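/- Let $\Bbbk$ be a field, let $\mathbf q=(q_{i,j})$ be an $n\times n$ matrix of nonzero elements of $\Bbbk$ with $q_{i,i}=1$ and $q_{i,j}q_{j,i}=1$, and let $Q=\Bbbk_{\mathbf q}[x_1,\dots,x_n]=\Bbbk\langle x_1,\dots,x_n\rangle/(x_ix_j-q_{i,j}x_jx_i)$ be the skew polynomial ring, graded by $\deg x_i=1$. Let $f_1,\dots,f_c\in Q$ be a regular sequence of normal homogeneous elements of positive degrees $\delta_1,\dots,\delta_c$: each $f_j$ has a graded normalizing automorphism $\sigma_j$ of $Q$ ($f_jy=\sigma_j(y)f_j$ for all $y$, $\sigma_j(f_j)=f_j$), and $f_j$ has zero annihilator modulo the two-sided ideal $(f_1,\dots,f_{j-1})$. Let $R=Q/(f_1,\dots,f_c)$ be the resulting skew complete intersection, and denote images in $R$ by bars. Let $G$ be the abelian group of automorphisms of $Q$ generated by the automorphisms $x_j\mapsto q_{i,j}x_j$ ($1\le i\le n$), the $i$-th of which is called the colour of $x_i$. Let $\chi$ be the skew bicharacter of $G$ with $\chi(\mathrm{colour}\,x_i,\mathrm{colour}\,x_j)=q_{i,j}$. The ring $R$ is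 graded by internal degree and by colour. For a finite ordered set $Y$ of variables $y$, each with a positive homological degree $|y|$, an internal degree and a colour, $R\langle Y\rangle$ is the free left $R$-module on the ordered monomials in exterior variables ($|y|$ odd) and divided powers $y^{(i)}$ ($|y|$ even). Its product satisfies $ab=(-1)^{|a||b|}\chi(a,b)\,ba$ for trihomogeneous $a,b$ (homogeneous for the homological degree, the internal degree and the colour), and $y^{(i)}y^{(j)}=\binom{i+j}{i}y^{(i+j)}$ for $|y|$ even. Its differential $\partial$ is $R$-linear, satisfies the graded Leibniz rule and $\partial(y^{(i)})=\partial(y)y^{(i-1)}$, and is determined by the $\partial(y)$. The skew Koszul complex of $R$ is $K^R=R\langle y_1,\dots,y_n\mid\partial(y_i)=\bar x_i\rangle$, where $y_i$ has homological degree $1$ and the internal degree and colour of $x_i$; it is a colour DG algebra. Then elements $a_{i,j}\in Q$ with $f_j=\sum_{i=1}^n a_{i,j}x_i$ can be chosen so that each element $z_j=\sum_{i=1}^n\bar a_{i,j}y_i$ of $K^R$ ($1\le j\le c$) is trihomogeneous of internal degree $\delta_j$. Moreover, for every choice of $a_{i,j}\in Q$ with $f_j=\sum_i a_{i,j}x_i$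 for all $j$, the following hold. 1. The $z_j$ are cycles, and their classes generate the $R$-module $\mathrm H_1(K^R)$. 2. The Koszul homology algebra is a skew exterior algebra: there are a matrix $(p_{i,j})$ of nonzero elements of $\Bbbk$ with $p_{i,i}=1$ and $p_{i,j}p_{j,i}=1$, and an isomorphism of $\Bbbk$-algebras $\Bbbk_{\mathbf p}[e_1,\dots,e_c]/(e_1^2,\dots,e_c^2)\cong \mathrm H(K^R)$ that maps $e_j$ to the class of $z_j$ for each $j$. 3. Suppose that every $\delta_j\ge2$ and that each $z_j$ is trihomogeneous, of internal degree $\delta_j$ and some colour $g_j\in G$. Then $$R\langle Y\rangle=R\langle y_1,\dots,y_{n+c}\mid \partial(y_i)=\bar x_i\ (1\le i\le n),\ \partial(y_{n+j})=\textstyle\sum_{i=1}^n\bar a_{i,j}y_i\ (1\le j\le c)\rangle,$$ where $y_{n+j}$ is a divided power variable of homological degree $2$, internal degree $\delta_j$ and colour $g_j$, is an acyclic closure of $\Bbbk$ over $R$, where $\Bbbk$ is the quotient of $R$ by the $\bar x_i$. That is: it is a colour DG algebra; $\mathrm H_0(R\langle Y\rangle)=\Bbbk$ and $\mathrm H_m(R\langle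 Y\rangle)=0$ for $m\ge1$; the elements $\partial(y)$ with $|y|=1$ minimally generate the kernel of $R\to\Bbbk$; and for all $m\ge1$ the classes of the $\partial(y)$ with $|y|=m+1$ minimally generate $\mathrm H_m(R\langle Y_{\le m}\rangle)$, where $Y_{\le m}$ is the set of variables of homological degree at most $m$. -/

import Mathlib

noncomputable section

namespace SkewKoszul

universe u v w t

/-! ### Skew polynomial rings, their gradings and colours -/

/-- The relations `x_i x_j = q_{ij} x_j x_i`. -/
inductive SkewRel {k : Type u} [Field k] {n : ℕ} (q : Fin n → Fin n → kˣ) :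
    FreeAlgebra k (Fin n) → FreeAlgebra k (Fin n) → Prop
  | swap (i j : Fin n) : SkewRel q (FreeAlgebra.ι k i * FreeAlgebra.ι k j)
      ((q i j : k) • (FreeAlgebra.ι k j * FreeAlgebra.ι k i))

/-- The skew polynomial ring `k_q[x_1, …, x_n]`. -/
def SkewPoly {k : Type u} [Field k] {n : ℕ} (q : Fin n → Fin n → kˣ) : Type u :=
  RingQuot (SkewRel q)

instance {k : Type u} [Field k] {n : ℕ} (q : Fin n → Fin n → kˣ) : Ring (SkewPoly q) :=
  inferInstanceAs (Ring (RingQuot (SkewRel q)))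

instance {k : Type u} [Field k] {n : ℕ} (q : Fin n → Fin n → kˣ) : Algebra k (SkewPoly q) :=
  inferInstanceAs (Algebra k (RingQuot (SkewRel q)))

/-- The variable `x_i`. -/
def SkewPoly.x {k : Type u} [Field k] {n : ℕ} (q : Fin n → Fin n → kˣ) (i : Fin n) : SkewPoly q :=
  RingQuot.mkAlgHom k (SkewRel q) (FreeAlgebra.ι k i)

/-- The homogeneous component of degree `d`, every variable having degree one. -/
def SkewPoly.homog {k : Type u} [Field k] {n : ℕ} (q : Fin n → Fin n → kˣ) (d : ℕ) :
    Submodule k (SkewPoly q) :=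
  Submodule.span k {m | ∃ l : List (Fin n), l.length = d ∧ m = (l.map (SkewPoly.x q)).prod}

/-- The group of colours. A tuple `g` of units stands for the automorphism `x_j ↦ g_j x_j` of the
skew polynomial ring; the `i`-th row of `q` is then the normalizing automorphism of `x_i`, and the
group of colours is the subgroup generated by these. -/
abbrev ColorGroup {k : Type u} [Field k] {n : ℕ} (q : Fin n → Fin n → kˣ) : Type u :=
  Subgroup.closure (Set.range q)

/-- The colour of the variable `x_i`. -/
def rowColor {k : Type u} [Field k] {n : ℕ} (q : Fin n → Fin n → kˣ) (i : Fin n) : ColorGroup q :=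
  ⟨q i, Subgroup.subset_closure ⟨i, rfl⟩⟩

theorem exists_exponents {k : Type u} [Field k] {n : ℕ} (q : Fin n → Fin n → kˣ)
    (g : ColorGroup q) : ∃ m : Fin n → ℤ, g = ∏ i, rowColor q i ^ m i := by
  obtain ⟨g, hg⟩ := g
  induction hg using Subgroup.closure_induction with
  | mem x hx =>
    obtain ⟨i, rfl⟩ := hx
    refine ⟨Pi.single i 1, ?_⟩
    rw [Finset.prod_eq_single i]
    · simp [rowColor]
    · intro j _ hj
      simp [Pi.single_eq_of_ne hj]
    · simp
  | one => exact ⟨0, by simp⟩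
  | mul x y hx hy ihx ihy =>
    obtain ⟨a, ha⟩ := ihx
    obtain ⟨b, hb⟩ := ihy
    refine ⟨a + b, ?_⟩
    simp only [Pi.add_apply, zpow_add, Finset.prod_mul_distrib, ← ha, ← hb]
    rfl
  | inv x hx ih =>
    obtain ⟨a, ha⟩ := ih
    refine ⟨-a, ?_⟩
    simp only [Pi.neg_apply, zpow_neg, Finset.prod_inv_distrib, ← ha]
    rfl

/-- The skew bicharacter on the group of colours: if `h = ∏ (colour of x_j)^{m_j}`, then
`χ(g, h) = ∏ g_j^{m_j}`, so that `χ(colour of x_i, colour of x_j) = q_{ij}`.  For an antisymmetric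
matrix `q` the value does not depend on the exponents `m_j` that represent `h`. -/
def bichar {k : Type u} [Field k] {n : ℕ} (q : Fin n → Fin n → kˣ) (g h : ColorGroup q) : kˣ :=
  ∏ j, g.1 j ^ (exists_exponents q h).choose j

/-- The component of degree `d` and colour `g`: the span of the words of this degree and colour. -/
def SkewPoly.comp {k : Type u} [Field k] {n : ℕ} (q : Fin n → Fin n → kˣ) (d : ℕ)
    (g : ColorGroup q) : Submodule k (SkewPoly q) :=
  Submodule.span k {m | ∃ l : List (Fin n), l.length = d ∧ (l.map (rowColor q)).prod = g ∧
    m = (l.map (SkewPoly.x q)).prod}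

/-- Normal elements: `f y = σ(y) f` for all `y`, for a graded automorphism `σ` that fixes `f`. -/
def IsNormal {k : Type u} [Field k] {n : ℕ} {q : Fin n → Fin n → kˣ} (f : SkewPoly q) : Prop :=
  ∃ σ : SkewPoly q ≃ₐ[k] SkewPoly q,
    (∀ d, ∀ y ∈ SkewPoly.homog q d, σ y ∈ SkewPoly.homog q d) ∧
    (∀ y, f * y = σ y * f) ∧ σ f = f

/-- `f_i` has zero annihilator modulo the two-sided ideal generated by the earlier `f_j`. -/
def IsRegularSeq {k : Type u} [Field k] {n c : ℕ} {q : Fin n → Fin n → kˣ}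
    (f : Fin c → SkewPoly q) : Prop :=
  ∀ i, ∀ a : SkewPoly q, a * f i ∈ TwoSidedIdeal.span (f '' {j | j < i}) →
    a ∈ TwoSidedIdeal.span (f '' {j | j < i})

/-- The quotient of a skew polynomial ring by the two-sided ideal generated by the `f_j`. -/
def SkewQuot {k : Type u} [Field k] {n c : ℕ} {q : Fin n → Fin n → kˣ}
    (f : Fin c → SkewPoly q) : Type u :=
  (TwoSidedIdeal.span (Set.range f)).ringCon.Quotient

instance {k : Type u} [Field k] {n c : ℕ} {q : Fin n → Fin n → kˣ} (f : Fin c → SkewPoly q) :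
    Ring (SkewQuot f) :=
  inferInstanceAs (Ring (TwoSidedIdeal.span (Set.range f)).ringCon.Quotient)

instance {k : Type u} [Field k] {n c : ℕ} {q : Fin n → Fin n → kˣ} (f : Fin c → SkewPoly q) :
    Algebra k (SkewQuot f) :=
  inferInstanceAs (Algebra k (TwoSidedIdeal.span (Set.range f)).ringCon.Quotient)

/-- The projection `Q → R`, `a ↦ ā`. -/
def SkewQuot.mk {k : Type u} [Field k] {n c : ℕ} {q : Fin n → Fin n → kˣ}
    (f : Fin c → SkewPoly q) : SkewPoly q →ₐ[k] SkewQuot f where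
  toRingHom := (TwoSidedIdeal.span (Set.range f)).ringCon.mk'
  commutes' _ := rfl

/-- The image of the variable `x_i`. -/
def SkewQuot.x {k : Type u} [Field k] {n c : ℕ} {q : Fin n → Fin n → kˣ}
    (f : Fin c → SkewPoly q) (i : Fin n) : SkewQuot f :=
  SkewQuot.mk f (SkewPoly.x q i)

/-- The skew exterior algebra `k_p[e_1, …, e_c] / (e_1², …, e_c²)`. -/
abbrev SkewExterior {k : Type u} [Field k] {c : ℕ} (p : Fin c → Fin c → kˣ) : Type u :=
  SkewQuot (fun i : Fin c => SkewPoly.x p i ^ 2)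

/-! ### Colour DG algebras and their homology algebras -/

/-- Skew bicharacters of an abelian group. -/
structure IsSkewBichar {k : Type u} [Field k] {G : Type v} [CommGroup G] (χ : G → G → kˣ) :
    Prop where
  mul_right : ∀ a b c, χ a (b * c) = χ a b * χ a c
  antisymm : ∀ a b, χ a b = (χ b a)⁻¹
  self : ∀ a, χ a a = 1

/-- `A` is a `χ`-colour DG algebra with components `𝒜 h e g` of homological degree `h`, internal
degree `e` and colour `g`, and with differential `d`. -/
structure IsColorDGA {k : Type u} [Field k] {G : Type v} [CommGroup G] {A : Type w} [Ring A]
    [Algebra k A] (χ : G → G → kˣ) (𝒜 : ℕ → ℕ → G → Submodule k A) (d : A →ₗ[k] A) : Prop where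
  isSkewBichar : IsSkewBichar χ
  independent : iSupIndep (fun s : ℕ × ℕ × G => 𝒜 s.1 s.2.1 s.2.2)
  spans : ⨆ s : ℕ × ℕ × G, 𝒜 s.1 s.2.1 s.2.2 = ⊤
  one_mem : 1 ∈ 𝒜 0 0 1
  mul_mem : ∀ {h e g h' e' g' a b}, a ∈ 𝒜 h e g → b ∈ 𝒜 h' e' g' →
    a * b ∈ 𝒜 (h + h') (e + e') (g * g')
  d_mem : ∀ {h e g a}, a ∈ 𝒜 (h + 1) e g → d a ∈ 𝒜 h e g
  d_zero : ∀ {e g a}, a ∈ 𝒜 0 e g → d a = 0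
  d_d : ∀ a, d (d a) = 0
  leibniz : ∀ {h e g a}, a ∈ 𝒜 h e g → ∀ b, d (a * b) = d a * b + (-1) ^ h * (a * d b)
  color_comm : ∀ {h e g h' e' g' a b}, a ∈ 𝒜 h e g → b ∈ 𝒜 h' e' g' →
    a * b = ((-1) ^ (h * h') * (χ g g' : k)) • (b * a)
  sq_zero : ∀ {h e g a}, Odd h → a ∈ 𝒜 h e g → a * a = 0

theorem IsColorDGA.d_mul_cycle {k : Type u} [Field k] {G : Type v} [CommGroup G] {A : Type w}
    [Ring A] [Algebra k A] {χ : G → G → kˣ} {𝒜 : ℕ → ℕ → G → Submodule k A} {d : A →ₗ[k] A}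
    (H : IsColorDGA χ 𝒜 d) (a : A) {b : A} (hb : d b = 0) : d (a * b) = d a * b := by
  have ha : a ∈ ⨆ s : ℕ × ℕ × G, 𝒜 s.1 s.2.1 s.2.2 := by rw [H.spans]; trivial
  induction ha using Submodule.iSup_induction' with
  | mem s x hx => simp [H.leibniz hx b, hb]
  | zero => simp
  | add x y _ _ hx hy => simp [add_mul, hx, hy]

/-- The algebra of cycles. -/
def IsColorDGA.cycleAlg {k : Type u} [Field k] {G : Type v} [CommGroup G] {A : Type w}
    [Ring A] [Algebra k A] {χ : G → G → kˣ} {𝒜 : ℕ → ℕ → G → Submodule k A} {d : A →ₗ[k] A}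
    (H : IsColorDGA χ 𝒜 d) : Subalgebra k A where
  carrier := {a | d a = 0}
  mul_mem' {a b} ha hb := by
    simp only [Set.mem_ofPred_eq] at ha hb ⊢
    rw [H.d_mul_cycle a hb, ha, zero_mul]
  add_mem' {a b} ha hb := by
    simp only [Set.mem_ofPred_eq] at ha hb ⊢
    rw [map_add, ha, hb, add_zero]
  algebraMap_mem' r := by
    simp only [Set.mem_ofPred_eq, Algebra.algebraMap_eq_smul_one, map_smul, H.d_zero H.one_mem,
      smul_zero]

/-- The homology algebra: the quotient of the algebra of cycles by its two-sided ideal of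
boundaries. -/
abbrev IsColorDGA.HomologyAlg {k : Type u} [Field k] {G : Type v} [CommGroup G] {A : Type w}
    [Ring A] [Algebra k A] {χ : G → G → kˣ} {𝒜 : ℕ → ℕ → G → Submodule k A} {d : A →ₗ[k] A}
    (H : IsColorDGA χ 𝒜 d) : Type w :=
  RingQuot (fun a b : H.cycleAlg => ∃ y : A, (a : A) = b + d y)

/-- The homology class of a cycle. -/
def IsColorDGA.cls {k : Type u} [Field k] {G : Type v} [CommGroup G] {A : Type w}
    [Ring A] [Algebra k A] {χ : G → G → kˣ} {𝒜 : ℕ → ℕ → G → Submodule k A} {d : A →ₗ[k] A}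
    (H : IsColorDGA χ 𝒜 d) : H.cycleAlg →ₐ[k] H.HomologyAlg :=
  RingQuot.mkAlgHom k _

/-! ### Adjoining exterior and divided power variables -/

/-- A bicharacter, a bigrading by internal degree and colour on `R`, and for each colour `g` the
automorphism of `R` by which (elements and variables of) colour `g` move past elements of `R`. -/
structure ColorData (k : Type u) [Field k] (G : Type v) [CommGroup G] (R : Type w) [Ring R]
    [Algebra k R] where
  χ : G → G → kˣ
  comp : ℕ → G → Submodule k R
  aut : G →* (R ≃ₐ[k] R)

/-- A family of variables: their homological degrees, internal degrees and colours. -/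
structure Vars (G : Type v) (ι : Type t) where
  hdeg : ι → ℕ
  ideg : ι → ℕ
  color : ι → G

/-- Exponents of the normal monomials `∏ y_v^{(I_v)}`, the product being taken in increasing order:
variables of odd homological degree have exponent at most one. -/
@[ext]
structure Mon {G : Type v} {ι : Type t} (V : Vars G ι) : Type t where
  exp : ι → ℕ
  exp_le : ∀ v, Odd (V.hdeg v) → exp v ≤ 1

namespace Mon

variable {G : Type v} [CommGroup G] {ι : Type t} {V : Vars G ι}

/-- The exponents of the monomial `1`. -/
def one (V : Vars G ι) : Mon V := ⟨0, fun _ _ => Nat.zero_le _⟩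

/-- A monomial that divides `I`. -/
def sub (I : Mon V) (J : ι → ℕ) (h : ∀ v, J v ≤ I.exp v) : Mon V :=
  ⟨J, fun v hv => (h v).trans (I.exp_le v hv)⟩

/-- The variable `y_v`. -/
def var [DecidableEq ι] (V : Vars G ι) (v : ι) : Mon V :=
  ⟨Pi.single v 1, fun w _ => by
    by_cases h : w = v
    · subst h; simp
    · simp [Pi.single_eq_of_ne h]⟩

/-- The part of `I` in the variables before `v`. -/
def before [LinearOrder ι] (I : Mon V) (v : ι) : Mon V :=
  I.sub (fun w => if w < v then I.exp w else 0) (fun w => by split_ifs <;> simp)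

/-- The part of `I` in `v` and the variables after it, with the exponent of `v` lowered by one. -/
def afterPred [LinearOrder ι] (I : Mon V) (v : ι) : Mon V :=
  I.sub (fun w => if w = v then I.exp w - 1 else if v < w then I.exp w else 0)
    (fun w => by split_ifs <;> simp)

/-- The product of two monomials is not forced to vanish by the square of an odd variable. -/
def Compat (I J : Mon V) : Prop := ∀ v, Odd (V.hdeg v) → I.exp v + J.exp v ≤ 1

/-- The sum of the exponents. -/
def add (I J : Mon V) (h : I.Compat J) : Mon V := ⟨fun v => I.exp v + J.exp v, h⟩

variable [Fintype ι]

/-- Homological degree of a monomial. -/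
def hdeg (I : Mon V) : ℕ := ∑ v, I.exp v * V.hdeg v

/-- Internal degree of a monomial. -/
def ideg (I : Mon V) : ℕ := ∑ v, I.exp v * V.ideg v

/-- Colour of a monomial. -/
def color (I : Mon V) : G := ∏ v, V.color v ^ I.exp v

end Mon

section SemiFree

set_option linter.unusedSectionVars false

variable {k : Type u} [Field k] {G : Type v} [CommGroup G] {R : Type w} [Ring R] [Algebra k R]
variable {ι : Type t} [Fintype ι] [LinearOrder ι]

/-- The algebra `R⟨Y⟩`: the free left `R`-module on the normal monomials in `Y`. -/
def SemiFree (_C : ColorData k G R) (V : Vars G ι) : Type (max t w) := Mon V →₀ R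

/-- The scalar `α` in `y^{(I)} y^{(J)} = α y^{(I+J)}`. It comes from
`y_v^{(i)} y_v^{(j)} = binom(i+j, i) y_v^{(i+j)}` and from
`y_v y_w = (-1)^{|v||w|} χ(v, w) y_w y_v`, applied to the pairs with `w < v`. -/
def structConst (C : ColorData k G R) {V : Vars G ι} (I J : Mon V) : k :=
  (∏ v, ((I.exp v + J.exp v).choose (I.exp v) : k)) *
    ∏ v, ∏ w, if w < v then
      ((-1) ^ (V.hdeg v * V.hdeg w) * (C.χ (V.color v) (V.color w) : k)) ^ (I.exp v * J.exp w) else 1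

namespace SemiFree

variable {C : ColorData k G R} {V : Vars G ι}

instance : AddCommGroup (SemiFree C V) := inferInstanceAs (AddCommGroup (Mon V →₀ R))
instance : Module R (SemiFree C V) := inferInstanceAs (Module R (Mon V →₀ R))
instance : Module k (SemiFree C V) := inferInstanceAs (Module k (Mon V →₀ R))
instance : IsScalarTower k R (SemiFree C V) := inferInstanceAs (IsScalarTower k R (Mon V →₀ R))

/-- `r y^{(I)}` -/
def term (C : ColorData k G R) {V : Vars G ι} (I : Mon V) (r : R) : SemiFree C V :=
  Finsupp.single I r

theorem term_zero (I : Mon V) : term C I 0 = 0 := Finsupp.single_zero I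

theorem term_add (I : Mon V) (r s : R) : term C I (r + s) = term C I r + term C I s :=
  Finsupp.single_add I r s

theorem smul_term (a : k) (I : Mon V) (r : R) : a • term C I r = term C I (a • r) :=
  Finsupp.smul_single a I r

theorem induction {p : SemiFree C V → Prop} (a : SemiFree C V) (zero : p 0)
    (add : ∀ a b, p a → p b → p (a + b)) (term : ∀ I r, p (term C I r)) : p a :=
  Finsupp.induction_linear a zero add term

open Classical in
/-- The product `(r y^{(I)}) (s y^{(J)})`, given `m = r σ(s)` where `y^{(I)} s = σ(s) y^{(I)}`. -/
def mulTerm (C : ColorData k G R) {V : Vars G ι} (I J : Mon V) (m : R) : SemiFree C V :=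
  if h : I.Compat J then term C (I.add J h) (structConst C I J • m) else 0

theorem mulTerm_zero (I J : Mon V) : mulTerm C I J 0 = 0 := by
  unfold mulTerm; split_ifs <;> simp [term_zero]

theorem mulTerm_add (I J : Mon V) (r s : R) :
    mulTerm C I J (r + s) = mulTerm C I J r + mulTerm C I J s := by
  unfold mulTerm; split_ifs <;> simp [term_add]

theorem smul_mulTerm (a : k) (I J : Mon V) (r : R) :
    a • mulTerm C I J r = mulTerm C I J (a • r) := by
  unfold mulTerm; split_ifs
  · rw [smul_term, smul_comm]
  · simp

instance : Mul (SemiFree C V) :=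
  ⟨fun a b => Finsupp.sum (α := Mon V) (M := R) a fun I r =>
    Finsupp.sum (α := Mon V) (M := R) b fun J s => mulTerm C I J (r * C.aut I.color s)⟩

instance : One (SemiFree C V) := ⟨term C (Mon.one V) 1⟩

theorem mul_def (a b : SemiFree C V) : a * b = Finsupp.sum (α := Mon V) (M := R) a fun I r =>
    Finsupp.sum (α := Mon V) (M := R) b fun J s => mulTerm C I J (r * C.aut I.color s) := rfl

theorem one_def : (1 : SemiFree C V) = term C (Mon.one V) 1 := rfl

theorem term_mul_term (I J : Mon V) (r s : R) :
    term C I r * term C J s = mulTerm C I J (r * C.aut I.color s) := by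
  rw [mul_def, term, term, Finsupp.sum_single_index, Finsupp.sum_single_index]
  · rw [map_zero, mul_zero, mulTerm_zero]
  · rw [Finsupp.sum_single_index] <;> simp [mulTerm_zero]

protected theorem zero_mul' (a : SemiFree C V) : 0 * a = 0 := Finsupp.sum_zero_index

protected theorem mul_zero' (a : SemiFree C V) : a * 0 = 0 := by
  rw [mul_def]
  exact Finset.sum_eq_zero fun I _ => Finsupp.sum_zero_index

protected theorem add_mul' (a b c : SemiFree C V) : (a + b) * c = a * c + b * c := by
  rw [mul_def, mul_def, mul_def]
  refine Finsupp.sum_add_index' (fun I => ?_) (fun I r s => ?_)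
  · exact Finset.sum_eq_zero fun J _ => by simp [mulTerm_zero]
  · simp only [add_mul, mulTerm_add]
    exact Finsupp.sum_add

protected theorem mul_add' (a b c : SemiFree C V) : a * (b + c) = a * b + a * c := by
  rw [mul_def, mul_def, mul_def]
  refine Eq.trans (Finsupp.sum_congr fun I _ => ?_) Finsupp.sum_add
  refine Finsupp.sum_add_index' (fun J => ?_) (fun J r s => ?_)
  · simp [mulTerm_zero]
  · simp only [map_add, mul_add, mulTerm_add]

theorem structConst_one_left (J : Mon V) : structConst C (Mon.one V) J = 1 := by
  simp [structConst, Mon.one]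

theorem structConst_one_right (I : Mon V) : structConst C I (Mon.one V) = 1 := by
  simp [structConst, Mon.one]

theorem structConst_assoc (I J K : Mon V) (h : I.Compat J) (h' : J.Compat K) :
    structConst C I J * structConst C (I.add J h) K =
      structConst C J K * structConst C I (J.add K h') := by
  have hb : ∀ i j l : ℕ, (((i + j).choose i : k)) * ((i + j + l).choose (i + j) : k) =
      ((j + l).choose j : k) * ((i + (j + l)).choose i : k) := by
    intro i j l
    have := Nat.choose_mul (n := i + j + l) (k := i + j) (s := i) (by omega)
    rw [show i + j + l - i = j + l by omega, show i + j - i = j by omega] at this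
    rw [← add_assoc, ← Nat.cast_mul, ← Nat.cast_mul, mul_comm, this, mul_comm]
  unfold structConst
  simp only [Mon.add]
  have e1 : ∀ a b c d : k, a * b * (c * d) = (a * c) * (b * d) := by intros; ring
  rw [e1, e1 (∏ v, ((J.exp v + K.exp v).choose (J.exp v) : k))]
  refine congrArg₂ (· * ·) ?_ ?_
  · rw [← Finset.prod_mul_distrib, ← Finset.prod_mul_distrib]
    exact Finset.prod_congr rfl fun v _ => hb _ _ _
  · simp only [← Finset.prod_mul_distrib]
    refine Finset.prod_congr rfl fun v _ => Finset.prod_congr rfl fun w _ => ?_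
    split_ifs
    · rw [← pow_add, ← pow_add]
      congr 1
      ring
    · rfl

theorem color_add (I J : Mon V) (h : I.Compat J) : (I.add J h).color = I.color * J.color := by
  simp [Mon.color, Mon.add, pow_add, Finset.prod_mul_distrib]

theorem color_one : (Mon.one V).color = 1 := by
  simp [Mon.color, Mon.one]

protected theorem one_mul' (a : SemiFree C V) : 1 * a = a := by
  induction a using SemiFree.induction with
  | zero => exact SemiFree.mul_zero' 1
  | add a b ha hb => rw [SemiFree.mul_add', ha, hb]
  | term I r =>
    have h : (Mon.one V).Compat I := fun v hv => by simpa [Mon.one] using I.exp_le v hv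
    rw [one_def, term_mul_term, mulTerm, dif_pos h, structConst_one_left, color_one]
    have : (Mon.one V).add I h = I := Mon.ext (by simp [Mon.add, Mon.one])
    simp [this]

protected theorem mul_one' (a : SemiFree C V) : a * 1 = a := by
  induction a using SemiFree.induction with
  | zero => exact SemiFree.zero_mul' 1
  | add a b ha hb => rw [SemiFree.add_mul', ha, hb]
  | term I r =>
    have h : I.Compat (Mon.one V) := fun v hv => by simpa [Mon.one] using I.exp_le v hv
    rw [one_def, term_mul_term, mulTerm, dif_pos h, structConst_one_right]
    have : I.add (Mon.one V) h = I := Mon.ext (by simp [Mon.add, Mon.one])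
    simp [this]

protected theorem mul_assoc' (a b c : SemiFree C V) : a * b * c = a * (b * c) := by
  induction a using SemiFree.induction with
  | zero => simp only [SemiFree.zero_mul']
  | add a a' h h' => simp only [SemiFree.add_mul', h, h']
  | term I r =>
  induction b using SemiFree.induction with
  | zero => simp only [SemiFree.zero_mul', SemiFree.mul_zero']
  | add a a' h h' => simp only [SemiFree.add_mul', SemiFree.mul_add', h, h']
  | term J s =>
  induction c using SemiFree.induction with
  | zero => simp only [SemiFree.mul_zero']
  | add a a' h h' => simp only [SemiFree.mul_add', h, h']
  | term K x =>
    rw [term_mul_term, term_mul_term]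
    by_cases h : ∀ v, Odd (V.hdeg v) → I.exp v + J.exp v + K.exp v ≤ 1
    · have h1 : I.Compat J := fun v hv => (Nat.le_add_right _ _).trans (h v hv)
      have h2 : J.Compat K := fun v hv =>
        (by have := h v hv; omega : J.exp v + K.exp v ≤ 1)
      have h3 : (I.add J h1).Compat K := h
      have h4 : I.Compat (J.add K h2) := fun v hv => by
        have := h v hv; simp only [Mon.add]; omega
      rw [mulTerm, dif_pos h1, mulTerm, dif_pos h2, term_mul_term, term_mul_term, mulTerm, dif_pos h3,
        mulTerm,
        dif_pos h4, color_add, map_mul]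
      have e : (I.add J h1).add K h3 = I.add (J.add K h2) h4 :=
        Mon.ext (by funext v; simp [Mon.add, add_assoc])
      rw [e]
      congr 1
      simp only [map_smul, map_mul, AlgEquiv.mul_apply, smul_mul_assoc, mul_smul_comm, smul_smul,
        mul_assoc]
      rw [mul_comm (structConst C (I.add J h1) K), structConst_assoc I J K h1 h2, mul_comm]
    · have l : mulTerm C I J (r * C.aut I.color s) * term C K x = 0 := by
        unfold mulTerm
        split_ifs with h1
        · rw [term_mul_term, mulTerm, dif_neg]
          exact h
        · exact SemiFree.zero_mul' _
      have r' : term C I r * mulTerm C J K (s * C.aut J.color x) = 0 := by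
        unfold mulTerm
        split_ifs with h1
        · rw [term_mul_term, mulTerm, dif_neg]
          intro h2
          exact h fun v hv => by have := h2 v hv; simp only [Mon.add] at this; omega
        · exact SemiFree.mul_zero' _
      rw [l, r']

instance : Ring (SemiFree C V) :=
  { (inferInstance : AddCommGroup (SemiFree C V)) with
    mul := (· * ·)
    one := 1
    zero_mul := SemiFree.zero_mul'
    mul_zero := SemiFree.mul_zero'
    left_distrib := SemiFree.mul_add'
    right_distrib := SemiFree.add_mul'
    one_mul := SemiFree.one_mul'
    mul_one := SemiFree.mul_one'
    mul_assoc := SemiFree.mul_assoc' }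

instance : Algebra k (SemiFree C V) :=
  Algebra.ofModule
    (fun x a b => by
      induction a using SemiFree.induction with
      | zero => simp
      | add a a' h h' => simp only [smul_add, add_mul, h, h']
      | term I r =>
      induction b using SemiFree.induction with
      | zero => simp
      | add a a' h h' => simp only [smul_add, mul_add, h, h']
      | term J s => rw [smul_term, term_mul_term, term_mul_term, smul_mulTerm, smul_mul_assoc])
    (fun x a b => by
      induction a using SemiFree.induction with
      | zero => simp
      | add a a' h h' => simp only [smul_add, add_mul, h, h']
      | term I r =>
      induction b using SemiFree.induction with
      | zero => simp
      | add a a' h h' => simp only [smul_add, mul_add, h, h']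
      | term J s =>
        rw [smul_term, term_mul_term, term_mul_term, smul_mulTerm, map_smul, mul_smul_comm])

/-- The inclusion of `R`, as a map of left `R`-modules. -/
def incl (C : ColorData k G R) (V : Vars G ι) : R →ₗ[R] SemiFree C V :=
  Finsupp.lsingle (Mon.one V)

/-- The variable `y_v`. -/
def var (C : ColorData k G R) (V : Vars G ι) (v : ι) : SemiFree C V := term C (Mon.var V v) 1

/-- The component of homological degree `h`, internal degree `e` and colour `g`. -/
def comp (C : ColorData k G R) (V : Vars G ι) (h e : ℕ) (g : G) : Submodule k (SemiFree C V) :=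
  Submodule.span k {a | ∃ (I : Mon V) (e' : ℕ) (g' : G), ∃ r ∈ C.comp e' g',
    I.hdeg = h ∧ e' + I.ideg = e ∧ g' * I.color = g ∧ a = term C I r}

/-- The differential of a normal monomial, if `∂(y_v) = z_v`: the Leibniz rule with
`∂(y_v^{(i)}) = z_v y_v^{(i-1)}`. -/
def dMon (z : ι → SemiFree C V) (I : Mon V) : SemiFree C V :=
  ∑ v, if I.exp v = 0 then 0 else
    (-1) ^ (I.before v).hdeg * term C (I.before v) 1 * z v * term C (I.afterPred v) 1

/-- The differential of `R⟨Y | ∂(y_v) = z_v⟩`. -/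
def d (z : ι → SemiFree C V) : SemiFree C V →ₗ[R] SemiFree C V :=
  Finsupp.linearCombination R (dMon z)

/-- The elements of homological degree `m` of `R⟨S⟩`, for a set `S` of variables. -/
def part (C : ColorData k G R) (V : Vars G ι) (S : Set ι) (m : ℕ) :
    Submodule R (SemiFree C V) :=
  Finsupp.supported R R {I : Mon V | I.hdeg = m ∧ ∀ v, v ∉ S → I.exp v = 0}

/-- The cycles of homological degree `m` of `R⟨S⟩`. -/
def cycles (z : ι → SemiFree C V) (S : Set ι) (m : ℕ) : Submodule R (SemiFree C V) :=
  part C V S m ⊓ LinearMap.ker (d z)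

/-- The boundaries of homological degree `m` of `R⟨S⟩`. -/
def boundaries (z : ι → SemiFree C V) (S : Set ι) (m : ℕ) : Submodule R (SemiFree C V) :=
  (part C V S (m + 1)).map (d z)

/-- The `R`-module `H_m(R⟨S⟩)`. -/
abbrev Homology (z : ι → SemiFree C V) (S : Set ι) (m : ℕ) : Type (max t w) :=
  cycles z S m ⧸ (boundaries z S m).submoduleOf (cycles z S m)

/-- The `b_j` are cycles whose classes generate the `R`-module `H_m(R⟨S⟩)`. -/
def GeneratesHomology (z : ι → SemiFree C V) (S : Set ι) (m : ℕ) {κ : Type*}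
    (b : κ → SemiFree C V) : Prop :=
  ∃ hb : ∀ j, b j ∈ cycles z S m,
    Submodule.span R (Set.range fun j => (Submodule.Quotient.mk ⟨b j, hb j⟩ : Homology z S m)) = ⊤

/-- `R⟨Y | ∂(y_v) = z_v⟩` is an acyclic closure over `R` of the algebra `B`, where `ε : R → B`. -/
structure IsAcyclicClosure (z : ι → SemiFree C V) {B : Type*} [Ring B] [Algebra k B]
    (ε : R →ₐ[k] B) : Prop where
  /-- It is a colour DG algebra. -/
  isColorDGA : IsColorDGA C.χ (comp C V) ((d z).restrictScalars k)
  /-- The variables have positive homological degree. -/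
  hdeg_pos : ∀ v, 0 < V.hdeg v
  /-- The map to `B` is surjective. -/
  surjective : Function.Surjective ε
  /-- The differentials of the variables of degree one generate the kernel of `R → B`. -/
  gen_zero : Submodule.span R (Set.range fun v : {v // V.hdeg v = 1} => d z (var C V v)) =
    Submodule.map (incl C V) (RingHom.ker ε)
  /-- They do so minimally. -/
  min_zero : ∀ v₀ : {v // V.hdeg v = 1},
    Submodule.span R (Set.range fun v : {v : {v // V.hdeg v = 1} // v ≠ v₀} =>
      d z (var C V v)) ≠ Submodule.map (incl C V) (RingHom.ker ε)
  /-- The differentials of the variables of degree `m + 1` generate the `m`-th homology of the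
  subalgebra on the variables of degree at most `m`. -/
  gen_succ : ∀ m, 1 ≤ m → GeneratesHomology z {v | V.hdeg v ≤ m} m
    (fun v : {v // V.hdeg v = m + 1} => d z (var C V v))
  /-- They do so minimally. -/
  min_succ : ∀ m, 1 ≤ m → ∀ v₀ : {v // V.hdeg v = m + 1},
    ¬ GeneratesHomology z {v | V.hdeg v ≤ m} m
      (fun v : {v : {v // V.hdeg v = m + 1} // v ≠ v₀} => d z (var C V v))
  /-- It is a resolution of `B`: in degree zero the cokernel of the differential is `B`. -/
  homology_zero : boundaries z Set.univ 0 = Submodule.map (incl C V) (RingHom.ker ε)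
  /-- It is a resolution of `B`: the homology in positive degrees vanishes. -/
  homology_pos : ∀ m, 1 ≤ m → Subsingleton (Homology z Set.univ m)

end SemiFree

end SemiFree

/-! ### The skew Koszul complex and the extension by divided power variables -/

section Koszul

variable {k : Type u} [Field k] {n c : ℕ} {q : Fin n → Fin n → kˣ}

open Classical in
/-- The action of the colours on `R = Q/(f_1, …, f_c)` by `g · x̄_i = g_i x̄_i`. It exists (and is
unique) when the ideal is generated by normal homogeneous elements; otherwise the value is the
trivial action. -/
def colorAct (f : Fin c → SkewPoly q) : ColorGroup q →* (SkewQuot f ≃ₐ[k] SkewQuot f) :=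
  if h : ∃ φ : ColorGroup q →* (SkewQuot f ≃ₐ[k] SkewQuot f),
      ∀ g i, φ g (SkewQuot.x f i) = (g.1 i : k) • SkewQuot.x f i
  then h.choose else 1

/-- The bicharacter, the gradings and the action of the colours on `R = Q/(f_1, …, f_c)`. -/
def colorData (f : Fin c → SkewPoly q) : ColorData k (ColorGroup q) (SkewQuot f) where
  χ := bichar q
  comp d g := (SkewPoly.comp q d g).map (SkewQuot.mk f).toLinearMap
  aut := colorAct f

/-- The variables `y_1, …, y_n` of the Koszul complex: `y_i` has homological degree one, and the
internal degree and colour of `x_i`. -/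
def koszulVars (q : Fin n → Fin n → kˣ) : Vars (ColorGroup q) (Fin n) where
  hdeg _ := 1
  ideg _ := 1
  color i := rowColor q i

/-- The underlying algebra of the Koszul complex `R⟨y_1, …, y_n | ∂(y_i) = x̄_i⟩` of `R`. -/
abbrev Koszul (f : Fin c → SkewPoly q) : Type u := SemiFree (colorData f) (koszulVars q)

/-- The elements `∂(y_i) = x̄_i`. -/
def koszulZ (f : Fin c → SkewPoly q) (i : Fin n) : Koszul f :=
  SemiFree.incl (colorData f) (koszulVars q) (SkewQuot.x f i)

/-- The elements `∑_i ā_{ij} y_i` of the Koszul complex. -/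
def koszulCycle (f : Fin c → SkewPoly q) (a : Fin n → Fin c → SkewPoly q) (j : Fin c) : Koszul f :=
  ∑ i, SkewQuot.mk f (a i j) • SemiFree.var (colorData f) (koszulVars q) i

/-- The variables `y_1, …, y_{n+c}`: the first `n` are those of the Koszul complex, and `y_{n+j}`
has homological degree two, internal degree `δ_j` and colour `g_j`. -/
def tateVars (q : Fin n → Fin n → kˣ) (δ : Fin c → ℕ) (g : Fin c → ColorGroup q) :
    Vars (ColorGroup q) (Fin (n + c)) where
  hdeg := Fin.append (fun _ => 1) (fun _ => 2)
  ideg := Fin.append (fun _ => 1) δ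
  color := Fin.append (rowColor q) g

/-- The elements `∂(y_i) = x̄_i` for `i ≤ n` and `∂(y_{n+j}) = ∑_i ā_{ij} y_i` for `j ≤ c`. -/
def tateZ (f : Fin c → SkewPoly q) (a : Fin n → Fin c → SkewPoly q) (δ : Fin c → ℕ)
    (g : Fin c → ColorGroup q) : Fin (n + c) → SemiFree (colorData f) (tateVars q δ g) :=
  Fin.append
    (fun i => SemiFree.incl (colorData f) (tateVars q δ g) (SkewQuot.x f i))
    (fun j => ∑ i, SkewQuot.mk f (a i j) •
      SemiFree.var (colorData f) (tateVars q δ g) (Fin.castAdd c i))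

end Koszul

end SkewKoszul

end

open SkewKoszul

noncomputable section

namespace SkewKoszul

universe u v w t

/-! ### Well-behaved colour data -/

namespace IsSkewBichar

variable {k : Type u} [Field k] {G : Type v} [CommGroup G] {χ : G → G → kˣ}

/-! Write `Q` for the skew polynomial ring and `R` for its quotient. The words in the variables, one
for each multiset, form a basis of `Q` (`SkewPoly.basis`). Comparing coefficients in `f x_i = σ(x_i)
f` at words in which some variable occurs as often as possible shows that `f x_i` is a scalar
multiple of `x_i f`. Hence all words of `f` have the same colour, so that the `f_j` are homogeneous
for the colour too (`SkewPoly.exists_mem_comp_of_isNormal`). The grading by degree and colour, the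
action of the colours and colour commutativity therefore descend to `R` (`SkewQuot.good_colorData`).

In any algebra of the form `R⟨Y⟩` the differential is `∑ z_v ∂_v`, where `∂_v` is a left derivative.
Each `∂_v` is a twisted derivation by Pascal's rule (`leftDeriv_mul`), which gives the Leibniz rule.
The second order part of `d²` is antisymmetric and vanishes, so `d² = ∑ d(z_v) ∂_v` (`d_dMon`). Thus
`d² = 0` as soon as the `z_v` are cycles (`isColorDGA`).

The homology is computed without forming the intermediate rings `Q/(f_1, …, f_i)`. Everything takes
place in `Q⟨Y⟩`, whose map `d` need not have square zero, modulo the elements with coefficients in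
the ideal `(f_1, …, f_i)`. For `i = 0` this is the Koszul complex of `Q`. It resolves `k`, because
each `x_i` is regular modulo the left ideal of the earlier variables (`koszul_exact`). The inductive
step is `KillData`: if `f` is regular and `f = d z`, then multiplication by `f` is homotopic to
zero, and the long exact sequence gives `H(A/f) = H(A) ⊕ z H(A)`.

Applied repeatedly to the Koszul complex with `z = ∑ a_{ij} y_i`, this shows that the `2^c` ordered
products of the `z_j` form a `k`-basis of the homology modulo all `f_j` (`koszul_homology`). The
classes of the `z_j` square to zero and commute up to scalars, so they define a map from a skew
exterior algebra, whose squarefree monomials go to this basis (`exists_homology_equiv`). The classes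
do not depend on the `a_{ij}`, because two choices over `Q` differ by a cycle of degree one, hence
by a boundary (`exists_koszulCycle_eq`). Homogeneous coefficients may thus be used to find the
scalars.

For the acyclic closure the steps alternate. If the homology is `k` before `f_i` is killed, it is `k
⊕ k z_i` afterwards, and adjoining a divided power variable with boundary `z_i` brings it back to
`k` (`divided_power_step`, `tate_homology`). For minimality in homological degree one, the variables
of `R` annihilate the homology, so that a relation between the classes of the `z_j` may be reduced
to one with coefficients in `k` (`aug_eq_zero_of_sum_eq_dR`). In degree zero it is detected by a map
to the dual numbers, which exists because every `δ_j ≥ 2` (`x_notMem_span`).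

If only the images in `R` of the given `a_{ij}` are homogeneous, they are replaced by homogeneous
lifts. The prescribed colour must be that of `f_j`, since otherwise the class of `z_j` would vanish
(`exists_homogeneous_lift`). -/

theorem mul_left (H : IsSkewBichar χ) (a b c : G) : χ (a * b) c = χ a c * χ b c := by
  rw [H.antisymm, H.mul_right, mul_inv, ← H.antisymm, ← H.antisymm]

theorem one_right (H : IsSkewBichar χ) (a : G) : χ a 1 = 1 := by
  have := H.mul_right a 1 1
  rw [mul_one] at this
  exact mul_left_cancel (a := χ a 1) (by rw [mul_one]; exact this.symm)

theorem one_left (H : IsSkewBichar χ) (a : G) : χ 1 a = 1 := by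
  rw [H.antisymm, H.one_right, inv_one]

theorem pow_right (H : IsSkewBichar χ) (a b : G) (m : ℕ) : χ a (b ^ m) = χ a b ^ m := by
  induction m with
  | zero => simp [H.one_right]
  | succ m ih => rw [pow_succ, H.mul_right, ih, pow_succ]

theorem pow_left (H : IsSkewBichar χ) (a b : G) (m : ℕ) : χ (a ^ m) b = χ a b ^ m := by
  rw [H.antisymm, H.pow_right, H.antisymm a b, inv_pow]

theorem prod_right (H : IsSkewBichar χ) {ι : Type*} (s : Finset ι) (a : G) (b : ι → G) :
    χ a (∏ i ∈ s, b i) = ∏ i ∈ s, χ a (b i) := by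
  classical
  induction s using Finset.induction_on with
  | empty => simp [H.one_right]
  | insert i s hi ih => rw [Finset.prod_insert hi, H.mul_right, ih, Finset.prod_insert hi]

theorem prod_left (H : IsSkewBichar χ) {ι : Type*} (s : Finset ι) (a : G) (b : ι → G) :
    χ (∏ i ∈ s, b i) a = ∏ i ∈ s, χ (b i) a := by
  rw [H.antisymm, H.prod_right, ← Finset.prod_inv_distrib]
  exact Finset.prod_congr rfl fun i _ => (H.antisymm _ _).symm

theorem mul_swap (H : IsSkewBichar χ) (a b : G) : χ a b * χ b a = 1 := by
  rw [H.antisymm a b, inv_mul_cancel]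

end IsSkewBichar

/-- The algebra `R` is graded by internal degree and colour, it is colour commutative, and the
colours act through the bicharacter. -/
structure ColorData.Good {k : Type u} [Field k] {G : Type v} [CommGroup G] {R : Type w} [Ring R]
    [Algebra k R] (C : ColorData k G R) : Prop where
  bichar : IsSkewBichar C.χ
  one_mem : 1 ∈ C.comp 0 1
  mul_mem : ∀ {e g e' g' r s}, r ∈ C.comp e g → s ∈ C.comp e' g' → r * s ∈ C.comp (e + e') (g * g')
  spans : ⨆ s : ℕ × G, C.comp s.1 s.2 = ⊤
  proj : ∀ e g, ∃ p : R →ₗ[k] R, (∀ r ∈ C.comp e g, p r = r) ∧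
    ∀ e' g', (e', g') ≠ (e, g) → ∀ r ∈ C.comp e' g', p r = 0
  aut_apply : ∀ {e g'} (g : G) {r}, r ∈ C.comp e g' → C.aut g r = (C.χ g g' : k) • r
  comm : ∀ {e g e' g' r s}, r ∈ C.comp e g → s ∈ C.comp e' g' →
    r * s = (C.χ g g' : k) • (s * r)

theorem ColorData.Good.induction {k : Type u} [Field k] {G : Type v} [CommGroup G] {R : Type w}
    [Ring R] [Algebra k R] {C : ColorData k G R} (H : C.Good) {p : R → Prop} (r : R) (zero : p 0)
    (add : ∀ r s, p r → p s → p (r + s)) (mem : ∀ e g, ∀ r ∈ C.comp e g, p r) : p r := by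
  have ha : r ∈ ⨆ s : ℕ × G, C.comp s.1 s.2 := by rw [H.spans]; trivial
  induction ha using Submodule.iSup_induction' with
  | mem s x hx => exact mem _ _ x hx
  | zero => exact zero
  | add x y _ _ hx hy => exact add _ _ hx hy

/-- Commutation and the action of the colours agree on homogeneous `s`, and these span. Written with
the automorphism, the rule needs no homogeneity of `s`. -/
theorem ColorData.Good.comm_aut {k : Type u} [Field k] {G : Type v} [CommGroup G] {R : Type w}
    [Ring R] [Algebra k R] {C : ColorData k G R} (H : C.Good) {e : ℕ} {g : G} {r : R}
    (hr : r ∈ C.comp e g) (s : R) : r * s = C.aut g s * r := by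
  induction s using H.induction with
  | zero => simp
  | add s t hs ht => rw [mul_add, hs, ht, map_add, add_mul]
  | mem e' g' s hs => rw [H.comm hr hs, H.aut_apply g hs, smul_mul_assoc]

/-- The `i`-th projection fixes `M i` and kills the span of the other submodules, so an element of
both is zero. -/
theorem iSupIndep_of_proj {k : Type*} [Field k] {A ι : Type*} [AddCommGroup A] [Module k A]
    (M : ι → Submodule k A) (p : ι → A →ₗ[k] A) (h : ∀ i, ∀ a ∈ M i, p i a = a)
    (h' : ∀ i j, j ≠ i → ∀ a ∈ M j, p i a = 0) : iSupIndep M := by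
  intro i
  rw [Submodule.disjoint_def]
  intro x hx hx'
  have : ⨆ j, ⨆ (_ : j ≠ i), M j ≤ LinearMap.ker (p i) :=
    iSup₂_le fun j hj a ha => h' i j hj a ha
  rw [← h i x hx]
  exact this hx'

/-! ### The sign rule for normal monomials -/

section Braid

set_option linter.unusedSectionVars false

variable {k : Type u} [Field k] {G : Type v} [CommGroup G] {R : Type w} [Ring R] [Algebra k R]
variable {ι : Type t} [Fintype ι] [LinearOrder ι]

/-- The scalar `s` in `y_v y_w = s y_w y_v`. -/
def varSign (C : ColorData k G R) (V : Vars G ι) (v w : ι) : kˣ :=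
  (-1) ^ (V.hdeg v * V.hdeg w) * C.χ (V.color v) (V.color w)

/-- The scalar that moves the variables of `I` past the smaller variables of `J`. -/
def braid (C : ColorData k G R) (V : Vars G ι) (I J : ι → ℕ) : kˣ :=
  ∏ v, ∏ w, if w < v then varSign C V v w ^ (I v * J w) else 1

/-- The scalar that moves all the variables of `I` past all those of `J`. -/
def fullBraid (C : ColorData k G R) (V : Vars G ι) (I J : ι → ℕ) : kˣ :=
  ∏ v, ∏ w, varSign C V v w ^ (I v * J w)

/-- The scalar splits into a product of binomial coefficients, which is symmetric up to the symmetry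
of binomials, and a unit that is multiplicative in each exponent. All sign computations are carried
out with the unit. -/
theorem structConst_eq (C : ColorData k G R) {V : Vars G ι} (I J : Mon V) :
    structConst C I J =
      (∏ v, ((I.exp v + J.exp v).choose (I.exp v) : k)) * (braid C V I.exp J.exp : k) := by
  unfold structConst braid varSign
  push_cast
  congr 1
  refine Finset.prod_congr rfl fun v _ => Finset.prod_congr rfl fun w _ => ?_
  split_ifs <;> simp

variable {C : ColorData k G R} {V : Vars G ι}

theorem braid_add_left (I I' J : ι → ℕ) :
    braid C V (I + I') J = braid C V I J * braid C V I' J := by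
  unfold braid
  simp only [← Finset.prod_mul_distrib]
  refine Finset.prod_congr rfl fun v _ => Finset.prod_congr rfl fun w _ => ?_
  split_ifs
  · rw [← pow_add, Pi.add_apply, add_mul]
  · simp

theorem braid_add_right (I J J' : ι → ℕ) :
    braid C V I (J + J') = braid C V I J * braid C V I J' := by
  unfold braid
  simp only [← Finset.prod_mul_distrib]
  refine Finset.prod_congr rfl fun v _ => Finset.prod_congr rfl fun w _ => ?_
  split_ifs
  · rw [← pow_add, Pi.add_apply, mul_add]
  · simp

theorem braid_eq_one {I J : ι → ℕ} (h : ∀ v w, w < v → I v = 0 ∨ J w = 0) :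
    braid C V I J = 1 := by
  unfold braid
  refine Finset.prod_eq_one fun v _ => Finset.prod_eq_one fun w _ => ?_
  split_ifs with hvw
  · rcases h v w hvw with h | h <;> simp [h]
  · rfl

theorem varSign_swap (H : C.Good) (v w : ι) : varSign C V v w * varSign C V w v = 1 := by
  unfold varSign
  rw [mul_comm (V.hdeg w), mul_mul_mul_comm, H.bichar.mul_swap, mul_one, ← mul_pow]
  simp

theorem varSign_self (H : C.Good) (v : ι) : varSign C V v v = (-1) ^ V.hdeg v := by
  unfold varSign
  rw [H.bichar.self, mul_one, pow_mul]
  rcases Nat.even_or_odd (V.hdeg v) with h | h <;> simp [h]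

/-- Over all pairs of variables the signs and the bicharacter multiply up to those of the total
degrees and total colours, by bimultiplicativity. -/
theorem fullBraid_eq (H : C.Good) (I J : Mon V) :
    fullBraid C V I.exp J.exp = (-1) ^ (I.hdeg * J.hdeg) * C.χ I.color J.color := by
  unfold fullBraid varSign
  simp only [mul_pow, Finset.prod_mul_distrib]
  congr 1
  · simp only [← pow_mul, Finset.prod_pow_eq_pow_sum]
    congr 1
    rw [Mon.hdeg, Mon.hdeg, Finset.sum_mul_sum]
    refine Finset.sum_congr rfl fun v _ => Finset.sum_congr rfl fun w _ => by ring
  · rw [Mon.color, Mon.color, H.bichar.prod_left]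
    refine Finset.prod_congr rfl fun v _ => ?_
    rw [H.bichar.prod_right]
    refine Finset.prod_congr rfl fun w _ => ?_
    rw [H.bichar.pow_left, H.bichar.pow_right, ← pow_mul, mul_comm]

/-- Pairs with `w < v` form the first factor. Pairs with `v < w` form the second, because exchanging
two variables twice is the identity. The diagonal is the rest. -/
theorem fullBraid_eq_braid (H : C.Good) (I J : ι → ℕ) :
    fullBraid C V I J =
      braid C V I J * (braid C V J I)⁻¹ * ∏ v, varSign C V v v ^ (I v * J v) := by
  have e1 : (braid C V J I)⁻¹ =
      ∏ v, ∏ w, if v < w then varSign C V v w ^ (I v * J w) else 1 := by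
    unfold braid
    rw [Finset.prod_comm, ← Finset.prod_inv_distrib]
    refine Finset.prod_congr rfl fun v _ => ?_
    rw [← Finset.prod_inv_distrib]
    refine Finset.prod_congr rfl fun w _ => ?_
    split_ifs with h
    · rw [← inv_pow, eq_inv_of_mul_eq_one_left (varSign_swap H v w), mul_comm]
    · simp
  have e2 : ∏ v, varSign C V v v ^ (I v * J v) =
      ∏ v, ∏ w, if v = w then varSign C V v w ^ (I v * J w) else 1 := by
    refine Finset.prod_congr rfl fun v _ => ?_
    rw [Finset.prod_ite_eq]; simp
  rw [e1, e2]
  unfold braid fullBraid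
  simp only [← Finset.prod_mul_distrib]
  refine Finset.prod_congr rfl fun v _ => Finset.prod_congr rfl fun w _ => ?_
  rcases lt_trichotomy v w with h | h | h
  · simp [h, h.ne, h.not_gt]
  · subst h; simp
  · simp [h, h.ne', h.not_gt]

/-- The diagonal factor is trivial: an even variable commutes with itself, and compatible monomials
do not share an odd one. -/
theorem fullBraid_of_compat (H : C.Good) {I J : Mon V} (h : I.Compat J) :
    fullBraid C V I.exp J.exp = braid C V I.exp J.exp * (braid C V J.exp I.exp)⁻¹ := by
  rw [fullBraid_eq_braid H, Finset.prod_eq_one, mul_one]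
  intro v _
  rw [varSign_self H]
  rcases Nat.even_or_odd (V.hdeg v) with hv | hv
  · simp [hv]
  · have := h v hv
    have : I.exp v * J.exp v = 0 := by
      rw [mul_eq_zero]; omega
    simp [this]

/-- The scalar in `∂_v y^{(I)} = s y^{(I - v)}` where `∂_v` is the left derivative. -/
def derivSign (C : ColorData k G R) (V : Vars G ι) (v : ι) (I : ι → ℕ) : kˣ :=
  (braid C V (Pi.single v 1) I)⁻¹

theorem fullBraid_single (H : C.Good) (I : ι → ℕ) (v : ι) : fullBraid C V I (Pi.single v 1) =
    braid C V I (Pi.single v 1) * derivSign C V v I * varSign C V v v ^ I v := by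
  rw [fullBraid_eq_braid H, derivSign]
  congr 1
  rw [Finset.prod_eq_single v]
  · simp
  · intro w _ hw; simp [Pi.single_eq_of_ne hw]
  · simp

theorem derivSign_add (v : ι) (I J : ι → ℕ) :
    derivSign C V v (I + J) = derivSign C V v I * derivSign C V v J := by
  unfold derivSign; rw [braid_add_right, mul_inv]

theorem derivSign_congr {v : ι} {I J : ι → ℕ} (h : ∀ w, w < v → I w = J w) :
    derivSign C V v I = derivSign C V v J := by
  unfold derivSign braid
  congr 1
  refine Finset.prod_congr rfl fun v' _ => Finset.prod_congr rfl fun w _ => ?_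
  by_cases hv : v' = v
  · subst hv
    split_ifs with hw
    · rw [h w hw]
    · rfl
  · simp [Pi.single_eq_of_ne hv]

theorem derivSign_single (v w : ι) :
    derivSign C V v (Pi.single w 1) = if w < v then (varSign C V v w)⁻¹ else 1 := by
  unfold derivSign braid
  rw [Finset.prod_eq_single v, Finset.prod_eq_single w]
  · split_ifs <;> simp
  · intro b _ hb; simp [Pi.single_eq_of_ne hb]
  · simp
  · intro b _ hb; simp [Pi.single_eq_of_ne hb]
  · simp

end Braid

/-! ### Colour commutativity and the Leibniz rule -/

namespace Mon

set_option linter.unusedSectionVars false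

variable {G : Type v} [CommGroup G] {ι : Type t} {V : Vars G ι}

/-- The monomial with the exponent of `v` lowered by one. -/
def pred [DecidableEq ι] (I : Mon V) (v : ι) : Mon V :=
  I.sub (I.exp - Pi.single v 1) fun w => by simp

theorem hdeg_add [Fintype ι] (I J : Mon V) (h : I.Compat J) :
    (I.add J h).hdeg = I.hdeg + J.hdeg := by
  simp [hdeg, add, add_mul, Finset.sum_add_distrib]

theorem ideg_add [Fintype ι] (I J : Mon V) (h : I.Compat J) :
    (I.add J h).ideg = I.ideg + J.ideg := by
  simp [ideg, add, add_mul, Finset.sum_add_distrib]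

theorem pred_exp_add [DecidableEq ι] {I : Mon V} {v : ι} (h : I.exp v ≠ 0) :
    (I.pred v).exp + Pi.single v 1 = I.exp := by
  funext w
  simp only [pred, sub, Pi.add_apply, Pi.sub_apply]
  by_cases hw : w = v
  · subst hw; simp; omega
  · simp [Pi.single_eq_of_ne hw]

theorem pred_hdeg [Fintype ι] [DecidableEq ι] {I : Mon V} {v : ι} (h : I.exp v ≠ 0) :
    (I.pred v).hdeg + V.hdeg v = I.hdeg := by
  unfold hdeg
  rw [← pred_exp_add h]
  simp [add_mul, Finset.sum_add_distrib, Pi.single_apply]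

theorem pred_ideg [Fintype ι] [DecidableEq ι] {I : Mon V} {v : ι} (h : I.exp v ≠ 0) :
    (I.pred v).ideg + V.ideg v = I.ideg := by
  unfold ideg
  rw [← pred_exp_add h]
  simp [add_mul, Finset.sum_add_distrib, Pi.single_apply]

theorem pred_color [Fintype ι] [DecidableEq ι] {I : Mon V} {v : ι} (h : I.exp v ≠ 0) :
    (I.pred v).color * V.color v = I.color := by
  unfold color
  rw [← pred_exp_add h]
  simp only [Pi.add_apply, pow_add, Finset.prod_mul_distrib, Pi.single_apply, pow_ite, pow_one,
    pow_zero, Finset.prod_ite_eq', Finset.mem_univ, if_true]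

end Mon

namespace SemiFree

section

set_option linter.unusedSectionVars false

variable {k : Type u} [Field k] {G : Type v} [CommGroup G] {R : Type w} [Ring R] [Algebra k R]
variable {ι : Type t} [Fintype ι] [LinearOrder ι]
variable {C : ColorData k G R} {V : Vars G ι}

theorem smul_term' (a : R) (I : Mon V) (r : R) : a • term C I r = term C I (a * r) :=
  Finsupp.smul_single a I r

theorem smul_mulTerm' (a : R) (I J : Mon V) (r : R) :
    a • mulTerm C I J r = mulTerm C I J (a * r) := by
  unfold mulTerm; split_ifs
  · rw [smul_term', mul_smul_comm]
  · simp

instance : IsScalarTower R (SemiFree C V) (SemiFree C V) :=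
  ⟨fun x a b => by
    induction a using SemiFree.induction with
    | zero => simp
    | add a a' h h' => simp only [smul_add, smul_eq_mul, add_mul] at h h' ⊢; rw [h, h']
    | term I r =>
    induction b using SemiFree.induction with
    | zero => simp
    | add a a' h h' => simp only [smul_add, smul_eq_mul, mul_add] at h h' ⊢; rw [h, h']
    | term J s =>
      rw [smul_term', smul_eq_mul, smul_eq_mul, term_mul_term, term_mul_term, smul_mulTerm',
        mul_assoc]⟩

/-- The monomial `y^{(E)}`, which is zero if an exponent of an odd variable is too large. -/
def ymon (C : ColorData k G R) (V : Vars G ι) (E : ι → ℕ) : SemiFree C V :=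
  open Classical in if h : ∀ v, Odd (V.hdeg v) → E v ≤ 1 then term C ⟨E, h⟩ 1 else 0

theorem ymon_exp (I : Mon V) : ymon C V I.exp = term C I 1 := dif_pos I.exp_le

theorem term_eq_smul (I : Mon V) (r : R) : term C I r = r • term C I 1 := by
  rw [smul_term', mul_one]

/-- As `ymon` vanishes on inadmissible exponents, it absorbs the case distinction in the product. -/
theorem mulTerm_eq (I J : Mon V) (r : R) :
    mulTerm C I J r = structConst C I J • r • ymon C V (I.exp + J.exp) := by
  unfold mulTerm
  split_ifs with h
  · have : ymon C V (I.exp + J.exp) = term C (I.add J h) 1 := ymon_exp (I.add J h)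
    rw [this, ← term_eq_smul, smul_term]
  · have : ymon C V (I.exp + J.exp) = 0 := dif_neg h
    rw [this, smul_zero, smul_zero]

theorem term_mul_smul (I : Mon V) (s : R) (b : SemiFree C V) :
    term C I 1 * (s • b) = C.aut I.color s • (term C I 1 * b) := by
  induction b using SemiFree.induction with
  | zero => simp
  | add a a' h h' => simp only [smul_add, mul_add, h, h']
  | term J t =>
    rw [smul_term', term_mul_term, term_mul_term, smul_mulTerm', map_mul, one_mul, one_mul]

theorem mul_smul_of_mem_comp (H : C.Good) {h e : ℕ} {g : G} {a : SemiFree C V}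
    (ha : a ∈ comp C V h e g) (s : R) (b : SemiFree C V) :
    a * (s • b) = C.aut g s • (a * b) := by
  induction ha using Submodule.span_induction with
  | zero => simp
  | add x y _ _ hx hy => rw [add_mul, hx, hy, add_mul, smul_add]
  | smul c x _ hx => rw [smul_mul_assoc, hx, smul_mul_assoc, smul_comm]
  | mem x hx =>
    obtain ⟨I, e', g', r, hr, -, -, rfl, rfl⟩ := hx
    rw [term_eq_smul, smul_mul_assoc, term_mul_smul, smul_mul_assoc, smul_smul, smul_smul,
      H.comm_aut hr, map_mul]
    rfl

/-- On terms the two products have the same monomial. The structure constants differ by the scalar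
`fullBraid`, and the coefficients contribute the remaining factors of the bicharacter. -/
theorem color_comm_of_mem (H : C.Good) {h e h' e' : ℕ} {g g' : G} {a b : SemiFree C V}
    (ha : a ∈ comp C V h e g) (hb : b ∈ comp C V h' e' g') :
    a * b = ((-1) ^ (h * h') * (C.χ g g' : k)) • (b * a) := by
  induction ha using Submodule.span_induction with
  | zero => simp
  | add x y _ _ hx hy => rw [add_mul, hx, hy, mul_add, smul_add]
  | smul c x _ hx => rw [smul_mul_assoc, hx, mul_smul_comm, smul_comm]
  | mem x hx =>
  induction hb using Submodule.span_induction with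
  | zero => simp
  | add x y _ _ hx hy => rw [mul_add, hx, hy, add_mul, smul_add]
  | smul c x _ hx => rw [mul_smul_comm, hx, smul_mul_assoc, smul_comm]
  | mem y hy =>
    obtain ⟨I, e₁, g₁, r, hr, rfl, -, rfl, rfl⟩ := hx
    obtain ⟨J, e₂, g₂, s, hs, rfl, -, rfl, rfl⟩ := hy
    rw [term_mul_term, term_mul_term]
    by_cases hc : I.Compat J
    · have hc' : J.Compat I := fun v hv => by rw [add_comm]; exact hc v hv
      have e : J.add I hc' = I.add J hc := Mon.ext (by funext v; simp [Mon.add, add_comm])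
      rw [mulTerm, dif_pos hc, mulTerm, dif_pos hc', e, smul_term, H.aut_apply _ hs,
        H.aut_apply _ hr, mul_smul_comm, mul_smul_comm, H.comm hr hs]
      simp only [smul_smul]
      congr 2
      have hb := fullBraid_of_compat H hc
      rw [fullBraid_eq H] at hb
      have hb' := congrArg (Units.val) hb
      push_cast at hb'
      -- Of the four factors of the bicharacter on the left, the one for `g₁` and `J.color` cancels
      -- against the twist by which `y^{(J)}` passes `r`.
      have hχ : (C.χ (g₁ * I.color) (g₂ * J.color) : k) * C.χ J.color g₁ =
          C.χ g₁ g₂ * C.χ I.color g₂ * C.χ I.color J.color := by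
        rw [H.bichar.mul_left, H.bichar.mul_right, H.bichar.mul_right, H.bichar.antisymm J.color]
        push_cast
        field_simp
      have hbin : ∏ v, ((J.exp v + I.exp v).choose (J.exp v) : k) =
          ∏ v, ((I.exp v + J.exp v).choose (I.exp v) : k) :=
        Finset.prod_congr rfl fun v _ => by rw [add_comm, Nat.choose_symm_add]
      rw [structConst_eq, structConst_eq, hbin]
      have hne : (braid C V J.exp I.exp : k) ≠ 0 := Units.ne_zero _
      have hb2 : (braid C V I.exp J.exp : k) =
          (-1) ^ (I.hdeg * J.hdeg) * C.χ I.color J.color * braid C V J.exp I.exp := by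
        rw [hb', mul_assoc, inv_mul_cancel₀ hne, mul_one]
      rw [hb2]
      linear_combination -(∏ v, ((I.exp v + J.exp v).choose (I.exp v) : k)) *
        (braid C V J.exp I.exp : k) * (-1) ^ (I.hdeg * J.hdeg) * hχ
    · have hc' : ¬ J.Compat I := fun h => hc fun v hv => by rw [add_comm]; exact h v hv
      rw [mulTerm, dif_neg hc, mulTerm, dif_neg hc', smul_zero]

theorem term_mem_comp (I : Mon V) {e : ℕ} {g : G} {r : R} (hr : r ∈ C.comp e g) :
    term C I r ∈ comp C V I.hdeg (e + I.ideg) (g * I.color) :=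
  Submodule.subset_span ⟨I, e, g, r, hr, rfl, rfl, rfl, rfl⟩

theorem mon_mem_comp (H : C.Good) (I : Mon V) :
    term C I 1 ∈ comp C V I.hdeg I.ideg I.color := by
  simpa using term_mem_comp I H.one_mem

theorem mul_mem_comp (H : C.Good) {h e h' e' : ℕ} {g g' : G} {a b : SemiFree C V}
    (ha : a ∈ comp C V h e g) (hb : b ∈ comp C V h' e' g') :
    a * b ∈ comp C V (h + h') (e + e') (g * g') := by
  induction ha using Submodule.span_induction with
  | zero => simp
  | add x y _ _ hx hy => rw [add_mul]; exact add_mem hx hy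
  | smul c x _ hx => rw [smul_mul_assoc]; exact Submodule.smul_mem _ _ hx
  | mem x hx =>
  induction hb using Submodule.span_induction with
  | zero => simp
  | add x y _ _ hx hy => rw [mul_add]; exact add_mem hx hy
  | smul c x _ hx => rw [mul_smul_comm]; exact Submodule.smul_mem _ _ hx
  | mem y hy =>
    obtain ⟨I, e₁, g₁, r, hr, rfl, rfl, rfl, rfl⟩ := hx
    obtain ⟨J, e₂, g₂, s, hs, rfl, rfl, rfl, rfl⟩ := hy
    rw [term_mul_term, H.aut_apply _ hs]
    unfold mulTerm
    split_ifs with hc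
    · refine Submodule.subset_span ⟨I.add J hc, e₁ + e₂, g₁ * g₂, _, ?_, Mon.hdeg_add I J hc,
        ?_, ?_, rfl⟩
      · rw [mul_smul_comm]
        exact Submodule.smul_mem _ _ (Submodule.smul_mem _ _ (H.mul_mem hr hs))
      · rw [Mon.ideg_add]; ring
      · rw [color_add, mul_mul_mul_comm]
    · exact zero_mem _

theorem structConst_before_afterPred (I : Mon V) (v : ι) :
    structConst C (I.before v) (I.afterPred v) = 1 := by
  rw [structConst_eq, braid_eq_one, Finset.prod_eq_one, Units.val_one, mul_one]
  · intro w _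
    simp only [Mon.before, Mon.afterPred, Mon.sub]
    rcases lt_trichotomy w v with h | h | h
    · simp [h, h.ne, h.not_gt]
    · subst h; simp
    · simp [h.not_gt]
  · intro w' w hw
    simp only [Mon.before, Mon.afterPred, Mon.sub]
    by_cases h : w' < v
    · right
      have := hw.trans h
      simp [this.ne, this.not_gt]
    · simp [h]

theorem ymon_before_add_afterPred (I : Mon V) (v : ι) :
    (I.before v).exp + (I.afterPred v).exp = (I.pred v).exp := by
  funext w
  simp only [Mon.before, Mon.afterPred, Mon.sub, Mon.pred, Pi.add_apply, Pi.sub_apply]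
  rcases lt_trichotomy w v with h | h | h
  · simp [h, h.ne, h.not_gt]
  · subst h; simp
  · simp [h.not_gt, h.ne', h]

theorem term_before_mul_afterPred (I : Mon V) (v : ι) :
    term C (I.before v) 1 * term C (I.afterPred v) 1 = term C (I.pred v) 1 := by
  rw [term_mul_term, map_one, one_mul, mulTerm_eq, structConst_before_afterPred, one_smul,
    one_smul, ymon_before_add_afterPred, ymon_exp]

/-- The differentials `z_v` of the variables `y_v` are trihomogeneous, of the degrees of `y_v` with
the homological degree lowered by one. -/
def IsDiff (C : ColorData k G R) (V : Vars G ι) (z : ι → SemiFree C V) : Prop :=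
  ∀ v, ∃ h, V.hdeg v = h + 1 ∧ z v ∈ comp C V h (V.ideg v) (V.color v)

variable {z : ι → SemiFree C V}

/-- As `z v` has the colour of `y_v` and one homological degree less, it moves past a monomial like
`y_v` does, up to the sign of the degree of the monomial. -/
theorem mon_mul_diff (H : C.Good) (hz : IsDiff C V z) (I : Mon V) (v : ι) :
    term C I 1 * z v = ((-1) ^ I.hdeg * (fullBraid C V I.exp (Pi.single v 1) : k)) •
      (z v * term C I 1) := by
  obtain ⟨h, hh, hv⟩ := hz v
  rw [color_comm_of_mem H (mon_mem_comp H I) hv]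
  congr 1
  have := fullBraid_eq H I (Mon.var V v)
  have e : (Mon.var V v).hdeg = h + 1 := by
    simp [Mon.hdeg, Mon.var, Pi.single_apply, hh]
  have e' : (Mon.var V v).color = V.color v := by
    simp [Mon.color, Mon.var, Pi.single_apply]
  rw [e, e'] at this
  have e2 : (Mon.var V v).exp = Pi.single v 1 := rfl
  rw [e2] at this
  rw [this]
  push_cast
  rw [← mul_assoc, ← pow_add, show I.hdeg + I.hdeg * (h + 1) = 2 * I.hdeg + I.hdeg * h by ring,
    pow_add, pow_mul]
  simp

/-- The sign in the Leibniz rule cancels against the one from pulling `z v` to the front, by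
`mon_mul_diff`. What is left is the scalar of the left derivative, so that `d` is `∑ z_v ∂_v`. -/
theorem dMon_eq (H : C.Good) (hz : IsDiff C V z) (I : Mon V) : dMon z I =
    ∑ v, if I.exp v = 0 then 0 else
      (derivSign C V v I.exp : k) • (z v * term C (I.pred v) 1) := by
  unfold dMon
  refine Finset.sum_congr rfl fun v _ => ?_
  split_ifs with h0
  · rfl
  rw [mul_assoc ((-1) ^ (I.before v).hdeg), mon_mul_diff H hz, mul_assoc, smul_mul_assoc,
    mul_assoc, term_before_mul_afterPred]
  have e1 : fullBraid C V (I.before v).exp (Pi.single v 1) = derivSign C V v I.exp := by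
    rw [fullBraid_single H, braid_eq_one, one_mul]
    · rw [show (I.before v).exp v = 0 by simp [Mon.before, Mon.sub], pow_zero, mul_one]
      exact derivSign_congr fun w hw => by simp [Mon.before, Mon.sub, hw]
    · intro v' w hw
      by_cases h : v' < v
      · right; exact Pi.single_eq_of_ne (hw.trans h).ne _
      · left; simp [Mon.before, Mon.sub, h]
  rw [e1]
  have : ((-1 : SemiFree C V)) ^ (I.before v).hdeg =
      algebraMap k (SemiFree C V) ((-1) ^ (I.before v).hdeg) := by simp
  rw [this, ← Algebra.smul_def, smul_smul, ← mul_assoc, ← pow_add, ← two_mul, pow_mul]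
  simp

/-- The grading involution: multiplication by `(-1)^h` in homological degree `h`. -/
def inv (C : ColorData k G R) (V : Vars G ι) : SemiFree C V →ₗ[R] SemiFree C V :=
  Finsupp.linearCombination R fun I : Mon V => ((-1 : k) ^ I.hdeg) • term C I 1

theorem inv_term (I : Mon V) (r : R) : inv C V (term C I r) = (-1 : k) ^ I.hdeg • term C I r := by
  unfold inv term
  erw [Finsupp.linearCombination_single]
  change r • (-1 : k) ^ I.hdeg • term C I 1 = _
  rw [smul_comm, ← term_eq_smul]
  rfl

theorem d_term (I : Mon V) (r : R) : d z (term C I r) = r • dMon z I :=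
  Finsupp.linearCombination_single ..

end

end SemiFree

namespace SemiFree

section

set_option linter.unusedSectionVars false

variable {k : Type u} [Field k] {G : Type v} [CommGroup G] {R : Type w} [Ring R] [Algebra k R]
variable {ι : Type t} [Fintype ι] [LinearOrder ι]
variable {C : ColorData k G R} {V : Vars G ι} {z : ι → SemiFree C V}

theorem ymon_eq_zero {E : ι → ℕ} {v : ι} (hv : Odd (V.hdeg v)) (h : 1 < E v) :
    ymon C V E = 0 := dif_neg fun h' => by have := h' v hv; omega

theorem mon_mul_mon (I J : Mon V) :
    term C I 1 * term C J 1 = structConst C I J • ymon C V (I.exp + J.exp) := by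
  rw [term_mul_term, map_one, one_mul, mulTerm_eq, one_smul]

theorem prod_choose_eq (I J : ι → ℕ) (v : ι) :
    ∏ w, ((I w + J w).choose (I w) : k) = ((I v + J v).choose (I v) : k) *
      ∏ w ∈ Finset.univ.erase v, ((I w + J w).choose (I w) : k) :=
  (Finset.mul_prod_erase _ _ (Finset.mem_univ v)).symm

theorem prod_choose_erase_congr {I J I' J' : ι → ℕ} {v : ι} (hI : ∀ w, w ≠ v → I w = I' w)
    (hJ : ∀ w, w ≠ v → J w = J' w) :
    ∏ w ∈ Finset.univ.erase v, ((I w + J w).choose (I w) : k) =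
      ∏ w ∈ Finset.univ.erase v, ((I' w + J' w).choose (I' w) : k) :=
  Finset.prod_congr rfl fun w hw => by
    rw [hI w (Finset.ne_of_mem_erase hw), hJ w (Finset.ne_of_mem_erase hw)]

theorem structConst_pred_left {I J : Mon V} {v : ι} (h : I.exp v ≠ 0) :
    structConst C (I.pred v) J = ((I.exp v - 1 + J.exp v).choose (I.exp v - 1) : k) *
      (∏ w ∈ Finset.univ.erase v, ((I.exp w + J.exp w).choose (I.exp w) : k)) *
      ((braid C V I.exp J.exp : k) * derivSign C V v J.exp) := by
  have hb : braid C V I.exp J.exp = braid C V (I.pred v).exp J.exp * braid C V (Pi.single v 1) J.exp := by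
    rw [← braid_add_left, Mon.pred_exp_add h]
  rw [structConst_eq, prod_choose_eq _ _ v, hb, derivSign, ← Units.val_mul, mul_inv_cancel_right,
    prod_choose_erase_congr (I' := I.exp) (J' := J.exp) _ fun _ _ => rfl]
  · simp [Mon.pred, Mon.sub]
  · intro w hw; simp [Mon.pred, Mon.sub, Pi.single_eq_of_ne hw]

theorem structConst_pred_right {I J : Mon V} {v : ι} (h : J.exp v ≠ 0) :
    structConst C I (J.pred v) = ((I.exp v + (J.exp v - 1)).choose (I.exp v) : k) *
      (∏ w ∈ Finset.univ.erase v, ((I.exp w + J.exp w).choose (I.exp w) : k)) *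
      ((braid C V I.exp J.exp : k) * (braid C V I.exp (Pi.single v 1))⁻¹) := by
  have hb : braid C V I.exp J.exp = braid C V I.exp (J.pred v).exp * braid C V I.exp (Pi.single v 1) := by
    rw [← braid_add_right, Mon.pred_exp_add h]
  rw [structConst_eq, prod_choose_eq _ _ v, hb]
  push_cast
  rw [mul_inv_cancel_right₀ (Units.ne_zero _),
    prod_choose_erase_congr (I' := I.exp) (J' := J.exp) fun _ _ => rfl]
  · simp [Mon.pred, Mon.sub]
  · intro w hw; simp [Mon.pred, Mon.sub, Pi.single_eq_of_ne hw]

/-- The left derivative with respect to `y_v` of a monomial. -/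
def leftDeriv (C : ColorData k G R) {V : Vars G ι} (v : ι) (I : Mon V) : SemiFree C V :=
  if I.exp v = 0 then 0 else (derivSign C V v I.exp : k) • term C (I.pred v) 1

/-- The left derivative is a derivation twisted by the scalar for moving `y_v` past `y^{(I)}`. All
terms are multiples of the same monomial, so only scalars in `k` have to be compared. -/
theorem leftDeriv_mul (H : C.Good) (v : ι) (I J : Mon V) :
    open Classical in
    (if h : I.Compat J then structConst C I J • leftDeriv C v (I.add J h) else 0) =
      leftDeriv C v I * term C J 1 +
        (fullBraid C V I.exp (Pi.single v 1) : k) • (term C I 1 * leftDeriv C v J) := by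
  classical
  have hb : ∀ (I : Mon V), I.exp v ≠ 0 → ∀ E, (I.pred v).exp + E = I.exp + E - Pi.single v 1 := by
    intro I h E
    funext w
    by_cases hw : w = v
    · subst hw; simp [Mon.pred, Mon.sub]; omega
    · simp [Mon.pred, Mon.sub, Pi.single_eq_of_ne hw]
  have hl : leftDeriv C v I * term C J 1 = (if I.exp v = 0 then 0 else
      (derivSign C V v I.exp : k) * structConst C (I.pred v) J) •
        ymon C V (I.exp + J.exp - Pi.single v 1) := by
    unfold leftDeriv
    split_ifs with h
    · simp
    · rw [smul_mul_assoc, mon_mul_mon, smul_smul, hb I h]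
  have hr : term C I 1 * leftDeriv C v J = (if J.exp v = 0 then 0 else
      (derivSign C V v J.exp : k) * structConst C I (J.pred v)) •
        ymon C V (I.exp + J.exp - Pi.single v 1) := by
    unfold leftDeriv
    split_ifs with h
    · simp
    · rw [mul_smul_comm, mon_mul_mon, smul_smul, add_comm, hb J h, add_comm]
  rw [hl, hr, smul_smul, ← add_smul, fullBraid_single H, varSign_self H]
  -- The exceptional case: the product vanishes because `y_v² = 0`, while both terms on the right
  -- survive and cancel.
  by_cases hodd : Odd (V.hdeg v) ∧ I.exp v = 1 ∧ J.exp v = 1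
  · obtain ⟨ho, h1, h2⟩ := hodd
    rw [dif_neg fun h => by have := h v ho; omega, if_neg (by omega), if_neg (by omega),
      structConst_pred_left (by omega), structConst_pred_right (by omega), h1, h2, ho.neg_one_pow]
    symm
    convert zero_smul k _
    simp
    field_simp
    ring
  have hL : (if h : I.Compat J then structConst C I J • leftDeriv C v (I.add J h) else 0) =
      (if I.exp v + J.exp v = 0 then 0 else structConst C I J * derivSign C V v (I.exp + J.exp)) •
        ymon C V (I.exp + J.exp - Pi.single v 1) := by
    split_ifs with h h0 h0
    · simp [leftDeriv, Mon.add, h0]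
    · unfold leftDeriv
      rw [if_neg (by simpa only [Mon.add] using h0), smul_smul, ← ymon_exp]
      rfl
    · simp
    -- Outside the exceptional case, incompatibility comes from an odd variable other than `v` and
    -- persists when the exponent of `v` is lowered.
    · rw [ymon, dif_neg, smul_zero]
      intro h'
      refine h fun w hw => ?_
      have := h' w hw
      by_cases hwv : w = v
      · subst hwv
        simp at this
        have := I.exp_le w hw
        have := J.exp_le w hw
        have : ¬ (I.exp w = 1 ∧ J.exp w = 1) := fun hh => hodd ⟨hw, hh⟩
        omega
      · simpa [Pi.single_eq_of_ne hwv] using this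
  rw [hL]
  congr 1
  have hc : structConst C I J = ((I.exp v + J.exp v).choose (I.exp v) : k) *
      (∏ w ∈ Finset.univ.erase v, ((I.exp w + J.exp w).choose (I.exp w) : k)) *
      (braid C V I.exp J.exp : k) := by
    rw [structConst_eq, prod_choose_eq _ _ v]
  have hne : (braid C V I.exp (Pi.single v 1) : k) ≠ 0 := Units.ne_zero _
  rw [hc, derivSign_add]
  by_cases hI : I.exp v = 0
  · by_cases hJ : J.exp v = 0
    · simp [hI, hJ]
    · rw [if_neg (by omega), if_pos hI, if_neg hJ, structConst_pred_right hJ, hI]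
      simp
      field_simp
  · rw [if_neg (by omega), if_neg hI, structConst_pred_left hI]
    by_cases hJ : J.exp v = 0
    · rw [if_pos hJ, hJ]
      simp
      ring
    · rw [if_neg hJ, structConst_pred_right hJ]
      have hev : Even (V.hdeg v) := by
        rw [← Nat.not_odd_iff_even]
        intro ho
        have := I.exp_le v ho
        have := J.exp_le v ho
        exact hodd ⟨ho, by omega, by omega⟩
      obtain ⟨a, ha⟩ := Nat.exists_eq_succ_of_ne_zero hI
      obtain ⟨b, hb⟩ := Nat.exists_eq_succ_of_ne_zero hJ
      rw [hev.neg_one_pow, ha, hb]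
      -- Pascal's rule. The two summands are the binomial coefficients that arise when the left and
      -- the right factor are differentiated.
      have hp : ((a.succ + b.succ).choose a.succ : k) =
          (a + b.succ).choose a + (a.succ + b).choose a.succ := by
        rw [show a.succ + b.succ = (a + b.succ).succ by omega, Nat.choose_succ_succ,
          show a.succ + b = a + b.succ by omega]
        push_cast; rfl
      simp only [Nat.succ_sub_one, hp]
      push_cast
      simp only [one_pow]
      field_simp

theorem dMon_eq_sum_leftDeriv (H : C.Good) (hz : IsDiff C V z) (I : Mon V) :
    dMon z I = ∑ v, z v * leftDeriv C v I := by
  rw [dMon_eq H hz]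
  refine Finset.sum_congr rfl fun v _ => ?_
  unfold leftDeriv
  split_ifs
  · simp
  · rw [mul_smul_comm]

theorem d_mon (I : Mon V) : d z (term C I 1) = dMon z I := by rw [d_term, one_smul]

theorem d_mon_mul_mon (H : C.Good) (hz : IsDiff C V z) (I J : Mon V) :
    d z (term C I 1 * term C J 1) = d z (term C I 1) * term C J 1 +
      (-1 : k) ^ I.hdeg • (term C I 1 * d z (term C J 1)) := by
  classical
  have e : ∀ v, (-1 : k) ^ I.hdeg • (term C I 1 * (z v * leftDeriv C v J)) =
      z v * ((fullBraid C V I.exp (Pi.single v 1) : k) • (term C I 1 * leftDeriv C v J)) := by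
    intro v
    rw [← mul_assoc, mon_mul_diff H hz, smul_mul_assoc, smul_smul, ← mul_assoc, ← pow_add,
      ← two_mul, pow_mul, mul_smul_comm, mul_assoc]
    simp
  rw [term_mul_term, map_one, one_mul, d_mon, d_mon, dMon_eq_sum_leftDeriv H hz,
    dMon_eq_sum_leftDeriv H hz, Finset.sum_mul, Finset.mul_sum, Finset.smul_sum,
    ← Finset.sum_add_distrib]
  simp_rw [e, mul_assoc, ← mul_add, ← leftDeriv_mul H]
  unfold mulTerm
  split_ifs with h
  · rw [d_term]
    have : (structConst C I J • (1 : R)) • dMon z (I.add J h) =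
        structConst C I J • dMon z (I.add J h) := smul_one_smul _ _ _
    rw [this, dMon_eq_sum_leftDeriv H hz, Finset.smul_sum]
    simp_rw [mul_smul_comm]
  · simp

theorem d_mon_mul_smul (H : C.Good) (hz : IsDiff C V z) (I : Mon V) (s : R) (b : SemiFree C V) :
    d z (term C I 1) * (s • b) = C.aut I.color s • (d z (term C I 1) * b) := by
  rw [d_mon, dMon_eq_sum_leftDeriv H hz, Finset.sum_mul, Finset.sum_mul, Finset.smul_sum]
  refine Finset.sum_congr rfl fun v _ => ?_
  unfold leftDeriv
  split_ifs with h
  · simp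
  · obtain ⟨_, -, hv⟩ := hz v
    rw [mul_smul_comm (derivSign C V v I.exp : k), smul_mul_assoc, smul_mul_assoc, mul_assoc, term_mul_smul,
      mul_smul_of_mem_comp H hv, smul_comm, ← mul_assoc, ← Mon.pred_color h,
      mul_comm (I.pred v).color, map_mul]
    rfl

/-- With the involution `inv` carrying the sign, the Leibniz rule holds for inhomogeneous `a` as
well. -/
theorem d_mul (H : C.Good) (hz : IsDiff C V z) (a b : SemiFree C V) :
    d z (a * b) = d z a * b + inv C V a * d z b := by
  induction a using SemiFree.induction with
  | zero => simp
  | add a a' h h' => simp only [add_mul, map_add, h, h']; abel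
  | term I r =>
  induction b using SemiFree.induction with
  | zero => simp
  | add a a' h h' => simp only [mul_add, map_add, h, h']; abel
  | term J s =>
    rw [term_eq_smul I, term_eq_smul J, map_smul, map_smul, map_smul, inv_term, smul_mul_assoc,
      smul_mul_assoc, term_mul_smul, d_mon_mul_smul H hz, map_smul, map_smul, d_mon_mul_mon H hz,
      smul_mul_assoc, smul_mul_assoc, term_mul_smul]
    simp only [smul_add]
    congr 2
    rw [smul_comm]

theorem inv_of_mem_comp {h e : ℕ} {g : G} {a : SemiFree C V} (ha : a ∈ comp C V h e g) :
    inv C V a = (-1 : k) ^ h • a := by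
  induction ha using Submodule.span_induction with
  | zero => simp
  | add x y _ _ hx hy => rw [map_add, hx, hy, smul_add]
  | smul c x _ hx =>
    rw [← smul_one_smul R c x, map_smul, hx, smul_comm]
  | mem x hx =>
    obtain ⟨I, e', g', r, hr, rfl, -, -, rfl⟩ := hx
    rw [inv_term]

end

end SemiFree

/-- Off the diagonal the terms cancel in pairs under exchange of indices. The diagonal has its own
hypothesis, as antisymmetry would only give `2 F v v = 0`. -/
theorem sum_sum_eq_zero_of_antisymm {ι A : Type*} [Fintype ι] [DecidableEq ι] [AddCommGroup A]
    (F : ι → ι → A)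
    (h : ∀ v w, v ≠ w → F v w + F w v = 0) (h0 : ∀ v, F v v = 0) : ∑ v, ∑ w, F v w = 0 := by
  rw [← Finset.sum_product']
  refine Finset.sum_involution (fun p _ => p.swap) ?_ ?_ (fun _ _ => by simp) (fun _ _ => by simp)
  · rintro ⟨v, w⟩ -
    by_cases hvw : v = w
    · subst hvw; simp [h0]
    · exact h v w hvw
  · rintro ⟨v, w⟩ - hne heq
    simp only [Prod.swap_prod_mk, Prod.mk.injEq] at heq
    obtain ⟨rfl, -⟩ := heq
    exact hne (h0 _)

/-! ### The square of the differential and the colour DG algebra structure -/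

namespace SemiFree

section

set_option linter.unusedSectionVars false

variable {k : Type u} [Field k] {G : Type v} [CommGroup G] {R : Type w} [Ring R] [Algebra k R]
variable {ι : Type t} [Fintype ι] [LinearOrder ι]
variable {C : ColorData k G R} {V : Vars G ι} {z : ι → SemiFree C V}

theorem smul_mem_comp (H : C.Good) {e : ℕ} {g : G} {r : R} (hr : r ∈ C.comp e g)
    {h e' : ℕ} {g' : G} {a : SemiFree C V} (ha : a ∈ comp C V h e' g') :
    r • a ∈ comp C V h (e + e') (g * g') := by
  have h1 : term C (Mon.one V) r ∈ comp C V 0 (e + 0) (g * 1) := by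
    simpa [Mon.hdeg, Mon.ideg, Mon.color, Mon.one] using term_mem_comp (V := V) (Mon.one V) hr
  have := mul_mem_comp H h1 ha
  rw [term_eq_smul, smul_mul_assoc, ← one_def, one_mul] at this
  simpa using this

theorem dMon_mem_comp (H : C.Good) (hz : IsDiff C V z) {h : ℕ} (I : Mon V) (hI : I.hdeg = h + 1) :
    dMon z I ∈ comp C V h I.ideg I.color := by
  rw [dMon_eq_sum_leftDeriv H hz]
  refine Submodule.sum_mem _ fun v _ => ?_
  unfold leftDeriv
  split_ifs with h0
  · simp
  · rw [mul_smul_comm]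
    refine Submodule.smul_mem _ _ ?_
    obtain ⟨l, hl, hv⟩ := hz v
    have h1 := mul_mem_comp H hv (mon_mem_comp H (I.pred v))
    have h2 := Mon.pred_hdeg h0
    have h3 : l + (I.pred v).hdeg = h := by omega
    rwa [h3, add_comm, Mon.pred_ideg h0, mul_comm, Mon.pred_color h0] at h1

theorem d_mem_comp (H : C.Good) (hz : IsDiff C V z) {h e : ℕ} {g : G} {a : SemiFree C V}
    (ha : a ∈ comp C V (h + 1) e g) : d z a ∈ comp C V h e g := by
  induction ha using Submodule.span_induction with
  | zero => simp
  | add x y _ _ hx hy => rw [map_add]; exact add_mem hx hy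
  | smul c x _ hx =>
    rw [← smul_one_smul R c x, map_smul, smul_one_smul]
    exact Submodule.smul_mem _ _ hx
  | mem x hx =>
    obtain ⟨I, e', g', r, hr, hI, rfl, rfl, rfl⟩ := hx
    rw [d_term]
    exact smul_mem_comp H hr (dMon_mem_comp H hz I hI)

theorem d_eq_zero_of_mem_comp (hz : IsDiff C V z) {e : ℕ} {g : G} {a : SemiFree C V}
    (ha : a ∈ comp C V 0 e g) : d z a = 0 := by
  induction ha using Submodule.span_induction with
  | zero => simp
  | add x y _ _ hx hy => rw [map_add, hx, hy, add_zero]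
  | smul c x _ hx => rw [← smul_one_smul R c x, map_smul, hx, smul_zero]
  | mem x hx =>
    obtain ⟨I, e', g', r, hr, hI, rfl, rfl, rfl⟩ := hx
    rw [d_term, dMon, Finset.sum_eq_zero, smul_zero]
    intro v _
    rw [if_pos]
    rw [Mon.hdeg, Finset.sum_eq_zero_iff] at hI
    obtain ⟨l, hl, -⟩ := hz v
    have := hI v (Finset.mem_univ v)
    rw [hl] at this
    simpa using this

/-- Colour commutativity only yields `2 a² = 0`, which is not enough in characteristic two. On a
term, an odd total degree forces an odd variable of exponent one, whose square is zero. Cross terms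
cancel because `χ(g, g) = 1`. -/
theorem mul_self_of_odd (H : C.Good) {h e : ℕ} {g : G} (hh : Odd h) {a : SemiFree C V}
    (ha : a ∈ comp C V h e g) : a * a = 0 := by
  induction ha using Submodule.span_induction with
  | zero => simp
  | add x y hx' hy' hx hy =>
    rw [add_mul, mul_add, mul_add, hx, hy, color_comm_of_mem H hx' hy', H.bichar.self,
      (hh.mul hh).neg_one_pow]
    simp
  | smul c x _ hx => rw [smul_mul_assoc, mul_smul_comm, hx, smul_zero, smul_zero]
  | mem x hx =>
    obtain ⟨I, e', g', r, hr, rfl, rfl, rfl, rfl⟩ := hx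
    rw [term_mul_term, mulTerm, dif_neg]
    intro hc
    rw [← Nat.not_even_iff_odd] at hh
    refine hh (Finset.even_sum _ fun v _ => ?_)
    by_cases hv : Odd (V.hdeg v)
    · have := hc v hv
      rw [show I.exp v = 0 by omega]; simp
    · rw [Nat.not_odd_iff_even] at hv
      exact hv.mul_left _

theorem derivSign_pred {I : Mon V} {v w : ι} (hv : I.exp v ≠ 0) : derivSign C V w I.exp =
    derivSign C V w (I.pred v).exp * derivSign C V w (Pi.single v 1) := by
  rw [← derivSign_add, Mon.pred_exp_add hv]

theorem d_leftDeriv (I : Mon V) (v : ι) (H : C.Good) (hz : IsDiff C V z) :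
    d z (leftDeriv C v I) = ∑ w, z w *
      (if I.exp v = 0 then 0 else (derivSign C V v I.exp : k) • leftDeriv C w (I.pred v)) := by
  split_ifs with h
  · simp [leftDeriv, h]
  · simp_rw [mul_smul_comm]
    rw [← Finset.smul_sum, ← dMon_eq_sum_leftDeriv H hz, leftDeriv, if_neg h,
      ← smul_one_smul R, map_smul, smul_one_smul, d_mon]

theorem leftDeriv_swap {I : Mon V} {v w : ι} (H : C.Good) (h : v ≠ w) :
    (if I.exp v = 0 then 0 else (derivSign C V v I.exp : k) • leftDeriv C w (I.pred v)) =
    (varSign C V w v : k) •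
      (if I.exp w = 0 then 0 else (derivSign C V w I.exp : k) • leftDeriv C v (I.pred w)) := by
  have e1 : ∀ {v w : ι}, v ≠ w → (I.pred v).exp w = I.exp w := fun h => by
    simp [Mon.pred, Mon.sub, Pi.single_eq_of_ne h.symm]
  by_cases hv : I.exp v = 0
  · rw [if_pos hv]
    split_ifs
    · simp
    · simp [leftDeriv, e1 h.symm, hv]
  by_cases hw : I.exp w = 0
  · rw [if_pos hw, if_neg hv]
    simp [leftDeriv, e1 h, hw]
  rw [if_neg hv, if_neg hw, leftDeriv, leftDeriv, e1 h, e1 h.symm, if_neg hw, if_neg hv, smul_smul,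
    smul_smul, smul_smul]
  have e2 : (I.pred v).pred w = (I.pred w).pred v := Mon.ext (by
    funext x; simp only [Mon.pred, Mon.sub, Pi.sub_apply]; omega)
  rw [e2]
  congr 1
  rw [derivSign_pred (w := w) hv, derivSign_pred (w := v) hw, derivSign_single, derivSign_single]
  have e3 := congrArg Units.val (varSign_swap (V := V) H v w)
  push_cast at e3
  rcases lt_or_gt_of_ne h with h' | h'
  · rw [if_neg h'.not_gt, if_pos h']
    push_cast
    field_simp
  · rw [if_pos h', if_neg h'.not_gt]
    push_cast
    field_simp
    linear_combination -e3

/-- The second order part of the square of `∑ z_v ∂_v` is antisymmetric in the two variables and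
vanishes. The `z v` are not assumed to be cycles: over the skew polynomial ring the boundary of `z
v` may be some `f_j`, and the formula measures how far `d` is from a differential. -/
theorem d_dMon (H : C.Good) (hz : IsDiff C V z) (I : Mon V) :
    d z (dMon z I) = ∑ v, d z (z v) * leftDeriv C v I := by
  classical
  rw [dMon_eq_sum_leftDeriv H hz, map_sum]
  simp_rw [d_mul H hz, d_leftDeriv _ _ H hz]
  rw [Finset.sum_add_distrib, add_eq_left]
  simp_rw [Finset.mul_sum]
  refine sum_sum_eq_zero_of_antisymm _ ?_ ?_
  · intro v w hvw
    obtain ⟨l, hl, hv⟩ := hz v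
    obtain ⟨m, hm, hw⟩ := hz w
    rw [leftDeriv_swap H hvw, inv_of_mem_comp hv, inv_of_mem_comp hw, mul_smul_comm, mul_smul_comm,
      smul_mul_assoc, smul_mul_assoc, smul_smul, ← mul_assoc, ← mul_assoc,
      color_comm_of_mem H hv hw, smul_mul_assoc, smul_smul, ← add_smul]
    convert zero_smul k _
    have e3 := congrArg Units.val (varSign_swap (V := V) H v w)
    unfold varSign at e3 ⊢
    push_cast at e3 ⊢
    have e4 := congrArg Units.val (H.bichar.mul_swap (V.color v) (V.color w))
    push_cast at e4
    rw [hl, hm]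
    rcases Nat.even_or_odd l with h1 | h1 <;> rcases Nat.even_or_odd m with h2 | h2 <;>
      simp [h1, h2, pow_succ, pow_add, mul_add, add_mul] <;>
        first | linear_combination e4 | linear_combination -e4
  · intro v
    split_ifs with h0
    · simp
    obtain ⟨l, hl, hv⟩ := hz v
    -- The diagonal term. If `z v` has even degree, then `y_v` is odd and can be removed only once;
    -- if `z v` has odd degree, its square is zero.
    rcases Nat.even_or_odd l with h1 | h1
    · rw [leftDeriv, if_pos]
      · simp
      · have ho : Odd (V.hdeg v) := by rw [hl]; exact h1.add_one
        have := I.exp_le v ho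
        simp [Mon.pred, Mon.sub]; omega
    · rw [inv_of_mem_comp hv, smul_mul_assoc, ← mul_assoc, mul_self_of_odd H h1 hv]
      simp

theorem d_d_term (H : C.Good) (hz : IsDiff C V z) (I : Mon V) (r : R) :
    d z (d z (term C I r)) = r • ∑ v, d z (z v) * leftDeriv C v I := by
  rw [d_term, map_smul, d_dMon H hz]

theorem d_d (H : C.Good) (hz : IsDiff C V z) (hdz : ∀ v, d z (z v) = 0) (a : SemiFree C V) :
    d z (d z a) = 0 := by
  induction a using SemiFree.induction with
  | zero => simp
  | add a a' h h' => simp only [map_add, h, h', add_zero]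
  | term I r => rw [d_d_term H hz]; simp [hdz]

/-- The map `r ↦ r y^{(I)}`, linear over `k`. -/
def termHom (C : ColorData k G R) {V : Vars G ι} (I : Mon V) : R →ₗ[k] SemiFree C V where
  toFun := term C I
  map_add' := term_add I
  map_smul' a r := (smul_term a I r).symm

open Classical in
/-- The projection onto a trihomogeneous component, given projections `p` on `R`. -/
def projComp (C : ColorData k G R) (V : Vars G ι) (p : ℕ → G → R →ₗ[k] R) (h e : ℕ) (g : G) :
    SemiFree C V →ₗ[k] SemiFree C V :=
  Finsupp.lsum ℕ (M := R) (N := SemiFree C V) fun I : Mon V =>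
    if I.hdeg = h ∧ I.ideg ≤ e then
      (termHom C I).comp (p (e - I.ideg) (g * I.color⁻¹)) else 0

open Classical in
theorem projComp_term (p : ℕ → G → R →ₗ[k] R) (h e : ℕ) (g : G) (I : Mon V) (r : R) :
    projComp C V p h e g (term C I r) = if I.hdeg = h ∧ I.ideg ≤ e then
      term C I (p (e - I.ideg) (g * I.color⁻¹) r) else 0 := by
  refine (Finsupp.sum_single_index (a := I) (b := r) (h := fun (I : Mon V) r =>
    (if I.hdeg = h ∧ I.ideg ≤ e then
      (termHom C I).comp (p (e - I.ideg) (g * I.color⁻¹)) else 0 : R →ₗ[k] SemiFree C V) r)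
    (map_zero _)).trans ?_
  split_ifs <;> rfl

theorem exists_proj (H : C.Good) (s : ℕ × ℕ × G) : ∃ p : SemiFree C V →ₗ[k] SemiFree C V,
    (∀ a ∈ comp C V s.1 s.2.1 s.2.2, p a = a) ∧
    ∀ s' : ℕ × ℕ × G, s' ≠ s → ∀ a ∈ comp C V s'.1 s'.2.1 s'.2.2, p a = 0 := by
  obtain ⟨h, e, g⟩ := s
  choose p hp hp' using H.proj
  refine ⟨projComp C V p h e g, fun a ha => ?_, ?_⟩
  · induction ha using Submodule.span_induction with
    | zero => simp
    | add x y _ _ hx hy => rw [map_add, hx, hy]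
    | smul c x _ hx => rw [map_smul, hx]
    | mem x hx =>
      obtain ⟨I, e', g', r, hr, hI, rfl, rfl, rfl⟩ := hx
      rw [projComp_term, if_pos ⟨hI, by simp⟩, hp]
      simpa using hr
  · rintro ⟨h', e', g'⟩ hs a ha
    induction ha using Submodule.span_induction with
    | zero => simp
    | add x y _ _ hx hy => rw [map_add, hx, hy, add_zero]
    | smul c x _ hx => rw [map_smul, hx, smul_zero]
    | mem x hx =>
      obtain ⟨I, e₁, g₁, r, hr, hI, rfl, rfl, rfl⟩ := hx
      rw [projComp_term]
      split_ifs with hc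
      · rw [hp' _ _ e₁ g₁ _ r hr, term_zero]
        rintro heq
        simp only [Prod.mk.injEq] at heq
        obtain ⟨rfl, rfl⟩ := heq
        apply hs
        simpa [Nat.sub_add_cancel hc.2] using hI.symm.trans hc.1
      · rfl

theorem iSupIndep_comp (H : C.Good) :
    iSupIndep fun s : ℕ × ℕ × G => comp C V s.1 s.2.1 s.2.2 := by
  choose p hp hp' using exists_proj (V := V) H
  exact iSupIndep_of_proj _ p hp fun i j => hp' i j

theorem iSup_comp (H : C.Good) : ⨆ s : ℕ × ℕ × G, comp C V s.1 s.2.1 s.2.2 = ⊤ := by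
  rw [eq_top_iff]
  rintro a -
  induction a using SemiFree.induction with
  | zero => exact zero_mem _
  | add a a' h h' => exact add_mem h h'
  | term I r =>
  induction r using H.induction with
  | zero => rw [term_zero]; exact zero_mem _
  | add r s hr hs => rw [term_add]; exact add_mem hr hs
  | mem e g r hr =>
    exact Submodule.mem_iSup_of_mem (I.hdeg, e + I.ideg, g * I.color) (term_mem_comp I hr)

theorem one_mem_comp (H : C.Good) : (1 : SemiFree C V) ∈ comp C V 0 0 1 := by
  have := mon_mem_comp (V := V) H (Mon.one V)
  rw [one_def]
  simpa [Mon.hdeg, Mon.ideg, Mon.color, Mon.one] using this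

/-- `R⟨Y⟩` is a colour DG algebra, as soon as the `z_v = ∂(y_v)` are trihomogeneous cycles of the
right degrees. -/
theorem isColorDGA (H : C.Good) (hz : IsDiff C V z) (hdz : ∀ v, d z (z v) = 0) :
    IsColorDGA C.χ (comp C V) ((d z).restrictScalars k) where
  isSkewBichar := H.bichar
  independent := iSupIndep_comp H
  spans := iSup_comp H
  one_mem := one_mem_comp H
  mul_mem := mul_mem_comp H
  d_mem := d_mem_comp H hz
  d_zero := d_eq_zero_of_mem_comp hz
  d_d := d_d H hz hdz
  leibniz {h e g a} ha b := by
    simp only [LinearMap.coe_restrictScalars]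
    rw [d_mul H hz, inv_of_mem_comp ha, smul_mul_assoc]
    have : (-1 : SemiFree C V) ^ h = algebraMap k _ ((-1) ^ h) := by simp
    rw [this, Algebra.smul_def]
  color_comm := color_comm_of_mem H
  sq_zero hh ha := mul_self_of_odd H hh ha

end

end SemiFree

/-! ### The basis of words of a skew polynomial ring -/

/-- The conditions `q_{ii} = 1` and `q_{ij} q_{ji} = 1`. -/
structure IsSkewMatrix {k : Type u} [Field k] {n : ℕ} (q : Fin n → Fin n → kˣ) : Prop where
  diag : ∀ i, q i i = 1
  anti : ∀ i j, q i j * q j i = 1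

namespace SkewPoly

variable {k : Type u} [Field k] {n : ℕ} {q : Fin n → Fin n → kˣ}

theorem x_mul_x (i j : Fin n) : x q i * x q j = (q i j : k) • (x q j * x q i) := by
  have := RingQuot.mkAlgHom_rel k (SkewRel.swap (q := q) i j)
  rw [map_mul, map_smul, map_mul] at this
  exact this

/-- Algebra homomorphisms from a skew polynomial ring. -/
def lift {B : Type*} [Ring B] [Algebra k B] (y : Fin n → B)
    (h : ∀ i j, y i * y j = (q i j : k) • (y j * y i)) : SkewPoly q →ₐ[k] B :=
  RingQuot.liftAlgHom k ⟨FreeAlgebra.lift k y, by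
    rintro _ _ ⟨i, j⟩
    simpa using h i j⟩

theorem lift_x {B : Type*} [Ring B] [Algebra k B] (y : Fin n → B)
    (h : ∀ i j, y i * y j = (q i j : k) • (y j * y i)) (i : Fin n) : lift y h (x q i) = y i := by
  unfold lift x
  erw [RingQuot.liftAlgHom_mkAlgHom_apply]
  simp

theorem algHom_ext {B : Type*} [Ring B] [Algebra k B] {φ ψ : SkewPoly q →ₐ[k] B}
    (h : ∀ i, φ (x q i) = ψ (x q i)) : φ = ψ :=
  RingQuot.ringQuot_ext' k _ _ (FreeAlgebra.hom_ext (funext h))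

/-- The product of the variables in a list. -/
def word (q : Fin n → Fin n → kˣ) (l : List (Fin n)) : SkewPoly q := (l.map (x q)).prod

@[simp] theorem word_nil : word q [] = 1 := rfl

theorem word_cons (i : Fin n) (l : List (Fin n)) : word q (i :: l) = x q i * word q l := by
  simp [word]

theorem word_singleton (i : Fin n) : word q [i] = x q i := by rw [word_cons, word_nil, mul_one]

theorem word_append (l l' : List (Fin n)) : word q (l ++ l') = word q l * word q l' := by
  simp [word]

theorem span_word : Submodule.span k (Set.range (word q)) = ⊤ := by
  rw [eq_top_iff]
  rintro a -
  obtain ⟨a, rfl⟩ := RingQuot.mkAlgHom_surjective k (SkewRel q) a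
  induction a using FreeAlgebra.induction with
  | grade0 r =>
    rw [Algebra.algebraMap_eq_smul_one, map_smul, map_one]
    exact Submodule.smul_mem _ _ (Submodule.subset_span ⟨[], rfl⟩)
  | grade1 i => exact Submodule.subset_span ⟨[i], word_singleton i⟩
  | add a b ha hb => rw [map_add]; exact add_mem ha hb
  | mul a b ha hb =>
    rw [map_mul]
    have h := Submodule.mul_mem_mul ha hb
    rw [Submodule.span_mul_span] at h
    refine Submodule.span_mono ?_ h
    rintro _ ⟨_, ⟨l, rfl⟩, _, ⟨l', rfl⟩, rfl⟩
    exact ⟨l ++ l', word_append l l'⟩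

theorem induction {p : SkewPoly q → Prop} (a : SkewPoly q) (zero : p 0)
    (add : ∀ a b, p a → p b → p (a + b)) (word : ∀ (c : k) l, p (c • word q l)) : p a := by
  have ha : a ∈ Submodule.span k (Set.range (SkewPoly.word q)) := by rw [span_word]; trivial
  induction ha using Submodule.closure_induction with
  | zero => exact zero
  | add a b _ _ ha hb => exact add a b ha hb
  | smul_mem c _ h => obtain ⟨l, rfl⟩ := h; exact word c l

theorem word_perm {l l' : List (Fin n)} (h : l.Perm l') :
    ∃ c : kˣ, word q l = (c : k) • word q l' := by
  induction h with
  | nil => exact ⟨1, by simp⟩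
  | cons i _ ih =>
    obtain ⟨c, hc⟩ := ih
    exact ⟨c, by rw [word_cons, word_cons, hc, mul_smul_comm]⟩
  | swap i j l =>
    exact ⟨q j i, by
      rw [word_cons, word_cons, word_cons, word_cons, ← mul_assoc, x_mul_x, smul_mul_assoc,
        mul_assoc]⟩
  | trans _ _ h h' =>
    obtain ⟨c, hc⟩ := h
    obtain ⟨c', hc'⟩ := h'
    exact ⟨c * c', by rw [hc, hc', smul_smul]; rfl⟩

/-- The word of a multiset of variables, in an arbitrary order. -/
def mword (q : Fin n → Fin n → kˣ) (s : Multiset (Fin n)) : SkewPoly q := word q s.toList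

theorem word_eq_mword (l : List (Fin n)) : ∃ c : kˣ, word q l = (c : k) • mword q l :=
  word_perm (by rw [← Multiset.coe_eq_coe, Multiset.coe_toList])

/-- The scalar that moves `x_i` past the smaller variables of a multiset. -/
def moveScalar (q : Fin n → Fin n → kˣ) (i : Fin n) (s : Multiset (Fin n)) : kˣ :=
  (s.map fun j => if j < i then q i j else 1).prod

theorem moveScalar_cons (i j : Fin n) (s : Multiset (Fin n)) :
    moveScalar q i (j ::ₘ s) = (if j < i then q i j else 1) * moveScalar q i s := by
  rw [moveScalar, Multiset.map_cons, Multiset.prod_cons, moveScalar]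

/-- Left multiplication by `x_i` on the ordered monomials. -/
def act (q : Fin n → Fin n → kˣ) (i : Fin n) : Module.End k (Multiset (Fin n) →₀ k) :=
  Finsupp.linearCombination k fun s => Finsupp.single (i ::ₘ s) (moveScalar q i s : k)

theorem act_single (i : Fin n) (s : Multiset (Fin n)) (c : k) :
    act q i (Finsupp.single s c) = Finsupp.single (i ::ₘ s) (c * moveScalar q i s) := by
  simp [act]

/-- The action of the skew polynomial ring on the ordered monomials. -/
def rep (hq : IsSkewMatrix q) : SkewPoly q →ₐ[k] Module.End k (Multiset (Fin n) →₀ k) :=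
  lift (act q) fun i j => by
    refine Finsupp.lhom_ext fun s c => ?_
    rw [LinearMap.smul_apply, Module.End.mul_apply, Module.End.mul_apply, act_single, act_single,
      act_single, act_single, Multiset.cons_swap, Finsupp.smul_single]
    congr 1
    rw [moveScalar_cons, moveScalar_cons]
    have h := congrArg Units.val (hq.anti i j)
    push_cast at h
    rcases lt_trichotomy i j with hij | rfl | hij
    · rw [if_neg hij.not_gt, if_pos hij]
      push_cast
      simp only [smul_eq_mul]
      linear_combination (-c * moveScalar q i s * moveScalar q j s) * h
    · simp [hq.diag]
    · rw [if_pos hij, if_neg hij.not_gt]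
      push_cast
      simp only [smul_eq_mul]
      ring

theorem rep_word (hq : IsSkewMatrix q) (l : List (Fin n)) :
    ∃ c : kˣ, rep hq (word q l) (Finsupp.single 0 1) = Finsupp.single (l : Multiset (Fin n)) (c : k) := by
  induction l with
  | nil => exact ⟨1, by simp⟩
  | cons i l ih =>
    obtain ⟨c, hc⟩ := ih
    refine ⟨c * moveScalar q i l, ?_⟩
    rw [word_cons, map_mul, Module.End.mul_apply, hc, rep, lift_x, act_single]
    simp

/-- Acting on the empty monomial, a word produces a unit multiple of its own ordered monomial, and
distinct ordered monomials are independent. -/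
theorem linearIndependent_mword (hq : IsSkewMatrix q) : LinearIndependent k (mword q) := by
  choose c hc using rep_word hq
  let T : SkewPoly q →ₗ[k] (Multiset (Fin n) →₀ k) :=
    (LinearMap.applyₗ (Finsupp.single 0 1)).comp (rep hq).toLinearMap
  refine LinearIndependent.of_comp T ?_
  have hT : T ∘ mword q = fun s => (c s.toList) • Finsupp.single s (1 : k) := by
    funext s
    change rep hq (word q s.toList) (Finsupp.single 0 1) = _
    rw [hc, Multiset.coe_toList]
    simp [Units.smul_def]
  rw [hT]
  exact LinearIndependent.units_smul (Finsupp.linearIndependent_single_one k _) _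

/-- The basis of words. -/
def basis (hq : IsSkewMatrix q) : Module.Basis (Multiset (Fin n)) k (SkewPoly q) :=
  Module.Basis.mk (linearIndependent_mword hq) (by
    rw [← span_word, Submodule.span_le]
    rintro _ ⟨l, rfl⟩
    obtain ⟨c, hc⟩ := word_eq_mword (q := q) l
    rw [hc]
    exact Submodule.smul_mem _ _ (Submodule.subset_span ⟨_, rfl⟩))

theorem basis_apply (hq : IsSkewMatrix q) (s : Multiset (Fin n)) : basis hq s = mword q s := by
  simp [basis]

theorem mword_induction (hq : IsSkewMatrix q) {p : SkewPoly q → Prop} (a : SkewPoly q) (zero : p 0)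
    (add : ∀ a b, p a → p b → p (a + b)) (mword : ∀ (c : k) s, p (c • mword q s)) : p a := by
  have ha : a ∈ Submodule.span k (Set.range (basis hq)) := by
    rw [(basis hq).span_eq]; trivial
  induction ha using Submodule.closure_induction with
  | zero => exact zero
  | add a b _ _ ha hb => exact add a b ha hb
  | smul_mem c _ h => obtain ⟨s, rfl⟩ := h; rw [basis_apply]; exact mword c s

/-- The coefficients with respect to the basis of words. -/
def coeff (hq : IsSkewMatrix q) (a : SkewPoly q) (s : Multiset (Fin n)) : k := (basis hq).repr a s

section

variable (hq : IsSkewMatrix q)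

@[simp] theorem coeff_zero (s : Multiset (Fin n)) : coeff hq 0 s = 0 := by simp [coeff]

@[simp] theorem coeff_add (a b : SkewPoly q) (s : Multiset (Fin n)) :
    coeff hq (a + b) s = coeff hq a s + coeff hq b s := by simp [coeff]

@[simp] theorem coeff_smul (c : k) (a : SkewPoly q) (s : Multiset (Fin n)) :
    coeff hq (c • a) s = c * coeff hq a s := by simp [coeff]

theorem coeff_mword (s t : Multiset (Fin n)) :
    coeff hq (mword q s) t = if s = t then 1 else 0 := by
  rw [coeff, ← basis_apply hq, Module.Basis.repr_self, Finsupp.single_apply]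

theorem coeff_word_ne {l : List (Fin n)} {s : Multiset (Fin n)} (h : (l : Multiset (Fin n)) ≠ s) :
    coeff hq (word q l) s = 0 := by
  obtain ⟨c, hc⟩ := word_eq_mword (q := q) l
  rw [hc, coeff_smul, coeff_mword, if_neg h, mul_zero]

theorem ext_coeff {a b : SkewPoly q} (h : ∀ s, coeff hq a s = coeff hq b s) : a = b :=
  (basis hq).repr.injective (Finsupp.ext h)

theorem eq_sum_coeff (a : SkewPoly q) :
    a = ((basis hq).repr a).sum fun s c => c • mword q s := by
  conv_lhs => rw [← (basis hq).linearCombination_repr a]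
  simp only [Finsupp.linearCombination_apply, basis_apply]

theorem exists_coeff_ne_zero {a : SkewPoly q} (h : a ≠ 0) : ∃ s, coeff hq a s ≠ 0 := by
  by_contra! h'
  exact h (ext_coeff hq fun s => by rw [h', coeff_zero])

theorem mem_span_words {P : Multiset (Fin n) → Prop} {a : SkewPoly q} :
    a ∈ Submodule.span k {m | ∃ l : List (Fin n), P l ∧ m = word q l} ↔
      ∀ s, coeff hq a s ≠ 0 → P s := by
  constructor
  · intro h
    induction h using Submodule.span_induction with
    | mem a ha =>
      obtain ⟨l, hl, rfl⟩ := ha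
      intro s hs
      by_contra h
      exact hs (coeff_word_ne hq fun h' => h (h' ▸ hl))
    | zero => simp
    | add a b _ _ ha hb =>
      intro s hs
      by_contra h
      have h1 : coeff hq a s = 0 := by by_contra h'; exact h (ha s h')
      have h2 : coeff hq b s = 0 := by by_contra h'; exact h (hb s h')
      simp [h1, h2] at hs
    | smul c a _ ha =>
      intro s hs
      rw [coeff_smul] at hs
      exact ha s (right_ne_zero_of_mul hs)
  · intro h
    rw [eq_sum_coeff hq a]
    refine Submodule.sum_mem _ fun s hs => Submodule.smul_mem _ _ (Submodule.subset_span ?_)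
    exact ⟨s.toList, by rw [Multiset.coe_toList]; exact h s (Finsupp.mem_support_iff.mp hs), rfl⟩

/-- A linear map that sends basis words to multiples of distinct basis words. -/
theorem coeff_map_of_injective {T : SkewPoly q →ₗ[k] SkewPoly q}
    {e : Multiset (Fin n) → Multiset (Fin n)} (he : Function.Injective e)
    {c : Multiset (Fin n) → k}
    (hT : ∀ s, T (mword q s) = c s • mword q (e s)) (a : SkewPoly q) (s : Multiset (Fin n)) :
    coeff hq (T a) (e s) = c s * coeff hq a s := by
  induction a using mword_induction hq with
  | zero => simp
  | add a b ha hb => rw [map_add, coeff_add, ha, hb, coeff_add, mul_add]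
  | mword r t =>
    rw [map_smul, hT, coeff_smul, coeff_smul, coeff_smul, coeff_mword, coeff_mword]
    by_cases h : t = s
    · subst h; simp [mul_comm]
    · simp [h, he.ne h]

theorem coeff_map_of_notMem_range {T : SkewPoly q →ₗ[k] SkewPoly q}
    {e : Multiset (Fin n) → Multiset (Fin n)} {c : Multiset (Fin n) → k}
    (hT : ∀ s, T (mword q s) = c s • mword q (e s)) (a : SkewPoly q) {t : Multiset (Fin n)}
    (ht : ∀ s, e s ≠ t) : coeff hq (T a) t = 0 := by
  induction a using mword_induction hq with
  | zero => simp
  | add a b ha hb => rw [map_add, coeff_add, ha, hb, add_zero]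
  | mword r s =>
    rw [map_smul, hT, coeff_smul, coeff_smul, coeff_mword, if_neg (ht s), mul_zero, mul_zero]

theorem mword_mul_x (i : Fin n) (s : Multiset (Fin n)) :
    ∃ c : kˣ, mword q s * x q i = (c : k) • mword q (i ::ₘ s) := by
  obtain ⟨c, hc⟩ := word_eq_mword (q := q) (s.toList ++ [i])
  refine ⟨c, ?_⟩
  have e : ((s.toList ++ [i] : List (Fin n)) : Multiset (Fin n)) = i ::ₘ s := by
    rw [← Multiset.coe_add, Multiset.coe_toList, add_comm]; rfl
  rw [word_append, word_singleton, e] at hc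
  exact hc

theorem x_mul_mword (i : Fin n) (s : Multiset (Fin n)) :
    ∃ c : kˣ, x q i * mword q s = (c : k) • mword q (i ::ₘ s) := by
  obtain ⟨c, hc⟩ := word_eq_mword (q := q) (i :: s.toList)
  refine ⟨c, ?_⟩
  rw [word_cons, ← Multiset.cons_coe, Multiset.coe_toList] at hc
  exact hc

theorem coeff_mul_x (i : Fin n) (s : Multiset (Fin n)) :
    ∃ c : kˣ, ∀ a, coeff hq (a * x q i) (i ::ₘ s) = c * coeff hq a s := by
  choose c hc using mword_mul_x (q := q) i
  exact ⟨c s, fun a => coeff_map_of_injective hq (T := LinearMap.mulRight k (x q i))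
    (e := fun s => i ::ₘ s) (fun _ _ h => (Multiset.cons_inj_right i).mp h) (c := fun s => c s) hc a s⟩

theorem coeff_mul_x_of_notMem {i : Fin n} {t : Multiset (Fin n)} (h : i ∉ t) (a : SkewPoly q) :
    coeff hq (a * x q i) t = 0 := by
  choose c hc using mword_mul_x (q := q) i
  exact coeff_map_of_notMem_range hq (T := LinearMap.mulRight k (x q i))
    (e := fun s => i ::ₘ s) (c := fun s => c s) hc a fun s hs => h (by simp [← hs])

theorem coeff_x_mul (i : Fin n) (s : Multiset (Fin n)) :
    ∃ c : kˣ, ∀ a, coeff hq (x q i * a) (i ::ₘ s) = c * coeff hq a s := by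
  choose c hc using x_mul_mword (q := q) i
  exact ⟨c s, fun a => coeff_map_of_injective hq (T := LinearMap.mulLeft k (x q i))
    (e := fun s => i ::ₘ s) (fun _ _ h => (Multiset.cons_inj_right i).mp h) (c := fun s => c s) hc a s⟩

theorem coeff_x_mul_of_notMem {i : Fin n} {t : Multiset (Fin n)} (h : i ∉ t) (a : SkewPoly q) :
    coeff hq (x q i * a) t = 0 := by
  choose c hc using x_mul_mword (q := q) i
  exact coeff_map_of_notMem_range hq (T := LinearMap.mulLeft k (x q i))
    (e := fun s => i ::ₘ s) (c := fun s => c s) hc a fun s hs => h (by simp [← hs])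

/-- The left ideal generated by the variables in `S`. -/
theorem mem_span_x_iff (S : Set (Fin n)) (a : SkewPoly q) :
    a ∈ Submodule.span (SkewPoly q) (x q '' S) ↔ ∀ s, coeff hq a s ≠ 0 → ∃ j ∈ s, j ∈ S := by
  constructor
  · intro h
    induction h using Submodule.closure_induction with
    | zero => simp
    | add a b _ _ ha hb =>
      intro s hs
      by_contra h
      have h1 : coeff hq a s = 0 := by by_contra h'; exact h (ha s h')
      have h2 : coeff hq b s = 0 := by by_contra h'; exact h (hb s h')
      simp [h1, h2] at hs
    | smul_mem b _ h =>
      obtain ⟨j, hj, rfl⟩ := h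
      intro s hs
      refine ⟨j, ?_, hj⟩
      by_contra h
      exact hs (coeff_mul_x_of_notMem hq h b)
  · intro h
    rw [eq_sum_coeff hq a]
    refine Submodule.sum_mem _ fun s hs => ?_
    obtain ⟨j, hj, hjS⟩ := h s (Finsupp.mem_support_iff.mp hs)
    obtain ⟨t, rfl⟩ := Multiset.exists_cons_of_mem hj
    obtain ⟨c, hc⟩ := mword_mul_x (q := q) j t
    have : mword q (j ::ₘ t) = ((c⁻¹ : kˣ) : k) • (mword q t * x q j) := by
      rw [hc, smul_smul]; simp
    change _ • mword q (j ::ₘ t) ∈ _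
    rw [this, smul_smul, ← smul_mul_assoc]
    exact Submodule.smul_mem _ _ (Submodule.subset_span ⟨j, hjS, rfl⟩)

/-- The left ideal is spanned by the words with a letter in `S`. Multiplication by `x_i` is
injective on multisets and adds no letter of `S`. -/
theorem mem_span_x_of_mul_x_mem (hq : IsSkewMatrix q) {S : Set (Fin n)} {i : Fin n} (hi : i ∉ S) {a : SkewPoly q}
    (h : a * x q i ∈ Submodule.span (SkewPoly q) (x q '' S)) :
    a ∈ Submodule.span (SkewPoly q) (x q '' S) := by
  rw [mem_span_x_iff hq] at h ⊢
  intro s hs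
  obtain ⟨c, hc⟩ := coeff_mul_x hq i s
  obtain ⟨j, hj, hjS⟩ := h (i ::ₘ s) (by rw [hc]; exact mul_ne_zero c.ne_zero hs)
  rcases Multiset.mem_cons.mp hj with rfl | hj
  · exact absurd hjS hi
  · exact ⟨j, hj, hjS⟩

end

end SkewPoly

/-! ### Colours of skew polynomials -/

section Bichar

variable {k : Type u} [Field k] {n : ℕ} {q : Fin n → Fin n → kˣ}

theorem coe_prod_rowColor (m : Fin n → ℤ) (j : Fin n) :
    (∏ i, rowColor q i ^ m i : ColorGroup q).1 j = ∏ i, q i j ^ m i := by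
  simp [rowColor, Finset.prod_apply]

/-- Both sides are products of powers of the `q_{ij}`. Since the right side involves `h` but not the
exponents `m`, the left side does not depend on how `h` is written, and the bicharacter is well
defined. -/
theorem prod_zpow_eq (hq : IsSkewMatrix q) {g h : ColorGroup q} {l m : Fin n → ℤ}
    (hg : g = ∏ i, rowColor q i ^ l i) (hh : h = ∏ i, rowColor q i ^ m i) :
    ∏ j, g.1 j ^ m j = (∏ i, h.1 i ^ l i)⁻¹ := by
  rw [hg, hh]
  simp only [coe_prod_rowColor, ← Finset.prod_zpow, ← Finset.prod_inv_distrib]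
  rw [Finset.prod_comm]
  refine Finset.prod_congr rfl fun i _ => Finset.prod_congr rfl fun j _ => ?_
  rw [eq_inv_of_mul_eq_one_left (hq.anti i j), inv_zpow, inv_zpow, zpow_comm]

theorem bichar_eq (hq : IsSkewMatrix q) (g : ColorGroup q) {h : ColorGroup q} {m : Fin n → ℤ}
    (hh : h = ∏ i, rowColor q i ^ m i) : bichar q g h = ∏ j, g.1 j ^ m j := by
  obtain ⟨l, hl⟩ := exists_exponents q g
  rw [prod_zpow_eq hq hl hh, bichar, prod_zpow_eq hq hl (exists_exponents q h).choose_spec]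

theorem bichar_rowColor (hq : IsSkewMatrix q) (g : ColorGroup q) (i : Fin n) :
    bichar q g (rowColor q i) = g.1 i := by
  rw [bichar_eq hq g (m := Pi.single i 1)]
  · rw [Finset.prod_eq_single i]
    · simp
    · intro j _ hj; simp [Pi.single_eq_of_ne hj]
    · simp
  · rw [Finset.prod_eq_single i]
    · simp
    · intro j _ hj; simp [Pi.single_eq_of_ne hj]
    · simp

theorem bichar_mul_right (hq : IsSkewMatrix q) (a b c : ColorGroup q) :
    bichar q a (b * c) = bichar q a b * bichar q a c := by
  obtain ⟨l, hl⟩ := exists_exponents q b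
  obtain ⟨m, hm⟩ := exists_exponents q c
  rw [bichar_eq hq a hl, bichar_eq hq a hm, bichar_eq hq a (m := l + m), ← Finset.prod_mul_distrib]
  · simp [zpow_add]
  · rw [hl, hm, ← Finset.prod_mul_distrib]
    simp [zpow_add]

theorem bichar_antisymm (hq : IsSkewMatrix q) (a b : ColorGroup q) :
    bichar q a b = (bichar q b a)⁻¹ := by
  obtain ⟨l, hl⟩ := exists_exponents q a
  obtain ⟨m, hm⟩ := exists_exponents q b
  rw [bichar_eq hq a hm, bichar_eq hq b hl, prod_zpow_eq hq hl hm]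

/-- Antisymmetry alone gives a square root of one. But in `χ(ab, ab)` the mixed factors cancel, so
`a ↦ χ(a, a)` is a homomorphism, and it is trivial on the generators because `q_{ii} = 1`. -/
theorem bichar_self (hq : IsSkewMatrix q) (a : ColorGroup q) : bichar q a a = 1 := by
  have hmul : ∀ a b : ColorGroup q,
      bichar q (a * b) (a * b) = bichar q a a * bichar q b b := by
    intro a b
    rw [bichar_mul_right hq, bichar_antisymm hq _ a, bichar_antisymm hq _ b, bichar_mul_right hq,
      bichar_mul_right hq, bichar_antisymm hq a b, mul_inv, mul_inv, ← bichar_antisymm hq a a,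
      ← bichar_antisymm hq b b, bichar_antisymm hq b a, inv_inv, inv_inv,
      bichar_antisymm hq a b]
    simp [mul_assoc]
  let D : ColorGroup q →* kˣ := MonoidHom.mk' (fun a => bichar q a a) hmul
  obtain ⟨l, hl⟩ := exists_exponents q a
  change D a = 1
  rw [hl, map_prod]
  refine Finset.prod_eq_one fun i _ => ?_
  rw [map_zpow]
  have : D (rowColor q i) = 1 := (bichar_rowColor hq _ i).trans (hq.diag i)
  rw [this, one_zpow]

theorem isSkewBichar_bichar (hq : IsSkewMatrix q) : IsSkewBichar (bichar q) :=
  ⟨bichar_mul_right hq, bichar_antisymm hq, bichar_self hq⟩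

end Bichar

namespace SkewPoly

variable {k : Type u} [Field k] {n : ℕ} {q : Fin n → Fin n → kˣ}

/-- The colour of a word. -/
def wordColor (q : Fin n → Fin n → kˣ) (s : Multiset (Fin n)) : ColorGroup q :=
  (s.map (rowColor q)).prod

theorem wordColor_coe (l : List (Fin n)) : wordColor q l = (l.map (rowColor q)).prod := by
  simp [wordColor]

theorem bichar_wordColor (hq : IsSkewMatrix q) (g : ColorGroup q) (s : Multiset (Fin n)) :
    bichar q g (wordColor q s) = (s.map g.1).prod := by
  induction s using Multiset.induction_on with
  | empty => simpa [wordColor] using (isSkewBichar_bichar hq).one_right g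
  | cons i s ih =>
    rw [wordColor, Multiset.map_cons, Multiset.prod_cons, bichar_mul_right hq,
      bichar_rowColor hq, Multiset.map_cons, Multiset.prod_cons, ← ih]
    rfl

theorem mem_comp_iff (hq : IsSkewMatrix q) {d : ℕ} {g : ColorGroup q} {a : SkewPoly q} :
    a ∈ comp q d g ↔ ∀ s, coeff hq a s ≠ 0 → s.card = d ∧ wordColor q s = g := by
  rw [← mem_span_words hq (P := fun s => s.card = d ∧ wordColor q s = g)]
  simp only [comp, and_assoc, Multiset.coe_card, wordColor_coe, word]

theorem mem_homog_iff (hq : IsSkewMatrix q) {d : ℕ} {a : SkewPoly q} :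
    a ∈ homog q d ↔ ∀ s, coeff hq a s ≠ 0 → s.card = d := by
  rw [← mem_span_words hq (P := fun s => s.card = d)]
  simp only [homog, Multiset.coe_card, word]

theorem word_mem_comp (l : List (Fin n)) :
    word q l ∈ comp q l.length (wordColor q (l : Multiset (Fin n))) :=
  Submodule.subset_span ⟨l, rfl, (wordColor_coe l).symm, rfl⟩

theorem comp_induction {d : ℕ} {g : ColorGroup q} {p : (a : SkewPoly q) → a ∈ comp q d g → Prop}
    (zero : p 0 (zero_mem _))
    (add : ∀ a b ha hb, p a ha → p b hb → p (a + b) (add_mem ha hb))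
    (word : ∀ (c : k) (l : List (Fin n)) (_ : l.length = d) (_ : wordColor q l = g)
      (h : c • word q l ∈ comp q d g), p (c • word q l) h)
    {a : SkewPoly q} (ha : a ∈ comp q d g) : p a ha := by
  induction ha using Submodule.closure_induction with
  | zero => exact zero
  | add a b ha' hb' ha hb => exact add a b ha' hb' ha hb
  | smul_mem c _ h =>
    obtain ⟨l, hl, hl', rfl⟩ := h
    exact word c l hl (by rw [wordColor_coe, hl']) _

/-- The automorphism `x_j ↦ g_j x_j`. -/
def scaleHom (q : Fin n → Fin n → kˣ) (g : Fin n → kˣ) : SkewPoly q →ₐ[k] SkewPoly q :=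
  lift (fun i => (g i : k) • x q i) fun i j => by
    rw [smul_mul_smul_comm, smul_mul_smul_comm, x_mul_x, smul_smul, smul_smul]
    congr 1; ring

theorem scaleHom_x (g : Fin n → kˣ) (i : Fin n) : scaleHom q g (x q i) = (g i : k) • x q i :=
  lift_x _ _ i

theorem scaleHom_mul (g h : Fin n → kˣ) :
    scaleHom q (g * h) = (scaleHom q g).comp (scaleHom q h) := by
  refine algHom_ext fun i => ?_
  rw [scaleHom_x, AlgHom.comp_apply, scaleHom_x, map_smul, scaleHom_x, smul_smul, mul_comm]
  rfl

theorem scaleHom_one : scaleHom q 1 = AlgHom.id k _ := algHom_ext fun i => by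
  simp [scaleHom_x]

theorem scaleHom_word (g : Fin n → kˣ) (l : List (Fin n)) :
    scaleHom q g (word q l) = (((l : Multiset (Fin n)).map g).prod : k) • word q l := by
  induction l with
  | nil => simp
  | cons i l ih =>
    rw [word_cons, map_mul, ih, scaleHom_x, smul_mul_smul_comm, ← Multiset.cons_coe,
      Multiset.map_cons, Multiset.prod_cons]
    rfl

/-- The action of the torus on the skew polynomial ring. -/
def scale (q : Fin n → Fin n → kˣ) : (Fin n → kˣ) →* (SkewPoly q ≃ₐ[k] SkewPoly q) where
  toFun g := AlgEquiv.ofAlgHom (scaleHom q g) (scaleHom q g⁻¹)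
    (by rw [← scaleHom_mul, mul_inv_cancel, scaleHom_one])
    (by rw [← scaleHom_mul, inv_mul_cancel, scaleHom_one])
  map_one' := AlgEquiv.ext fun a => by
    change scaleHom q 1 a = a
    rw [scaleHom_one]; rfl
  map_mul' g h := AlgEquiv.ext fun a => by
    change scaleHom q (g * h) a = scaleHom q g (scaleHom q h a)
    rw [scaleHom_mul]; rfl

theorem scale_apply (g : Fin n → kˣ) (a : SkewPoly q) : scale q g a = scaleHom q g a := rfl

/-- The colour data of the skew polynomial ring. -/
def _root_.SkewKoszul.polyData (q : Fin n → Fin n → kˣ) :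
    ColorData k (ColorGroup q) (SkewPoly q) where
  χ := bichar q
  comp := comp q
  aut := (scale q).comp (Subgroup.subtype _)

theorem scale_of_mem_comp (hq : IsSkewMatrix q) {d : ℕ} {g' : ColorGroup q} (g : ColorGroup q)
    {a : SkewPoly q} (ha : a ∈ comp q d g') : scale q g.1 a = (bichar q g g' : k) • a := by
  induction ha using comp_induction with
  | zero => simp
  | add a b _ _ ha hb => rw [map_add, ha, hb, smul_add]
  | word c l hl hl' _ =>
    rw [map_smul, scale_apply, scaleHom_word, ← hl', bichar_wordColor hq, smul_comm]

theorem x_mul_word (i : Fin n) (l : List (Fin n)) : x q i * word q l =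
    (((l : Multiset (Fin n)).map (q i)).prod : k) • (word q l * x q i) := by
  induction l with
  | nil => simp
  | cons j l ih =>
    rw [word_cons, ← mul_assoc, x_mul_x, smul_mul_assoc, mul_assoc, ih, mul_smul_comm, smul_smul,
      ← Multiset.cons_coe, Multiset.map_cons, Multiset.prod_cons, mul_assoc]
    rfl

theorem word_mul_word (hq : IsSkewMatrix q) (l l' : List (Fin n)) : word q l * word q l' =
    (bichar q (wordColor q l) (wordColor q l') : k) • (word q l' * word q l) := by
  have H := isSkewBichar_bichar hq
  induction l with
  | nil => simp [wordColor, H.one_left]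
  | cons i l ih =>
    have e : wordColor q (i :: l : List (Fin n)) = rowColor q i * wordColor q l := by
      simp [wordColor]
    rw [word_cons, mul_assoc, ih, mul_smul_comm, ← mul_assoc, x_mul_word, smul_mul_assoc,
      smul_smul, mul_assoc, e, H.mul_left, bichar_wordColor hq (rowColor q i), mul_comm]
    rfl

/-- The projection onto the words with a given property. -/
def projWords (hq : IsSkewMatrix q) (P : Multiset (Fin n) → Prop) : SkewPoly q →ₗ[k] SkewPoly q :=
  open Classical in (basis hq).constr k fun s => if P s then mword q s else 0

open Classical in
theorem coeff_projWords (hq : IsSkewMatrix q) (P : Multiset (Fin n) → Prop) (a : SkewPoly q)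
    (s : Multiset (Fin n)) : coeff hq (projWords hq P a) s = if P s then coeff hq a s else 0 := by
  induction a using mword_induction hq with
  | zero => simp
  | add a b ha hb => rw [map_add, coeff_add, ha, hb]; split_ifs <;> simp
  | mword c t =>
    rw [projWords, map_smul, ← basis_apply hq, Module.Basis.constr_basis, basis_apply hq,
      coeff_smul, coeff_smul, coeff_mword]
    by_cases h : t = s
    · subst h
      by_cases h : P t <;> simp [coeff_mword, h]
    · by_cases h' : P t <;> simp [coeff_mword, h, h']

theorem good_polyData (hq : IsSkewMatrix q) : (polyData q).Good where
  bichar := isSkewBichar_bichar hq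
  one_mem := word_mem_comp (q := q) []
  mul_mem {e g e' g' r s} hr hs := by
    change r ∈ comp q e g at hr
    change s ∈ comp q e' g' at hs
    change r * s ∈ comp q (e + e') (g * g')
    induction hr using comp_induction with
    | zero => simp
    | add a b _ _ ha hb => rw [add_mul]; exact add_mem ha hb
    | word c l hl hlg _ =>
    induction hs using comp_induction with
    | zero => simp
    | add a b _ _ ha hb => rw [mul_add]; exact add_mem ha hb
    | word c' l' hl' hlg' _ =>
      rw [smul_mul_smul_comm, ← word_append]
      refine Submodule.smul_mem _ _ ?_
      have := word_mem_comp (q := q) (l ++ l')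
      rw [List.length_append, hl, hl', ← Multiset.coe_add, wordColor, Multiset.map_add,
        Multiset.prod_add] at this
      rw [← hlg, ← hlg']
      exact this
  spans := by
    rw [eq_top_iff]
    rintro a -
    induction a using SkewPoly.induction with
    | zero => exact zero_mem _
    | add a b ha hb => exact add_mem ha hb
    | word c l => exact Submodule.smul_mem _ _ (Submodule.mem_iSup_of_mem (l.length, wordColor q l)
        (word_mem_comp l))
  proj e g := by
    classical
    refine ⟨projWords hq fun s => s.card = e ∧ wordColor q s = g, fun r hr => ?_,
      fun e' g' hne r hr => ?_⟩
    · refine ext_coeff hq fun s => ?_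
      rw [coeff_projWords]
      split_ifs with h
      · rfl
      · by_contra h'
        exact h ((mem_comp_iff hq).mp hr s (Ne.symm h'))
    · refine ext_coeff hq fun s => ?_
      rw [coeff_projWords, coeff_zero]
      split_ifs with h
      · by_contra h'
        have := (mem_comp_iff hq).mp hr s h'
        exact hne (by rw [← h.1, ← h.2, this.1, this.2])
      · rfl
  aut_apply g r hr := scale_of_mem_comp hq g hr
  comm {e g e' g' r s} hr hs := by
    change r ∈ comp q e g at hr
    change s ∈ comp q e' g' at hs
    change r * s = (bichar q g g' : k) • (s * r)
    induction hr using comp_induction with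
    | zero => simp
    | add a b _ _ ha hb => rw [add_mul, ha, hb, mul_add, smul_add]
    | word c l hl hlg _ =>
    induction hs using comp_induction with
    | zero => simp
    | add a b _ _ ha hb => rw [mul_add, ha, hb, add_mul, smul_add]
    | word c' l' hl' hlg' _ =>
      rw [smul_mul_smul_comm, word_mul_word hq, hlg, hlg', smul_mul_smul_comm, smul_comm,
        mul_comm c]

theorem exists_eq_sum_smul_x {a : SkewPoly q} (ha : a ∈ homog q 1) :
    ∃ c : Fin n → k, a = ∑ i, c i • x q i := by
  induction ha using Submodule.span_induction with
  | mem a ha =>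
    obtain ⟨l, hl, rfl⟩ := ha
    obtain ⟨i, rfl⟩ := List.length_eq_one_iff.mp hl
    exact ⟨Pi.single i 1, by simp [Pi.single_apply]⟩
  | zero => exact ⟨0, by simp⟩
  | add a b _ _ ha hb =>
    obtain ⟨c, rfl⟩ := ha
    obtain ⟨c', rfl⟩ := hb
    exact ⟨c + c', by simp [add_smul, Finset.sum_add_distrib]⟩
  | smul r a _ ha =>
    obtain ⟨c, rfl⟩ := ha
    exact ⟨r • c, by simp [smul_smul, Finset.smul_sum]⟩

theorem coeff_sum (hq : IsSkewMatrix q) {κ : Type*} (S : Finset κ) (a : κ → SkewPoly q)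
    (s : Multiset (Fin n)) : coeff hq (∑ i ∈ S, a i) s = ∑ i ∈ S, coeff hq (a i) s := by
  simp [coeff]

theorem x_mem_homog (i : Fin n) : x q i ∈ homog q 1 :=
  Submodule.subset_span ⟨[i], rfl, (word_singleton i).symm⟩

/-- The normalizing automorphism of a normal element rescales the variables. -/
theorem exists_mul_x_eq (hq : IsSkewMatrix q) {f : SkewPoly q} (h0 : f ≠ 0) (hf : IsNormal f)
    (i : Fin n) : ∃ c : k, f * x q i = c • (x q i * f) := by
  obtain ⟨σ, hσ, hσf, -⟩ := hf
  obtain ⟨c, hc⟩ := exists_eq_sum_smul_x (hσ 1 _ (x_mem_homog i))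
  refine ⟨c i, ?_⟩
  have hfx := hσf (x q i)
  rw [hc, Finset.sum_mul] at hfx
  rw [hfx, Finset.sum_eq_single i]
  · rw [smul_mul_assoc]
  · intro l _ hl
    suffices c l = 0 by rw [this, zero_smul, zero_mul]
    -- Choose a word `t` of `f` in which `x_l` occurs most often. In `f x_i`, and in `x_j f` with `j
    -- ≠ l`, the word `x_l t` could only come from a word of `f` with one more `x_l`. So its
    -- coefficient isolates `c l`.
    obtain ⟨t, ht, hmax⟩ := ((basis hq).repr f).support.exists_max_image (fun t => t.count l) (by
      rw [Finset.nonempty_iff_ne_empty, Ne, Finsupp.support_eq_empty]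
      simpa using h0)
    rw [Finsupp.mem_support_iff] at ht
    have hbig : ∀ t', t.count l < t'.count l → coeff hq f t' = 0 := by
      intro t' hlt
      by_contra h
      exact absurd (hmax t' (Finsupp.mem_support_iff.mpr h)) (not_le.mpr hlt)
    have hcnt : ∀ j t', j ≠ l → l ::ₘ t = j ::ₘ t' → coeff hq f t' = 0 := by
      intro j t' hj he
      refine hbig t' ?_
      have := congrArg (Multiset.count l) he
      rw [Multiset.count_cons_self, Multiset.count_cons_of_ne hj.symm] at this
      omega
    have h1 : coeff hq (f * x q i) (l ::ₘ t) = 0 := by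
      by_cases hi : i ∈ l ::ₘ t
      · obtain ⟨t', ht'⟩ := Multiset.exists_cons_of_mem hi
        obtain ⟨r, hr⟩ := coeff_mul_x hq i t'
        rw [ht', hr, hcnt i t' hl.symm ht', mul_zero]
      · exact coeff_mul_x_of_notMem hq hi f
    rw [hfx, coeff_sum, Finset.sum_eq_single l] at h1
    · obtain ⟨r, hr⟩ := coeff_x_mul hq l t
      rw [smul_mul_assoc, coeff_smul, hr] at h1
      rcases mul_eq_zero.mp h1 with h1 | h1
      · exact h1
      · exact absurd h1 (mul_ne_zero r.ne_zero ht)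
    · intro j _ hj
      rw [smul_mul_assoc, coeff_smul]
      by_cases hjm : j ∈ l ::ₘ t
      · obtain ⟨t', ht'⟩ := Multiset.exists_cons_of_mem hjm
        obtain ⟨r, hr⟩ := coeff_x_mul hq j t'
        rw [ht', hr, hcnt j t' hj ht', mul_zero, mul_zero]
      · rw [coeff_x_mul_of_notMem hq hjm, mul_zero]
    · simp
  · simp

/-- Normal homogeneous elements are colour homogeneous. -/
theorem exists_mem_comp_of_isNormal (hq : IsSkewMatrix q) {f : SkewPoly q} (h0 : f ≠ 0)
    (hf : IsNormal f) {d : ℕ} (hd : f ∈ homog q d) : ∃ g, f ∈ comp q d g := by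
  choose c hc using exists_mul_x_eq hq h0 hf
  -- Moving `x_i` past the word `t` costs the `i`-th coordinate of the colour of `t`, which must be
  -- `c i` for every word of `f`. A colour is determined by its coordinates.
  have key : ∀ t, coeff hq f t ≠ 0 → ∀ i, ((wordColor q t).1 i : k) = c i := by
    intro t ht i
    choose r hr using x_mul_mword (q := q) i
    have h1 : ∀ s, mword q s * x q i = ((wordColor q s).1 i * r s : k) • mword q (i ::ₘ s) := by
      intro s
      have := word_mul_word hq s.toList [i]
      rw [word_singleton, Multiset.coe_toList, show wordColor q ([i] : List (Fin n)) = rowColor q i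
        by simp [wordColor], bichar_rowColor hq] at this
      rw [mul_smul, ← hr]
      exact this
    have h2 := coeff_map_of_injective hq (T := LinearMap.mulRight k (x q i))
      (e := fun s => i ::ₘ s) (fun _ _ h => (Multiset.cons_inj_right i).mp h)
      (c := fun s => ((wordColor q s).1 i * r s : k)) h1 f t
    have h3 := coeff_map_of_injective hq (T := LinearMap.mulLeft k (x q i))
      (e := fun s => i ::ₘ s) (fun _ _ h => (Multiset.cons_inj_right i).mp h)
      (c := fun s => (r s : k)) hr f t
    simp only [LinearMap.mulRight_apply, LinearMap.mulLeft_apply] at h2 h3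
    rw [hc i, coeff_smul, h3] at h2
    have hne : (r t : k) * coeff hq f t ≠ 0 := mul_ne_zero (r t).ne_zero ht
    apply mul_right_cancel₀ hne
    linear_combination -h2
  obtain ⟨t₀, ht₀⟩ := exists_coeff_ne_zero hq h0
  refine ⟨wordColor q t₀, (mem_comp_iff hq).mpr fun s hs => ⟨(mem_homog_iff hq).mp hd s hs, ?_⟩⟩
  refine Subtype.ext (funext fun i => Units.ext ?_)
  rw [key s hs, key t₀ ht₀]

theorem exists_eq_sum_mul_x {d : ℕ} {g : ColorGroup q} {f : SkewPoly q}
    (hf : f ∈ comp q (d + 1) g) : ∃ a : Fin n → SkewPoly q,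
      (∀ i, a i ∈ comp q d (g * (rowColor q i)⁻¹)) ∧ f = ∑ i, a i * x q i := by
  induction hf using comp_induction with
  | zero => exact ⟨0, fun i => zero_mem _, by simp⟩
  | add a b _ _ ha hb =>
    obtain ⟨a, ha, rfl⟩ := ha
    obtain ⟨b, hb, rfl⟩ := hb
    exact ⟨a + b, fun i => add_mem (ha i) (hb i), by simp [add_mul, Finset.sum_add_distrib]⟩
  | word c l hl hlg _ =>
    obtain ⟨l', i, rfl⟩ : ∃ l' i, l = l' ++ [i] :=
      ⟨l.dropLast, l.getLast (by rintro rfl; simp at hl), (List.dropLast_append_getLast _).symm⟩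
    refine ⟨Pi.single i (c • word q l'), fun j => ?_, ?_⟩
    · by_cases hj : j = i
      · subst hj
        rw [Pi.single_eq_same]
        refine Submodule.smul_mem _ _ ?_
        have h := word_mem_comp (q := q) l'
        have e : wordColor q (l' : Multiset (Fin n)) = g * (rowColor q j)⁻¹ := by
          rw [← hlg]; simp [wordColor]
        rw [e] at h
        simp at hl
        rwa [hl] at h
      · rw [Pi.single_eq_of_ne hj]; exact zero_mem _
    · rw [Finset.sum_eq_single i]
      · rw [Pi.single_eq_same, smul_mul_assoc, word_append, word_singleton]
      · intro j _ hj; rw [Pi.single_eq_of_ne hj, zero_mul]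
      · simp

end SkewPoly

/-! ### Quotients of skew polynomial rings -/

namespace SkewQuot

variable {k : Type u} [Field k] {n c : ℕ} {q : Fin n → Fin n → kˣ} {f : Fin c → SkewPoly q}

theorem mk_surjective : Function.Surjective (mk f) :=
  RingCon.mk'_surjective _

theorem mk_eq_zero {a : SkewPoly q} : mk f a = 0 ↔ a ∈ TwoSidedIdeal.span (Set.range f) := by
  rw [TwoSidedIdeal.mem_iff, ← RingCon.eq]
  rfl

theorem mk_gen (j : Fin c) : mk f (f j) = 0 :=
  mk_eq_zero.mpr (TwoSidedIdeal.subset_span ⟨j, rfl⟩)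

/-- Algebra homomorphisms from the quotient. -/
def lift {B : Type*} [Ring B] [Algebra k B] (φ : SkewPoly q →ₐ[k] B) (h : ∀ j, φ (f j) = 0) :
    SkewQuot f →ₐ[k] B where
  toRingHom := RingCon.lift _ (φ : SkewPoly q →+* B) (by
    have hle : TwoSidedIdeal.span (Set.range f) ≤ TwoSidedIdeal.ker (φ : SkewPoly q →+* B) := by
      rw [TwoSidedIdeal.span_le]
      rintro _ ⟨j, rfl⟩
      exact (TwoSidedIdeal.mem_ker _).mpr (h j)
    intro a b hab
    have := hle ((TwoSidedIdeal.rel_iff _ a b).mp hab)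
    rw [TwoSidedIdeal.mem_ker, map_sub, sub_eq_zero] at this
    exact this)
  commutes' r := φ.commutes r

theorem algHom_ext {B : Type*} [Ring B] [Algebra k B] {φ ψ : SkewQuot f →ₐ[k] B}
    (h : ∀ i, φ (x f i) = ψ (x f i)) : φ = ψ := by
  have : φ.comp (mk f) = ψ.comp (mk f) := SkewPoly.algHom_ext h
  refine AlgHom.ext fun a => ?_
  obtain ⟨a, rfl⟩ := mk_surjective a
  exact DFunLike.congr_fun this a

section

variable (hq : IsSkewMatrix q) {δ : Fin c → ℕ} {γ : Fin c → ColorGroup q}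
  (hf : ∀ j, f j ∈ SkewPoly.comp q (δ j) (γ j))

set_option linter.unusedSectionVars false

include hq hf

theorem mk_scale_gen (g : ColorGroup q) (j : Fin c) : mk f (SkewPoly.scale q g.1 (f j)) = 0 := by
  rw [SkewPoly.scale_of_mem_comp hq g (hf j), map_smul, mk_gen, smul_zero]

/-- A colour homogeneous `f_j` is an eigenvector of each rescaling of the variables, so the
rescalings preserve the ideal and descend to the quotient. Hence `colorAct` does not take its
default value. -/
theorem exists_colorAct : ∃ φ : ColorGroup q →* (SkewQuot f ≃ₐ[k] SkewQuot f),
    ∀ g i, φ g (SkewQuot.x f i) = (g.1 i : k) • SkewQuot.x f i := by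
  let ψ (g : ColorGroup q) : SkewQuot f →ₐ[k] SkewQuot f :=
    lift ((mk f).comp (SkewPoly.scale q g.1 : SkewPoly q →ₐ[k] SkewPoly q)) (mk_scale_gen hq hf g)
  have hx : ∀ g i, ψ g (x f i) = (g.1 i : k) • x f i := by
    intro g i
    change mk f (SkewPoly.scaleHom q g.1 (SkewPoly.x q i)) = _
    rw [SkewPoly.scaleHom_x, map_smul]
    rfl
  have h1 : ψ 1 = AlgHom.id k _ := algHom_ext fun i => by rw [hx]; simp
  have hm : ∀ g h, ψ (g * h) = (ψ g).comp (ψ h) := fun g h => algHom_ext fun i => by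
    rw [hx, AlgHom.comp_apply, hx, map_smul, hx, smul_smul, mul_comm]; rfl
  refine ⟨⟨⟨fun g => AlgEquiv.ofAlgHom (ψ g) (ψ g⁻¹) ?_ ?_, ?_⟩, ?_⟩, hx⟩
  · rw [← hm, mul_inv_cancel, h1]
  · rw [← hm, inv_mul_cancel, h1]
  · exact AlgEquiv.ext fun a => DFunLike.congr_fun h1 a
  · exact fun g h => AlgEquiv.ext fun a => DFunLike.congr_fun (hm g h) a

theorem colorAct_x (g : ColorGroup q) (i : Fin n) :
    colorAct f g (x f i) = (g.1 i : k) • x f i := by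
  have h := exists_colorAct hq hf
  rw [colorAct, dif_pos h]
  exact h.choose_spec g i

theorem colorAct_mk (g : ColorGroup q) (a : SkewPoly q) :
    colorAct f g (mk f a) = mk f (SkewPoly.scale q g.1 a) := by
  have : ((colorAct f g : SkewQuot f →ₐ[k] SkewQuot f)).comp (mk f) =
      (mk f).comp (SkewPoly.scale q g.1 : SkewPoly q →ₐ[k] SkewPoly q) :=
    SkewPoly.algHom_ext fun i => by
      change colorAct f g (x f i) = mk f (SkewPoly.scaleHom q g.1 (SkewPoly.x q i))
      rw [colorAct_x hq hf, SkewPoly.scaleHom_x, map_smul]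
      rfl
  exact DFunLike.congr_fun this a

/-- The coaction of the monoid of degrees and colours on the quotient. -/
theorem exists_coaction : ∃ Δ : SkewQuot f →ₐ[k] MonoidAlgebra (SkewQuot f)
      (Multiplicative ℕ × ColorGroup q),
    ∀ d g, ∀ a ∈ SkewPoly.comp q d g,
      Δ (mk f a) = MonoidAlgebra.single (Multiplicative.ofAdd d, g) (mk f a) := by
  let y (i : Fin n) : MonoidAlgebra (SkewQuot f) (Multiplicative ℕ × ColorGroup q) :=
    MonoidAlgebra.single (Multiplicative.ofAdd 1, rowColor q i) (x f i)
  have hy : ∀ i j, y i * y j = (q i j : k) • (y j * y i) := by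
    intro i j
    simp only [y, MonoidAlgebra.single_mul_single, MonoidAlgebra.smul_single]
    rw [mul_comm]
    congr 1
    rw [x, x, ← map_mul, SkewPoly.x_mul_x, map_smul, map_mul]
  have hw : ∀ l : List (Fin n), SkewPoly.lift y hy (SkewPoly.word q l) =
      MonoidAlgebra.single (Multiplicative.ofAdd l.length, SkewPoly.wordColor q l)
        (mk f (SkewPoly.word q l)) := by
    intro l
    induction l with
    | nil => simp [SkewPoly.wordColor]; rfl
    | cons i l ih =>
      rw [SkewPoly.word_cons, map_mul, ih, SkewPoly.lift_x, MonoidAlgebra.single_mul_single,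
        map_mul]
      congr 1
      rw [Prod.mk_mul_mk, ← ofAdd_add, List.length_cons, add_comm, ← Multiset.cons_coe,
        SkewPoly.wordColor, SkewPoly.wordColor, Multiset.map_cons, Multiset.prod_cons]
  have hc : ∀ d g, ∀ a ∈ SkewPoly.comp q d g, SkewPoly.lift y hy a =
      MonoidAlgebra.single (Multiplicative.ofAdd d, g) (mk f a) := by
    intro d g a ha
    induction ha using SkewPoly.comp_induction with
    | zero => simp
    | add a b _ _ ha hb => rw [map_add, ha, hb, map_add, MonoidAlgebra.single_add]
    | word r l hl hlg _ =>
      rw [map_smul, hw, hl, hlg, map_smul, MonoidAlgebra.smul_single]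
  refine ⟨lift (SkewPoly.lift y hy) fun j => ?_, fun d g a ha => hc d g a ha⟩
  rw [hc _ _ _ (hf j), mk_gen, MonoidAlgebra.single_zero]

/-- Everything is inherited from the skew polynomial ring except the directness of the grading. The
coaction labels a homogeneous element by its degree and colour, and reading off one label gives the
required projection. -/
theorem good_colorData : (colorData f).Good where
  bichar := isSkewBichar_bichar hq
  one_mem := ⟨1, (SkewPoly.good_polyData hq).one_mem, map_one (mk f)⟩
  mul_mem {e g e' g' r s} hr hs := by
    obtain ⟨r, hr, rfl⟩ := hr
    obtain ⟨s, hs, rfl⟩ := hs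
    exact ⟨r * s, (SkewPoly.good_polyData hq).mul_mem hr hs, map_mul (mk f) _ _⟩
  spans := by
    have h := congrArg (Submodule.map (mk f).toLinearMap) (SkewPoly.good_polyData hq).spans
    rw [Submodule.map_iSup, Submodule.map_top, LinearMap.range_eq_top.mpr mk_surjective] at h
    exact h
  proj e g := by
    obtain ⟨Δ, hΔ⟩ := exists_coaction hq hf
    let ev : MonoidAlgebra (SkewQuot f) (Multiplicative ℕ × ColorGroup q) →ₗ[k] SkewQuot f :=
      { toFun := fun a => a.coeff (Multiplicative.ofAdd e, g)
        map_add' := fun a b => rfl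
        map_smul' := fun a b => rfl }
    refine ⟨ev.comp Δ.toLinearMap, ?_, ?_⟩
    · rintro _ ⟨a, ha, rfl⟩
      change (Δ (mk f a)).coeff (Multiplicative.ofAdd e, g) = mk f a
      rw [hΔ e g a ha, MonoidAlgebra.coeff_single]
      exact Finsupp.single_eq_same
    · rintro e' g' hne _ ⟨a, ha, rfl⟩
      change (Δ (mk f a)).coeff (Multiplicative.ofAdd e, g) = 0
      rw [hΔ e' g' a ha, MonoidAlgebra.coeff_single]
      exact Finsupp.single_eq_of_ne fun h => hne (by
        simp only [Prod.mk.injEq] at h ⊢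
        exact ⟨Multiplicative.ofAdd.injective h.1.symm, h.2.symm⟩)
  aut_apply {e g'} g r hr := by
    obtain ⟨a, ha, rfl⟩ := hr
    change colorAct f g (mk f a) = _ • mk f a
    rw [colorAct_mk hq hf, SkewPoly.scale_of_mem_comp hq g ha, map_smul]
    rfl
  comm {e g e' g' r s} hr hs := by
    obtain ⟨r, hr, rfl⟩ := hr
    obtain ⟨s, hs, rfl⟩ := hs
    change mk f r * mk f s = (bichar q g g' : k) • (mk f s * mk f r)
    rw [← map_mul, ← map_mul, ← map_smul]
    exact congrArg _ ((SkewPoly.good_polyData hq).comm hr hs)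

end

end SkewQuot

/-! ### Coefficients, subalgebras on sets of variables, and change of rings -/

namespace Mon

variable {G : Type v} {ι : Type t} {V : Vars G ι}

/-- The monomial involves only variables in `S`. -/
def On (S : Set ι) (I : Mon V) : Prop := ∀ v, v ∉ S → I.exp v = 0

/-- The monomial with the variable `v` removed. -/
def erase [DecidableEq ι] (I : Mon V) (v : ι) : Mon V :=
  I.sub (fun w => if w = v then 0 else I.exp w) fun w => by split_ifs <;> simp

theorem On.mono {S S' : Set ι} (h : S ⊆ S') {I : Mon V} (hI : I.On S) : I.On S' :=
  fun v hv => hI v fun h' => hv (h h')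

theorem On.add {S : Set ι} {I J : Mon V} (hI : I.On S) (hJ : J.On S) (h : I.Compat J) :
    (I.add J h).On S := fun v hv => by simp [Mon.add, hI v hv, hJ v hv]

theorem On.erase [DecidableEq ι] {S : Set ι} {v : ι} {I : Mon V} (hI : I.On (insert v S)) :
    (I.erase v).On S := fun w hw => by
  simp only [Mon.erase, Mon.sub]
  split_ifs with h
  · rfl
  · exact hI w (by simp [h, hw])

theorem On.pred [DecidableEq ι] {S : Set ι} {I : Mon V} (hI : I.On S) (v : ι) : (I.pred v).On S :=
  fun w hw => by simp [Mon.pred, Mon.sub, hI w hw]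

theorem On.one (S : Set ι) : (Mon.one V).On S := fun _ _ => rfl

end Mon

namespace SemiFree

section

set_option linter.unusedSectionVars false

variable {k : Type u} [Field k] {G : Type v} [CommGroup G] {R : Type w} [Ring R] [Algebra k R]
variable {ι : Type t} [Fintype ι] [LinearOrder ι]
variable {C : ColorData k G R} {V : Vars G ι} {z : ι → SemiFree C V}

/-- The coefficient of a monomial, as a linear map. -/
def cf (C : ColorData k G R) {V : Vars G ι} (I : Mon V) : SemiFree C V →ₗ[R] R := Finsupp.lapply I

open Classical in
theorem cf_term (I J : Mon V) (r : R) : cf C J (term C I r) = if I = J then r else 0 :=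
  Finsupp.single_apply

theorem ext_cf {a b : SemiFree C V} (h : ∀ I, cf C I a = cf C I b) : a = b := Finsupp.ext h

/-- The elements supported on the monomials with a given property. -/
def supp (C : ColorData k G R) {V : Vars G ι} (P : Mon V → Prop) : Submodule R (SemiFree C V) :=
  Finsupp.supported R R {I | P I}

theorem mem_supp {P : Mon V → Prop} {a : SemiFree C V} :
    a ∈ supp C P ↔ ∀ I, cf C I a ≠ 0 → P I :=
  ⟨fun h _ hI => h (Finsupp.mem_support_iff.mpr hI),
    fun h _ hI => h _ (Finsupp.mem_support_iff.mp hI)⟩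

theorem term_mem_supp {P : Mon V → Prop} {I : Mon V} (hI : P I) (r : R) :
    term C I r ∈ supp C P := Finsupp.single_mem_supported R r hI

theorem supp_induction {P : Mon V → Prop} {p : (a : SemiFree C V) → a ∈ supp C P → Prop}
    (zero : p 0 (zero_mem _))
    (add : ∀ a b ha hb, p a ha → p b hb → p (a + b) (add_mem ha hb))
    (term : ∀ I r (h : P I), p (term C I r) (term_mem_supp h r))
    {a : SemiFree C V} (ha : a ∈ supp C P) : p a ha := by
  have h' : supp C P = Submodule.span R ((fun I => SemiFree.term C I 1) '' {I | P I}) :=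
    Finsupp.supported_eq_span_single R _
  suffices ∀ a ∈ Submodule.span R ((fun I => SemiFree.term C I 1) '' {I | P I}),
      ∀ ha : a ∈ supp C P, p a ha from this a (h' ▸ ha) ha
  intro a ha
  induction ha using Submodule.closure_induction with
  | zero => exact fun _ => zero
  | add a b ha hb iha ihb =>
    exact fun _ => add a b (h' ▸ ha) (h' ▸ hb) (iha _) (ihb _)
  | smul_mem r _ h =>
    obtain ⟨I, hI, rfl⟩ := h
    intro hm
    have := term I r hI
    simp only [term_eq_smul I r] at this
    exact this

theorem mulTerm_mem_supp {P : Mon V → Prop} {I J : Mon V} (r : R)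
    (h : ∀ hc : I.Compat J, P (I.add J hc)) : mulTerm C I J r ∈ supp C P := by
  unfold mulTerm
  split_ifs with hc
  · exact term_mem_supp (h hc) _
  · exact zero_mem _

theorem mul_mem_supp {P P' P'' : Mon V → Prop}
    (h : ∀ I J, P I → P' J → ∀ hc : I.Compat J, P'' (I.add J hc)) {a b : SemiFree C V}
    (ha : a ∈ supp C P) (hb : b ∈ supp C P') : a * b ∈ supp C P'' := by
  induction ha using supp_induction with
  | zero => simp
  | add a a' _ _ h h' => rw [add_mul]; exact add_mem h h'
  | term I r hI =>
  induction hb using supp_induction with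
  | zero => simp
  | add a a' _ _ h h' => rw [mul_add]; exact add_mem h h'
  | term J s hJ => rw [term_mul_term]; exact mulTerm_mem_supp _ (h I J hI hJ)

theorem supp_smul_mem {P : Mon V → Prop} (c : k) {a : SemiFree C V} (ha : a ∈ supp C P) :
    c • a ∈ supp C P := by
  rw [← smul_one_smul R c a]; exact Submodule.smul_mem _ _ ha

/-- The subalgebra `R⟨S⟩`, as a module. -/
abbrev sub (C : ColorData k G R) (V : Vars G ι) (S : Set ι) : Submodule R (SemiFree C V) :=
  supp C (Mon.On (V := V) S)

theorem part_eq_supp (S : Set ι) (m : ℕ) :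
    part C V S m = supp C fun I => I.hdeg = m ∧ I.On S := rfl

theorem sub_mono {S S' : Set ι} (h : S ⊆ S') : sub C V S ≤ sub C V S' := fun _ ha =>
  mem_supp.mpr fun I hI => (mem_supp.mp ha I hI).mono h

theorem part_le_sub (S : Set ι) (m : ℕ) : part C V S m ≤ sub C V S := fun _ ha =>
  mem_supp.mpr fun I hI => (mem_supp.mp (part_eq_supp (C := C) S m ▸ ha) I hI).2

theorem mul_mem_sub {S : Set ι} {a b : SemiFree C V} (ha : a ∈ sub C V S) (hb : b ∈ sub C V S) :
    a * b ∈ sub C V S := mul_mem_supp (fun _ _ h h' hc => h.add h' hc) ha hb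

theorem mul_mem_part {S : Set ι} {m m' : ℕ} {a b : SemiFree C V} (ha : a ∈ part C V S m)
    (hb : b ∈ part C V S m') : a * b ∈ part C V S (m + m') :=
  mul_mem_supp (fun I J h h' hc => ⟨by rw [Mon.hdeg_add, h.1, h'.1], Mon.On.add h.2 h'.2 hc⟩) ha hb

theorem one_mem_sub (S : Set ι) : (1 : SemiFree C V) ∈ sub C V S :=
  term_mem_supp (Mon.On.one S) 1

theorem one_mem_part (S : Set ι) : (1 : SemiFree C V) ∈ part C V S 0 :=
  term_mem_supp (P := fun I : Mon V => I.hdeg = 0 ∧ I.On S)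
    ⟨by simp [Mon.hdeg, Mon.one], Mon.On.one S⟩ 1

theorem dMon_mem (H : C.Good) (hz : IsDiff C V z) {S : Set ι} {I : Mon V} (hI : I.On S)
    {M : Submodule R (SemiFree C V)}
    (h : ∀ v ∈ S, I.exp v ≠ 0 → z v * term C (I.pred v) 1 ∈ M) : dMon z I ∈ M := by
  rw [dMon_eq H hz]
  refine Submodule.sum_mem _ fun v _ => ?_
  split_ifs with h0
  · exact zero_mem _
  · rw [← smul_one_smul R]
    refine Submodule.smul_mem _ _ (h v ?_ h0)
    by_contra hv
    exact h0 (hI v hv)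

theorem d_mem_sub (H : C.Good) (hz : IsDiff C V z) {S : Set ι} (hS : ∀ v ∈ S, z v ∈ sub C V S)
    {a : SemiFree C V} (ha : a ∈ sub C V S) : d z a ∈ sub C V S := by
  induction ha using supp_induction with
  | zero => simp
  | add a a' _ _ h h' => rw [map_add]; exact add_mem h h'
  | term I r hI =>
    rw [d_term]
    exact Submodule.smul_mem _ _ (dMon_mem H hz hI fun v hv _ =>
      mul_mem_sub (hS v hv) (term_mem_supp (Mon.On.pred hI v) 1))

theorem d_mem_part (H : C.Good) (hz : IsDiff C V z) {S : Set ι}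
    (hS : ∀ v ∈ S, ∃ h, V.hdeg v = h + 1 ∧ z v ∈ part C V S h) {m : ℕ}
    {a : SemiFree C V} (ha : a ∈ part C V S (m + 1)) : d z a ∈ part C V S m := by
  rw [part_eq_supp] at ha
  induction ha using supp_induction with
  | zero => simp
  | add a a' _ _ h h' => rw [map_add]; exact add_mem h h'
  | term I r hI =>
    rw [d_term]
    refine Submodule.smul_mem _ _ (dMon_mem H hz hI.2 fun v hv h0 => ?_)
    obtain ⟨h, hh, hzv⟩ := hS v hv
    have h1 : term C (I.pred v) 1 ∈ part C V S (I.pred v).hdeg :=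
      term_mem_supp (P := fun J : Mon V => J.hdeg = (I.pred v).hdeg ∧ J.On S)
        ⟨rfl, Mon.On.pred hI.2 v⟩ 1
    have h2 := mul_mem_part hzv h1
    have h3 := Mon.pred_hdeg h0
    rwa [show h + (I.pred v).hdeg = m by have := hI.1; omega] at h2

theorem d_one : d z (1 : SemiFree C V) = 0 := by
  rw [one_def, d_mon, dMon]
  exact Finset.sum_eq_zero fun v _ => if_pos rfl

theorem d_smul_one (r : R) : d z (r • (1 : SemiFree C V)) = 0 := by
  rw [map_smul, d_one, smul_zero]

theorem inv_mem_supp {P : Mon V → Prop} {a : SemiFree C V} (ha : a ∈ supp C P) :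
    inv C V a ∈ supp C P := by
  induction ha using supp_induction with
  | zero => simp
  | add a a' _ _ h h' => rw [map_add]; exact add_mem h h'
  | term I r hI => rw [inv_term]; exact supp_smul_mem _ (term_mem_supp hI r)

theorem inv_of_mem_part {S : Set ι} {m : ℕ} {a : SemiFree C V} (ha : a ∈ part C V S m) :
    inv C V a = (-1 : k) ^ m • a := by
  rw [part_eq_supp] at ha
  induction ha using supp_induction with
  | zero => simp
  | add a a' _ _ h h' => rw [map_add, h, h', smul_add]
  | term I r hI => rw [inv_term, hI.1]

theorem inv_inv (a : SemiFree C V) : inv C V (inv C V a) = a := by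
  induction a using SemiFree.induction with
  | zero => simp
  | add a a' h h' => rw [map_add, map_add, h, h']
  | term I r =>
    rw [inv_term, smul_term, inv_term, smul_term, smul_smul, ← pow_add, ← two_mul, pow_mul]
    simp

/-- The elements whose coefficients lie in a two-sided ideal. -/
def coefIdeal (C : ColorData k G R) (V : Vars G ι) (J : TwoSidedIdeal R) :
    Submodule R (SemiFree C V) where
  carrier := {a | ∀ I, cf C I a ∈ J}
  zero_mem' I := by rw [map_zero]; exact J.zero_mem
  add_mem' ha hb I := by rw [map_add]; exact J.add_mem (ha I) (hb I)
  smul_mem' r a ha I := by rw [map_smul]; exact J.mul_mem_left _ _ (ha I)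

theorem term_mem_coefIdeal {J : TwoSidedIdeal R} {r : R} (hr : r ∈ J) (I : Mon V) :
    term C I r ∈ coefIdeal C V J := by
  classical
  intro L
  rw [cf_term]
  split_ifs
  · exact hr
  · exact J.zero_mem

theorem smul_mem_coefIdeal {J : TwoSidedIdeal R} {r : R} (hr : r ∈ J) (a : SemiFree C V) :
    r • a ∈ coefIdeal C V J := fun I => by rw [map_smul]; exact J.mul_mem_right _ _ hr

theorem coefIdeal_mono {J J' : TwoSidedIdeal R} (h : J ≤ J') :
    coefIdeal C V J ≤ coefIdeal C V J' := fun _ ha I => h (ha I)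

theorem eq_sum_term (a : SemiFree C V) :
    a = ∑ I ∈ Finsupp.support (M := R) a, term C I (cf C I a) :=
  (Finsupp.sum_single a).symm

/-- Only additivity of `T` is asked for, since multiplication by an element from the left is not
linear over `R`. -/
theorem map_mem_of_coefIdeal {J : TwoSidedIdeal R} {A : Type*} [AddCommGroup A]
    (M : AddSubgroup A) (T : SemiFree C V →+ A)
    (h : ∀ I r, r ∈ J → T (term C I r) ∈ M) {a : SemiFree C V} (ha : a ∈ coefIdeal C V J) :
    T a ∈ M := by
  rw [eq_sum_term a, map_sum]
  exact sum_mem fun I _ => h I _ (ha I)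

theorem d_mem_coefIdeal {J : TwoSidedIdeal R} {a : SemiFree C V} (ha : a ∈ coefIdeal C V J) :
    d z a ∈ coefIdeal C V J :=
  map_mem_of_coefIdeal (coefIdeal C V J).toAddSubgroup (d z).toAddMonoidHom
    (fun I r hr => by
      change d z (term C I r) ∈ coefIdeal C V J
      rw [d_term]; exact smul_mem_coefIdeal hr _) ha

theorem mul_mem_coefIdeal_right {J : TwoSidedIdeal R} {a : SemiFree C V}
    (ha : a ∈ coefIdeal C V J) (b : SemiFree C V) : a * b ∈ coefIdeal C V J :=
  map_mem_of_coefIdeal (coefIdeal C V J).toAddSubgroup (AddMonoidHom.mulRight b)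
    (fun I r hr => by
      change term C I r * b ∈ coefIdeal C V J
      rw [term_eq_smul, smul_mul_assoc]; exact smul_mem_coefIdeal hr _) ha

/-- Coefficients of `a` are twisted by colours when they move to the left of the monomials of `b`,
so the ideal must be stable under the colours. -/
theorem mul_mem_coefIdeal_left {J : TwoSidedIdeal R} (hJ : ∀ g, ∀ r ∈ J, C.aut g r ∈ J)
    {a : SemiFree C V} (ha : a ∈ coefIdeal C V J) (b : SemiFree C V) : b * a ∈ coefIdeal C V J :=
  map_mem_of_coefIdeal (coefIdeal C V J).toAddSubgroup (AddMonoidHom.mulLeft b)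
    (fun I r hr => by
      change b * term C I r ∈ coefIdeal C V J
      induction b using SemiFree.induction with
      | zero => rw [zero_mul]; exact zero_mem _
      | add b b' h h' => rw [add_mul]; exact add_mem h h'
      | term L s =>
        rw [term_eq_smul I, term_eq_smul L, smul_mul_assoc, term_mul_smul]
        exact Submodule.smul_mem _ _ (smul_mem_coefIdeal (hJ _ _ hr) _)) ha

/-- The splitting is made coefficient by coefficient on the support of `a`, so the supports of both
parts stay inside that of `a`. -/
theorem exists_eq_add_smul {J J' : TwoSidedIdeal R} {f : R}
    (h : ∀ r ∈ J', ∃ s ∈ J, ∃ t, r = s + f * t) {P : Mon V → Prop} {a : SemiFree C V}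
    (ha : a ∈ supp C P) (ha' : a ∈ coefIdeal C V J') :
    ∃ u ∈ supp C P ⊓ coefIdeal C V J, ∃ b ∈ supp C P, a = u + f • b := by
  choose s hs t ht using h
  refine ⟨∑ I ∈ (Finsupp.support (M := R) a).attach, term C I.1 (s (cf C I.1 a) (ha' _)),
    ⟨Submodule.sum_mem _ fun I _ => ?_, Submodule.sum_mem _ fun I _ => ?_⟩,
    ∑ I ∈ (Finsupp.support (M := R) a).attach, term C I.1 (t (cf C I.1 a) (ha' _)),
    Submodule.sum_mem _ fun I _ => ?_, ?_⟩
  · exact term_mem_supp (mem_supp.mp ha _ (Finsupp.mem_support_iff.mp I.2)) _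
  · exact term_mem_coefIdeal (hs _ _) _
  · exact term_mem_supp (mem_supp.mp ha _ (Finsupp.mem_support_iff.mp I.2)) _
  · rw [Finset.smul_sum, ← Finset.sum_add_distrib]
    conv_lhs => rw [eq_sum_term a, ← Finset.sum_attach]
    refine Finset.sum_congr rfl fun I _ => ?_
    rw [smul_term', ← term_add, ← ht]

/-- The divided power `y_v^{(l)}`, which is zero if `y_v` is odd and `l ≥ 2`. -/
def dpow (C : ColorData k G R) (V : Vars G ι) (v : ι) (l : ℕ) : SemiFree C V :=
  ymon C V (Pi.single v l)

theorem dpow_zero (v : ι) : dpow C V v 0 = 1 := by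
  rw [dpow, Pi.single_zero, one_def, ← ymon_exp]; rfl

theorem dpow_one (v : ι) : dpow C V v 1 = var C V v := by
  rw [dpow, var, ← ymon_exp]; rfl

/-- The monomial `y_v^{(l)}`. -/
def powMon (V : Vars G ι) (v : ι) (l : ℕ) (h : Odd (V.hdeg v) → l ≤ 1) : Mon V :=
  ⟨Pi.single v l, fun w hw => by
    by_cases hwv : w = v
    · subst hwv; simpa using h hw
    · simp [Pi.single_eq_of_ne hwv]⟩

theorem dpow_eq {v : ι} {l : ℕ} (h : Odd (V.hdeg v) → l ≤ 1) :
    dpow C V v l = term C (powMon V v l h) 1 := by rw [dpow, ← ymon_exp]; rfl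

theorem d_dpow_succ (H : C.Good) (hz : IsDiff C V z) {v : ι} {l : ℕ}
    (h : Odd (V.hdeg v) → l + 1 ≤ 1) : d z (dpow C V v (l + 1)) = z v * dpow C V v l := by
  rw [dpow_eq h, d_mon, dMon_eq H hz, Finset.sum_eq_single v, if_neg (by simp [powMon])]
  · have e : derivSign C V v (powMon V v (l + 1) h).exp = 1 := by
      unfold derivSign
      rw [braid_eq_one, inv_one]
      intro a b hab
      by_cases hb : b = v
      · left; subst hb; exact Pi.single_eq_of_ne hab.ne' _
      · right; exact Pi.single_eq_of_ne hb _
    rw [e, Units.val_one, one_smul, dpow, ← ymon_exp]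
    congr 2
    funext w
    by_cases hw : w = v
    · subst hw; simp [Mon.pred, Mon.sub, powMon]
    · simp [Mon.pred, Mon.sub, powMon, Pi.single_eq_of_ne hw]
  · intro w _ hw
    rw [if_pos (by simp [powMon, Pi.single_eq_of_ne hw])]
  · simp

theorem dpow_mem_sub {S : Set ι} {v : ι} (hv : v ∈ S) (l : ℕ) : dpow C V v l ∈ sub C V S := by
  unfold dpow ymon
  split_ifs
  · exact term_mem_supp (fun w hw => Pi.single_eq_of_ne (fun h => hw (by rwa [h])) _) 1
  · exact zero_mem _

section Adjoin

variable {S : Set ι} {v : ι}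

/-- All variables of `S` precede `v`, so the power of `y_v` is appended at the end: nothing moves
and all binomials are one. -/
theorem term_mul_dpow (hS : ∀ w ∈ S, w < v) {I J : Mon V} (hI : I.On S)
    (hJ : J.exp = I.exp + Pi.single v (J.exp v)) (r : R) :
    term C I r * dpow C V v (J.exp v) = term C J r := by
  have hv : v ∉ S := fun h => lt_irrefl _ (hS v h)
  rw [dpow_eq (J.exp_le v), term_mul_term, map_one, mul_one, mulTerm_eq, structConst_eq,
    braid_eq_one, Finset.prod_eq_one]
  · rw [Units.val_one, mul_one, one_smul, term_eq_smul, ← ymon_exp J]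
    congr 2
    exact hJ.symm
  · intro w _
    by_cases hw : w = v
    · subst hw; simp [hI w hv, powMon]
    · simp [powMon, Pi.single_eq_of_ne hw]
  · intro a b hab
    by_cases hb : b = v
    · left
      subst hb
      exact hI a fun h => lt_asymm hab (hS a h)
    · right; exact Pi.single_eq_of_ne hb _

/-- The coefficient of `y_v^{(l)}`. -/
def coefAt (C : ColorData k G R) (V : Vars G ι) (v : ι) (l : ℕ) : SemiFree C V →ₗ[R] SemiFree C V :=
  Finsupp.linearCombination R fun I : Mon V => if I.exp v = l then term C (I.erase v) 1 else 0

theorem coefAt_term (l : ℕ) (I : Mon V) (r : R) : coefAt C V v l (term C I r) =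
    if I.exp v = l then term C (I.erase v) r else 0 := by
  refine (Finsupp.linearCombination_single ..).trans ?_
  rw [smul_ite, smul_zero]
  split_ifs
  · rw [smul_term', mul_one]
  · rfl

theorem coefAt_mem_coefIdeal {J : TwoSidedIdeal R} (l : ℕ) {a : SemiFree C V}
    (ha : a ∈ coefIdeal C V J) : coefAt C V v l a ∈ coefIdeal C V J :=
  map_mem_of_coefIdeal (coefIdeal C V J).toAddSubgroup (coefAt C V v l).toAddMonoidHom
    (fun I r hr => by
      change coefAt C V v l (term C I r) ∈ coefIdeal C V J
      rw [coefAt_term]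
      split_ifs
      · exact term_mem_coefIdeal hr _
      · exact zero_mem _) ha

theorem coefAt_mul_dpow (hS : ∀ w ∈ S, w < v) {a : SemiFree C V} (ha : a ∈ sub C V S) {l l' : ℕ}
    (hl : Odd (V.hdeg v) → l ≤ 1) :
    coefAt C V v l' (a * dpow C V v l) = if l = l' then a else 0 := by
  have hv : v ∉ S := fun h => lt_irrefl _ (hS v h)
  induction ha using supp_induction with
  | zero => simp
  | add a a' _ _ h h' => rw [add_mul, map_add, h, h']; split_ifs <;> simp
  | term I r hI =>
    let J : Mon V := ⟨I.exp + Pi.single v l, fun w hw => by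
      by_cases hwv : w = v
      · subst hwv; simpa [hI w hv] using hl hw
      · simpa [Pi.single_eq_of_ne hwv] using I.exp_le w hw⟩
    have hJv : J.exp v = l := by simp [J, hI v hv]
    have h := term_mul_dpow (C := C) hS hI (J := J) (by rw [hJv]) r
    rw [hJv] at h
    rw [h, coefAt_term, hJv]
    have : J.erase v = I := Mon.ext (by
      funext w
      simp only [Mon.erase, Mon.sub, J]
      split_ifs with hw
      · subst hw; exact (hI w hv).symm
      · simp [Pi.single_eq_of_ne hw])
    rw [this]

theorem exists_eq_sum_dpow (hS : ∀ w ∈ S, w < v) {a : SemiFree C V}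
    (ha : a ∈ sub C V (insert v S)) :
    ∃ (N : ℕ) (b : ℕ → SemiFree C V), (∀ l, b l ∈ sub C V S) ∧
      a = ∑ l ∈ Finset.range N, b l * dpow C V v l := by
  -- The vanishing of `b l` for `l ≥ N` is carried along so that two sums of different lengths can
  -- be added.
  suffices ∃ (N : ℕ) (b : ℕ → SemiFree C V), (∀ l, b l ∈ sub C V S) ∧ (∀ l, N ≤ l → b l = 0) ∧
      a = ∑ l ∈ Finset.range N, b l * dpow C V v l by
    obtain ⟨N, b, hb, -, h⟩ := this
    exact ⟨N, b, hb, h⟩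
  induction ha using supp_induction with
  | zero => exact ⟨0, 0, fun _ => zero_mem _, fun _ _ => rfl, by simp⟩
  | add a a' _ _ h h' =>
    obtain ⟨N, b, hb, hN, h⟩ := h
    obtain ⟨N', b', hb', hN', h'⟩ := h'
    refine ⟨max N N', b + b', fun l => add_mem (hb l) (hb' l), fun l hl => ?_, ?_⟩
    · rw [Pi.add_apply, hN l (le_of_max_le_left hl), hN' l (le_of_max_le_right hl), add_zero]
    · simp only [Pi.add_apply, add_mul, Finset.sum_add_distrib]
      rw [h, h']
      congr 1
      · refine Finset.sum_subset (Finset.range_mono (le_max_left _ _)) fun l _ hl => ?_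
        rw [hN l (by simpa using hl), zero_mul]
      · refine Finset.sum_subset (Finset.range_mono (le_max_right _ _)) fun l _ hl => ?_
        rw [hN' l (by simpa using hl), zero_mul]
  | term I r hI =>
    refine ⟨I.exp v + 1, Pi.single (I.exp v) (term C (I.erase v) r), fun l => ?_, fun l hl => ?_, ?_⟩
    · by_cases h : l = I.exp v
      · rw [h, Pi.single_eq_same]; exact term_mem_supp hI.erase r
      · rw [Pi.single_eq_of_ne h]; exact zero_mem _
    · exact Pi.single_eq_of_ne (by omega) _
    · rw [Finset.sum_eq_single (I.exp v)]
      · rw [Pi.single_eq_same, term_mul_dpow hS hI.erase]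
        funext w
        by_cases hw : w = v
        · subst hw; simp [Mon.erase, Mon.sub]
        · simp [Mon.erase, Mon.sub, hw]
      · intro l _ hl; rw [Pi.single_eq_of_ne hl, zero_mul]
      · simp

theorem exists_eq_add_mul_var (hS : ∀ w ∈ S, w < v) (hv : Odd (V.hdeg v)) {a : SemiFree C V}
    (ha : a ∈ sub C V (insert v S)) :
    ∃ b ∈ sub C V S, ∃ b' ∈ sub C V S, a = b + b' * var C V v := by
  obtain ⟨N, b, hb, rfl⟩ := exists_eq_sum_dpow hS ha
  have h0 : ∀ l, dpow C V v (l + 2) = 0 := fun l => ymon_eq_zero hv (by simp)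
  rcases N with - | - | N
  · exact ⟨0, zero_mem _, 0, zero_mem _, by simp⟩
  · exact ⟨b 0, hb 0, 0, zero_mem _, by simp [dpow_zero]⟩
  · refine ⟨b 0, hb 0, b 1, hb 1, ?_⟩
    rw [Finset.sum_range_succ', Finset.sum_range_succ', Finset.sum_eq_zero]
    · rw [zero_add, dpow_zero, mul_one, ← dpow_one, add_comm]
    · intro l _; rw [h0, mul_zero]

end Adjoin

end

/-! ### Change of the coefficient ring -/

section Map

set_option linter.unusedSectionVars false

variable {k : Type u} [Field k] {G : Type v} [CommGroup G] {R R' : Type w} [Ring R] [Algebra k R]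
  [Ring R'] [Algebra k R']
variable {ι : Type t} [Fintype ι] [LinearOrder ι]
variable {C : ColorData k G R} {C' : ColorData k G R'} {V : Vars G ι} {z : ι → SemiFree C V}

theorem mulTerm_map (φ : R →ₐ[k] R') (hχ : C.χ = C'.χ) (I J : Mon V) (r : R)
    (T : SemiFree C V →+ SemiFree C' V) (hT : ∀ I r, T (term C I r) = term C' I (φ r)) :
    T (mulTerm C I J r) = mulTerm C' I J (φ r) := by
  unfold mulTerm
  split_ifs with h
  · rw [hT, map_smul]
    congr 2
    unfold structConst
    rw [hχ]
  · exact map_zero _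

/-- Change of rings. -/
def map (φ : R →ₐ[k] R') (hχ : C.χ = C'.χ) (hφ : ∀ g r, φ (C.aut g r) = C'.aut g (φ r))
    (V : Vars G ι) : SemiFree C V →+* SemiFree C' V :=
  let T : SemiFree C V →+ SemiFree C' V := Finsupp.mapRange.addMonoidHom (ι := Mon V) φ
  have hT : ∀ I r, T (term C I r) = term C' I (φ r) := fun I r =>
    Finsupp.mapRange_single (f := φ) (hf := map_zero φ)
  { T with
    map_one' := by
      change T 1 = 1
      rw [one_def, hT, map_one]; rfl
    map_mul' := fun a b => by
      change T (a * b) = T a * T b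
      induction a using SemiFree.induction with
      | zero => simp
      | add a a' h h' => rw [add_mul, map_add, h, h', map_add, add_mul]
      | term I r =>
      induction b using SemiFree.induction with
      | zero => simp
      | add a a' h h' => rw [mul_add, map_add, h, h', map_add, mul_add]
      | term J s =>
        rw [hT, hT, term_mul_term, term_mul_term, mulTerm_map φ hχ I J _ T hT, map_mul, hφ] }

variable (φ : R →ₐ[k] R') (hχ : C.χ = C'.χ) (hφ : ∀ g r, φ (C.aut g r) = C'.aut g (φ r))

theorem map_term (I : Mon V) (r : R) : map φ hχ hφ V (term C I r) = term C' I (φ r) :=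
  Finsupp.mapRange_single (f := φ) (hf := map_zero φ)

theorem map_smul' (r : R) (a : SemiFree C V) : map φ hχ hφ V (r • a) = φ r • map φ hχ hφ V a := by
  induction a using SemiFree.induction with
  | zero => simp
  | add a a' h h' => rw [smul_add, map_add, h, h', map_add, smul_add]
  | term I s => rw [smul_term', map_term, map_term, smul_term', map_mul]

theorem map_smul_field (c : k) (a : SemiFree C V) :
    map φ hχ hφ V (c • a) = c • map φ hχ hφ V a := by
  rw [← smul_one_smul R c a, map_smul', map_smul, map_one, smul_one_smul]

theorem map_d (a : SemiFree C V) :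
    map φ hχ hφ V (d z a) = d (fun v => map φ hχ hφ V (z v)) (map φ hχ hφ V a) := by
  induction a using SemiFree.induction with
  | zero => simp
  | add a a' h h' => simp only [map_add, h, h']
  | term I r =>
    rw [d_term, map_smul', map_term, d_term]
    congr 1
    unfold dMon
    rw [map_sum]
    refine Finset.sum_congr rfl fun v _ => ?_
    split_ifs
    · exact map_zero _
    · simp only [map_mul, map_pow, map_neg, map_one, map_term]

theorem cf_map (I : Mon V) (a : SemiFree C V) : cf C' I (map φ hχ hφ V a) = φ (cf C I a) :=
  Finsupp.mapRange_apply (f := φ) (hf := map_zero φ) ..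

theorem map_eq_zero_iff {J : TwoSidedIdeal R} (hJ : ∀ r, φ r = 0 ↔ r ∈ J) {a : SemiFree C V} :
    map φ hχ hφ V a = 0 ↔ a ∈ coefIdeal C V J := by
  constructor
  · intro h I
    rw [← hJ, ← cf_map φ hχ hφ, h, map_zero]
  · intro h
    refine ext_cf fun I => ?_
    rw [cf_map, map_zero, hJ]
    exact h I

theorem map_mem_supp {P : Mon V → Prop} {a : SemiFree C V} (ha : a ∈ supp C P) :
    map φ hχ hφ V a ∈ supp C' P := by
  rw [mem_supp] at ha ⊢
  intro I hI
  rw [cf_map] at hI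
  exact ha I fun h => hI (by rw [h, map_zero])

theorem exists_map_eq (hs : Function.Surjective φ) {P : Mon V → Prop} {a : SemiFree C' V}
    (ha : a ∈ supp C' P) : ∃ b ∈ supp C P, map φ hχ hφ V b = a := by
  induction ha using supp_induction with
  | zero => exact ⟨0, zero_mem _, map_zero _⟩
  | add a a' _ _ h h' =>
    obtain ⟨b, hb, rfl⟩ := h
    obtain ⟨b', hb', rfl⟩ := h'
    exact ⟨b + b', add_mem hb hb', map_add _ _ _⟩
  | term I r hI =>
    obtain ⟨s, rfl⟩ := hs r
    exact ⟨term C I s, term_mem_supp hI s, map_term ..⟩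

theorem map_var (v : ι) : map φ hχ hφ V (var C V v) = var C' V v := by
  rw [var, map_term, map_one]; rfl

end Map

end SemiFree

/-! ### Killing a regular element -/

/-- Data for comparing the homology of `A` modulo `N` with that of `A` modulo `N' = N + f A`, where
`f` is regular modulo `N` and is the boundary of `z`. -/
structure KillData {R T : Type*} [Ring R] [Ring T] [Module R T] (D : T →+ T)
    (A N N' : AddSubgroup T) (f : R) (z : T) : Prop where
  d_mem : ∀ a ∈ A, D a ∈ A
  d_mem_N : ∀ a ∈ N, D a ∈ N
  smul_mem : ∀ a ∈ A, f • a ∈ A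
  smul_mem_N : ∀ a ∈ N, f • a ∈ N
  mul_mem : ∀ a ∈ A, z * a ∈ A
  mul_mem_N : ∀ a ∈ N, z * a ∈ N
  d_d : ∀ a ∈ A, D (D a) ∈ N
  split : ∀ a ∈ A, a ∈ N' → ∃ u ∈ A, u ∈ N ∧ ∃ b ∈ A, a = u + f • b
  le : N ≤ N'
  smul_mem_N' : ∀ a, f • a ∈ N'
  regular : ∀ b ∈ A, f • b ∈ N → b ∈ N
  d_smul : ∀ b, D (f • b) = f • D b
  d_mul : ∀ b, D (z * b) = f • b - z * D b

namespace KillData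

variable {R T : Type*} [Ring R] [Ring T] [Module R T] {D : T →+ T} {A N N' E : AddSubgroup T}
  {f : R} {z : T}

/-- Multiplication by `f` is zero on homology modulo `N`, since `f b` and `z D b` add up to `D (z
b)`. If `E` represents the homology modulo `N`, the long exact sequence shows that `E` and `z E`
represent the homology modulo `N'`. This is the generating half, at the level of chains. -/
theorem generates (h : KillData D A N N' f z) (hE : E ≤ A) (hDE : ∀ e ∈ E, D e ∈ N)
    (gen : ∀ a ∈ A, D a ∈ N → ∃ b ∈ A, ∃ e ∈ E, ∃ u ∈ N, a = D b + e + u) {a : T} (ha : a ∈ A)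
    (hDa : D a ∈ N') : ∃ b ∈ A, ∃ e ∈ E, ∃ e' ∈ E, ∃ u ∈ N', a = D b + e + z * e' + u := by
  obtain ⟨u, huA, huN, b, hb, hab⟩ := h.split _ (h.d_mem a ha) hDa
  -- The connecting map: `f D b` is the boundary of a boundary up to `N`, and `f` is regular, so `b`
  -- is a cycle modulo `N`.
  have h1 : D b ∈ N := by
    refine h.regular _ (h.d_mem b hb) ?_
    have : f • D b = D (D a) - D u := by rw [hab, map_add, h.d_smul]; abel
    rw [this]
    exact sub_mem (h.d_d a ha) (h.d_mem_N u huN)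
  obtain ⟨b', hb', e', he', u', hu', hbe⟩ := gen b hb h1
  -- The boundary of `z e'` is `f e'` modulo `N`, so subtracting it removes the image of `a` under
  -- the connecting map.
  have h2 : D (a - f • b' - z * e') ∈ N := by
    have : D (a - f • b' - z * e') = u + f • u' + z * D e' := by
      rw [map_sub, map_sub, hab, h.d_smul, h.d_mul, hbe, smul_add, smul_add]; abel
    rw [this]
    exact add_mem (add_mem huN (h.smul_mem_N _ hu')) (h.mul_mem_N _ (hDE e' he'))
  obtain ⟨b₂, hb₂, e, he, u₂, hu₂, h3⟩ := gen _
    (sub_mem (sub_mem ha (h.smul_mem _ hb')) (h.mul_mem _ (hE he'))) h2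
  refine ⟨b₂, hb₂, e, he, e', he', u₂ + f • b', add_mem (h.le hu₂) (h.smul_mem_N' _), ?_⟩
  rw [sub_sub, sub_eq_iff_eq_add] at h3
  rw [h3]; abel

/-- The connecting map separates the summand `z E` from `E`, and `E` stays independent because `f`
acts as zero on the homology modulo `N`. -/
theorem independent (h : KillData D A N N' f z) (hE : E ≤ A) (hDE : ∀ e ∈ E, D e ∈ N)
    (gen : ∀ a ∈ A, D a ∈ N → ∃ b ∈ A, ∃ e ∈ E, ∃ u ∈ N, a = D b + e + u)
    (ind : ∀ e ∈ E, ∀ b ∈ A, e - D b ∈ N → e = 0) {e e' b : T} (he : e ∈ E) (he' : e' ∈ E)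
    (hb : b ∈ A) (hN : e + z * e' - D b ∈ N') : e = 0 ∧ e' = 0 := by
  obtain ⟨u, huA, huN, v, hv, huv⟩ := h.split _
    (sub_mem (add_mem (hE he) (h.mul_mem _ (hE he'))) (h.d_mem b hb)) hN
  -- Applying `D` to the relation and dividing by `f` exhibits `e'` as a boundary modulo `N`.
  have h1 : e' = 0 := by
    refine ind e' he' v hv (h.regular _ (sub_mem (hE he') (h.d_mem v hv)) ?_)
    have := congrArg D huv
    rw [map_sub, map_add, h.d_mul, map_add, h.d_smul] at this
    have h2 : f • (e' - D v) = D u - D e + z * D e' + D (D b) := by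
      rw [smul_sub, sub_eq_iff_eq_add, eq_comm, ← sub_eq_zero]
      rw [← sub_eq_zero] at this
      rw [← neg_eq_zero, ← this]; abel
    rw [h2]
    exact add_mem (add_mem (sub_mem (h.d_mem_N u huN) (hDE e he)) (h.mul_mem_N _ (hDE e' he')))
      (h.d_d b hb)
  refine ⟨?_, h1⟩
  subst h1
  rw [mul_zero, add_zero] at huv
  have h2 : D v ∈ N := by
    refine h.regular _ (h.d_mem v hv) ?_
    have := congrArg D huv
    rw [map_sub, map_add, h.d_smul] at this
    have h3 : f • D v = D e - D (D b) - D u := by rw [this]; abel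
    rw [h3]
    exact sub_mem (sub_mem (hDE e he) (h.d_d b hb)) (h.d_mem_N u huN)
  obtain ⟨v', hv', e₂, he₂, u₂, hu₂, hve⟩ := gen v hv h2
  -- The term `f v` is itself a boundary modulo `N`: write `v = D v' + e₂ + u₂` and use that `f e₂`
  -- is the boundary of `z e₂` modulo `N`.
  refine ind e he (b + f • v' + z * e₂)
    (add_mem (add_mem hb (h.smul_mem _ hv')) (h.mul_mem _ (hE he₂))) ?_
  have h3 : e - D (b + f • v' + z * e₂) = u + f • u₂ + z * D e₂ := by
    rw [map_add, map_add, h.d_smul, h.d_mul]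
    have : e = D b + (u + f • v) := by rw [← huv]; abel
    rw [this, hve, smul_add, smul_add]; abel
  rw [h3]
  exact add_mem (add_mem huN (h.smul_mem_N _ hu₂)) (h.mul_mem_N _ (hDE e₂ he₂))

end KillData

/-! ### The ideals of a regular sequence of normal elements -/

section Ideals

variable {k : Type u} [Field k] {n c : ℕ} {q : Fin n → Fin n → kˣ}

/-- The ideal generated by the elements `f_j` with `j < i`. -/
def seqIdeal (f : Fin c → SkewPoly q) (i : ℕ) : TwoSidedIdeal (SkewPoly q) :=
  TwoSidedIdeal.span (f '' {j | j.val < i})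

theorem seqIdeal_zero (f : Fin c → SkewPoly q) : seqIdeal f 0 = ⊥ := by
  rw [seqIdeal, eq_bot_iff, TwoSidedIdeal.span_le]
  rintro _ ⟨j, hj, rfl⟩
  exact absurd hj (Nat.not_lt_zero _)

theorem seqIdeal_last (f : Fin c → SkewPoly q) :
    seqIdeal f c = TwoSidedIdeal.span (Set.range f) := by
  rw [seqIdeal, show {j : Fin c | j.val < c} = Set.univ from Set.eq_univ_of_forall fun j => j.2,
    Set.image_univ]

theorem mem_seqIdeal (f : Fin c → SkewPoly q) {j : Fin c} {i : ℕ} (h : j.val < i) :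
    f j ∈ seqIdeal f i := TwoSidedIdeal.subset_span ⟨j, h, rfl⟩

theorem seqIdeal_mono (f : Fin c → SkewPoly q) {i i' : ℕ} (h : i ≤ i') :
    seqIdeal f i ≤ seqIdeal f i' :=
  TwoSidedIdeal.span_mono (Set.image_mono fun _ hj => lt_of_lt_of_le hj h)

variable (hq : IsSkewMatrix q) {f : Fin c → SkewPoly q} {δ : Fin c → ℕ} {γ : Fin c → ColorGroup q}
  (hf : ∀ j, f j ∈ SkewPoly.comp q (δ j) (γ j))

set_option linter.unusedSectionVars false

include hq hf

theorem aut_mem_seqIdeal (i : ℕ) (g : ColorGroup q) {r : SkewPoly q} (hr : r ∈ seqIdeal f i) :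
    (polyData q).aut g r ∈ seqIdeal f i := by
  have : seqIdeal f i ≤ (seqIdeal f i).comap ((polyData q).aut g : SkewPoly q →+* SkewPoly q) := by
    conv_lhs => rw [seqIdeal]
    rw [TwoSidedIdeal.span_le]
    rintro _ ⟨j, hj, rfl⟩
    rw [SetLike.mem_coe, TwoSidedIdeal.mem_comap]
    change (polyData q).aut g (f j) ∈ _
    rw [(SkewPoly.good_polyData hq).aut_apply g (hf j), Algebra.smul_def]
    exact TwoSidedIdeal.mul_mem_left _ _ _ (mem_seqIdeal f hj)
  exact (TwoSidedIdeal.mem_comap _).mp (this hr)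

theorem gen_mul (j : Fin c) (r : SkewPoly q) : f j * r = (polyData q).aut (γ j) r * f j :=
  (SkewPoly.good_polyData hq).comm_aut (hf j) r

theorem mul_gen (j : Fin c) (r : SkewPoly q) : r * f j = f j * (polyData q).aut (γ j)⁻¹ r := by
  rw [gen_mul hq hf, ← AlgEquiv.mul_apply, ← map_mul, mul_inv_cancel, map_one]; rfl

/-- An element moves from the left of `f_i` to its right at the cost of an automorphism. So the sums
`s + f_i t` already form a two-sided ideal. -/
theorem mem_seqIdeal_succ (i : Fin c) {r : SkewPoly q} (hr : r ∈ seqIdeal f (i.val + 1)) :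
    ∃ s ∈ seqIdeal f i.val, ∃ t, r = s + f i * t := by
  let J : TwoSidedIdeal (SkewPoly q) := TwoSidedIdeal.mk'
    {r | ∃ s ∈ seqIdeal f i.val, ∃ t, r = s + f i * t}
    ⟨0, TwoSidedIdeal.zero_mem _, 0, by simp⟩
    (by
      rintro _ _ ⟨s, hs, t, rfl⟩ ⟨s', hs', t', rfl⟩
      exact ⟨s + s', TwoSidedIdeal.add_mem _ hs hs', t + t', by rw [mul_add]; abel⟩)
    (by
      rintro _ ⟨s, hs, t, rfl⟩
      exact ⟨-s, TwoSidedIdeal.neg_mem _ hs, -t, by rw [mul_neg]; abel⟩)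
    (by
      rintro y _ ⟨s, hs, t, rfl⟩
      exact ⟨y * s, TwoSidedIdeal.mul_mem_left _ _ _ hs, (polyData q).aut (γ i)⁻¹ y * t, by
        rw [mul_add, ← mul_assoc y, mul_gen hq hf, mul_assoc]⟩)
    (by
      rintro _ y ⟨s, hs, t, rfl⟩
      exact ⟨s * y, TwoSidedIdeal.mul_mem_right _ _ _ hs, t * y, by rw [add_mul, mul_assoc]⟩)
  have hJ : ∀ r, r ∈ J ↔ ∃ s ∈ seqIdeal f i.val, ∃ t, r = s + f i * t := fun r => by
    rw [TwoSidedIdeal.mem_mk']; rfl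
  have hle : seqIdeal f (i.val + 1) ≤ J := by
    rw [seqIdeal, TwoSidedIdeal.span_le]
    rintro _ ⟨j, hj, rfl⟩
    rw [SetLike.mem_coe, hJ]
    rcases Nat.lt_succ_iff_lt_or_eq.mp hj with h | h
    · exact ⟨f j, mem_seqIdeal f h, 0, by simp⟩
    · obtain rfl := Fin.ext h
      exact ⟨0, TwoSidedIdeal.zero_mem _, 1, by simp⟩
  exact (hJ r).mp (hle hr)

/-- Regularity is given for multiplication by `f_i` from the right. Normality turns `f_i r` into a
twist of `r` times `f_i`, and the twist is undone because the ideal is stable under the colours. -/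
theorem mem_seqIdeal_of_gen_mul_mem (hreg : IsRegularSeq f) (i : Fin c) {r : SkewPoly q}
    (hr : f i * r ∈ seqIdeal f i.val) : r ∈ seqIdeal f i.val := by
  rw [gen_mul hq hf] at hr
  have h := hreg i _ hr
  have h' := aut_mem_seqIdeal hq hf i.val (γ i)⁻¹ h
  rwa [← AlgEquiv.mul_apply, ← map_mul, inv_mul_cancel, map_one] at h'

omit hq hf in
/-- The augmentation `x_i ↦ 0`. -/
def aug (q : Fin n → Fin n → kˣ) : SkewPoly q →ₐ[k] k :=
  SkewPoly.lift (fun _ => 0) fun _ _ => by simp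

omit hq hf in
theorem aug_x (i : Fin n) : aug q (SkewPoly.x q i) = 0 := SkewPoly.lift_x _ _ i

omit hq hf in
theorem aug_of_mem_homog {d : ℕ} (hd : 0 < d) {a : SkewPoly q} (ha : a ∈ SkewPoly.homog q d) :
    aug q a = 0 := by
  induction ha using Submodule.span_induction with
  | mem a ha =>
    obtain ⟨l, hl, rfl⟩ := ha
    cases l with
    | nil => simp at hl; omega
    | cons i l => rw [List.map_cons, List.prod_cons, map_mul, aug_x, zero_mul]
  | zero => simp
  | add a b _ _ ha hb => rw [map_add, ha, hb, add_zero]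
  | smul r a _ ha => rw [map_smul, ha, smul_zero]

omit hq hf in
theorem aug_of_mem_seqIdeal (hf : ∀ j, aug q (f j) = 0) {i : ℕ} {r : SkewPoly q}
    (hr : r ∈ seqIdeal f i) : aug q r = 0 := by
  have : seqIdeal f i ≤ TwoSidedIdeal.ker (aug q : SkewPoly q →+* k) := by
    rw [seqIdeal, TwoSidedIdeal.span_le]
    rintro _ ⟨j, -, rfl⟩
    exact (TwoSidedIdeal.mem_ker _).mpr (hf j)
  exact (TwoSidedIdeal.mem_ker _).mp (this hr)

omit hq hf in
theorem exists_eq_aug_add (a : SkewPoly q) :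
    ∃ r ∈ Submodule.span (SkewPoly q) (Set.range (SkewPoly.x q)), a = algebraMap k _ (aug q a) + r := by
  induction a using SkewPoly.induction with
  | zero => exact ⟨0, zero_mem _, by simp⟩
  | add a b ha hb =>
    obtain ⟨r, hr, ha⟩ := ha
    obtain ⟨s, hs, hb⟩ := hb
    refine ⟨r + s, add_mem hr hs, ?_⟩
    rw [map_add, map_add]
    nth_rewrite 1 [ha, hb]
    abel
  | word c l =>
    rcases List.eq_nil_or_concat l with rfl | ⟨l, i, rfl⟩
    · exact ⟨0, zero_mem _, by
        rw [SkewPoly.word_nil, map_smul, map_one, Algebra.algebraMap_eq_smul_one]; simp⟩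
    · rw [List.concat_eq_append, SkewPoly.word_append, SkewPoly.word_singleton, ← smul_mul_assoc]
      refine ⟨c • SkewPoly.word q l * SkewPoly.x q i,
        Submodule.smul_mem _ _ (Submodule.subset_span ⟨i, rfl⟩), ?_⟩
      rw [map_mul, aug_x, mul_zero, map_zero, zero_add]

end Ideals

/-! ### Elements with coefficients in an ideal, and constant terms -/

namespace SemiFree

section

set_option linter.unusedSectionVars false

variable {k : Type u} [Field k] {G : Type v} [CommGroup G] {R : Type w} [Ring R] [Algebra k R]
variable {ι : Type t} [Fintype ι] [LinearOrder ι]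
variable {C : ColorData k G R} {V : Vars G ι} {z : ι → SemiFree C V}

/-- By `d_d_term` the square of `d` is a combination of the `d z (z v)`. So it is zero modulo any
ideal that contains their coefficients, although it need not be zero over the ring itself. -/
theorem d_d_mem_coefIdeal (H : C.Good) (hz : IsDiff C V z) {S : Set ι} {J : TwoSidedIdeal R}
    (hS : ∀ v ∈ S, d z (z v) ∈ coefIdeal C V J) {a : SemiFree C V} (ha : a ∈ sub C V S) :
    d z (d z a) ∈ coefIdeal C V J := by
  induction ha using supp_induction with
  | zero => simp
  | add a a' _ _ h h' => rw [map_add, map_add]; exact add_mem h h'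
  | term I r hI =>
    rw [d_d_term H hz]
    refine Submodule.smul_mem _ _ (Submodule.sum_mem _ fun v _ => ?_)
    by_cases hv : v ∈ S
    · exact mul_mem_coefIdeal_right (hS v hv) _
    · rw [leftDeriv, if_pos (hI v hv), mul_zero]; exact zero_mem _

theorem mem_coefIdeal_bot {a : SemiFree C V} : a ∈ coefIdeal C V ⊥ ↔ a = 0 := by
  constructor
  · intro h
    exact ext_cf fun I => by rw [map_zero]; exact (TwoSidedIdeal.mem_bot R).mp (h I)
  · rintro rfl; exact zero_mem _

theorem cf_one_one : cf C (Mon.one V) (1 : SemiFree C V) = 1 := by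
  classical rw [one_def, cf_term, if_pos rfl]

theorem cf_one_of_hdeg_ne {P : Mon V → Prop} (hP : ∀ I, P I → I.hdeg ≠ 0) {a : SemiFree C V}
    (ha : a ∈ supp C P) : cf C (Mon.one V) a = 0 := by
  by_contra h
  exact hP _ (mem_supp.mp ha _ h) (by simp [Mon.hdeg, Mon.one])

theorem exists_eq_smul_one_of_mem_sub_empty {S : Set ι} (hS : S = ∅) {a : SemiFree C V}
    (ha : a ∈ sub C V S) : ∃ r : R, a = r • 1 := by
  induction ha using supp_induction with
  | zero => exact ⟨0, by simp⟩
  | add a a' _ _ h h' =>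
    obtain ⟨r, rfl⟩ := h
    obtain ⟨s, rfl⟩ := h'
    exact ⟨r + s, (add_smul _ _ _).symm⟩
  | term I r hI =>
    refine ⟨r, ?_⟩
    have : I = Mon.one V := Mon.ext (funext fun v => hI v (by simp [hS]))
    rw [this, term_eq_smul, one_def]

theorem smul_one_mem_sub (S : Set ι) (r : R) : r • (1 : SemiFree C V) ∈ sub C V S :=
  Submodule.smul_mem _ _ (one_mem_sub S)

theorem var_mem_sub {S : Set ι} {v : ι} (hv : v ∈ S) : var C V v ∈ sub C V S := by
  rw [← dpow_one]; exact dpow_mem_sub hv 1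

theorem d_var (H : C.Good) (hz : IsDiff C V z) (v : ι) : d z (var C V v) = z v := by
  rw [← dpow_one, d_dpow_succ H hz (fun _ => le_rfl), dpow_zero, mul_one]

theorem incl_eq (r : R) : incl C V r = r • (1 : SemiFree C V) := by
  rw [one_def, smul_term', mul_one]; rfl

end

end SemiFree

/-! ### Exactness of the Koszul complex of a skew polynomial ring -/

namespace SemiFree

section Exact

set_option linter.unusedSectionVars false

variable {k : Type u} [Field k] {n : ℕ} {q : Fin n → Fin n → kˣ} (hq : IsSkewMatrix q)
variable {ι : Type t} [Fintype ι] [LinearOrder ι] {V : Vars (ColorGroup q) ι}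
  {z : ι → SemiFree (polyData q) V} (hz : IsDiff (polyData q) V z)
  {e : Fin n → ι} (he : StrictMono e) (hdeg : ∀ i, V.hdeg (e i) = 1)
  (hze : ∀ i, z (e i) = SkewPoly.x q i • 1)

include hq hz he hdeg hze

theorem cf_one_d_mem (i : ℕ) {a : SemiFree (polyData q) V}
    (ha : a ∈ sub (polyData q) V (e '' {j | j.val < i})) :
    cf (polyData q) (Mon.one V) (d z a) ∈
      Submodule.span (SkewPoly q) (SkewPoly.x q '' {j | j.val < i}) := by
  classical
  induction ha using supp_induction with
  | zero => simp
  | add a a' _ _ h h' => rw [map_add, map_add]; exact add_mem h h'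
  | term I r hI =>
    rw [d_term, map_smul]
    refine Submodule.smul_mem _ _ ?_
    refine dMon_mem (SkewPoly.good_polyData hq) hz hI (M := Submodule.comap
      (cf (polyData q) (Mon.one V)) (Submodule.span _ (SkewPoly.x q '' {j | j.val < i}))) ?_
    rintro _ ⟨j, hj, rfl⟩ -
    rw [Submodule.mem_comap, hze, smul_mul_assoc, one_mul, map_smul, cf_term]
    split_ifs
    · rw [smul_eq_mul, mul_one]; exact Submodule.subset_span ⟨j, hj, rfl⟩
    · simp

theorem z_mem_sub_image (i : ℕ) : ∀ v ∈ e '' {j : Fin n | j.val < i},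
    z v ∈ sub (polyData q) V (e '' {j | j.val < i}) := by
  rintro _ ⟨j, -, rfl⟩
  rw [hze]
  exact smul_one_mem_sub _ _

theorem exists_d_eq_smul_one {i : ℕ} {r : SkewPoly q}
    (hr : r ∈ Submodule.span (SkewPoly q) (SkewPoly.x q '' {j | j.val < i})) :
    ∃ a ∈ sub (polyData q) V (e '' {j | j.val < i}), d z a = r • 1 := by
  induction hr using Submodule.closure_induction with
  | zero => exact ⟨0, zero_mem _, by simp⟩
  | add r s _ _ hr hs =>
    obtain ⟨a, ha, hr⟩ := hr
    obtain ⟨b, hb, hs⟩ := hs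
    exact ⟨a + b, add_mem ha hb, by rw [map_add, hr, hs, add_smul]⟩
  | smul_mem r _ h =>
    obtain ⟨j, hj, rfl⟩ := h
    refine ⟨r • var (polyData q) V (e j), Submodule.smul_mem _ _ (var_mem_sub ⟨j, hj, rfl⟩), ?_⟩
    rw [map_smul, d_var (SkewPoly.good_polyData hq) hz, hze, smul_smul, smul_eq_mul]

/-- Variables are adjoined one at a time, as for a commutative regular sequence: `x_v` is regular
modulo the left ideal of the earlier variables. Constants `r • 1` are left over and treated in
`koszul_exact`. -/
theorem exists_eq_d_add_smul_one (i : ℕ) (hi : i ≤ n) {a : SemiFree (polyData q) V}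
    (ha : a ∈ sub (polyData q) V (e '' {j | j.val < i})) (hda : d z a = 0) :
    ∃ b ∈ sub (polyData q) V (e '' {j | j.val < i}), ∃ r : SkewPoly q, a = d z b + r • 1 := by
  have H := SkewPoly.good_polyData hq
  induction i generalizing a with
  | zero =>
    obtain ⟨r, hr⟩ := exists_eq_smul_one_of_mem_sub_empty (S := e '' {j | j.val < 0}) (by simp) ha
    exact ⟨0, zero_mem _, r, by rw [map_zero, zero_add, hr]⟩
  | succ i ih =>
    set S : Set ι := e '' {j : Fin n | j.val < i} with hS
    let v : Fin n := ⟨i, hi⟩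
    have hins : e '' {j : Fin n | j.val < i + 1} = insert (e v) S := by
      rw [hS, ← Set.image_insert_eq]
      congr 1
      ext j
      simp only [Set.mem_ofPred_eq, Set.mem_insert_iff, v, Fin.ext_iff]
      omega
    have hlt : ∀ w ∈ S, w < e v := by
      rintro _ ⟨j, hj, rfl⟩
      exact he hj
    have hodd : Odd (V.hdeg (e v)) := by rw [hdeg]; exact odd_one
    have hSz := z_mem_sub_image hq hz he hdeg hze i
    have hSle : sub (polyData q) V S ≤ sub (polyData q) V (insert (e v) S) :=
      sub_mono (Set.subset_insert _ _)
    have hdY : d z (var (polyData q) V (e v)) = SkewPoly.x q v • 1 := by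
      rw [d_var H hz, hze]
    have hmulz : ∀ b ∈ sub (polyData q) V S,
        inv (polyData q) V b * (SkewPoly.x q v • 1) ∈ sub (polyData q) V S := fun b hb =>
      mul_mem_sub (inv_mem_supp hb) (smul_one_mem_sub _ _)
    -- On the Koszul variables the square of `d` is zero even over the skew polynomial ring. Other
    -- variables in `ι` may lack this property, hence the restriction to a set of variables.
    have hdd : ∀ b ∈ sub (polyData q) V (insert (e v) S), d z (d z b) = 0 := fun b hb =>
      mem_coefIdeal_bot.mp (d_d_mem_coefIdeal H hz (fun w hw => by
        rw [← hins] at hw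
        obtain ⟨j, -, rfl⟩ := hw
        rw [hze, d_smul_one]; exact zero_mem _) hb)
    have hYmem : ∀ b ∈ sub (polyData q) V S,
        b * var (polyData q) V (e v) ∈ sub (polyData q) V (insert (e v) S) := fun b hb =>
      mul_mem_sub (hSle hb) (var_mem_sub (Set.mem_insert _ _))
    rw [hins] at ha ⊢
    obtain ⟨b, hb, b', hb', rfl⟩ := exists_eq_add_mul_var hlt hodd ha
    have split : ∀ c ∈ sub (polyData q) V S, ∀ c' ∈ sub (polyData q) V S,
        c + c' * var (polyData q) V (e v) = 0 → c = 0 ∧ c' = 0 := by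
      intro c hc c' hc' h0
      have hc0 : ∀ l', coefAt (polyData q) V (e v) l' c = if 0 = l' then c else 0 := fun l' => by
        have := coefAt_mul_dpow hlt hc (l := 0) (l' := l') (fun _ => zero_le_one)
        rwa [dpow_zero, mul_one] at this
      have hc1 := fun l' => coefAt_mul_dpow hlt hc' (l := 1) (l' := l') (fun _ => le_rfl)
      simp only [dpow_one] at hc1
      have h1 := congrArg (coefAt (polyData q) V (e v) 0) h0
      have h2 := congrArg (coefAt (polyData q) V (e v) 1) h0
      rw [map_add, hc0, hc1, map_zero] at h1 h2
      simpa using And.intro h1 h2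
    have hd1 : d z b + inv (polyData q) V b' * (SkewPoly.x q v • 1) = 0 ∧ d z b' = 0 := by
      refine split _ (add_mem (d_mem_sub H hz hSz hb) (hmulz b' hb')) _
        (d_mem_sub H hz hSz hb') ?_
      rw [← hda, map_add, d_mul H hz, hdY]; abel
    -- The coefficient of `y_v` is a cycle in fewer variables. Subtracting the boundary of `c y_v`
    -- reduces it to the constant `r`.
    obtain ⟨c, hc, r, hbr⟩ := ih (by omega) hb' hd1.2
    have hb1 : b - inv (polyData q) V c * (SkewPoly.x q v • 1) ∈ sub (polyData q) V S :=
      sub_mem hb (hmulz c hc)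
    have ha2 : b + b' * var (polyData q) V (e v) = d z (c * var (polyData q) V (e v)) +
        (b - inv (polyData q) V c * (SkewPoly.x q v • 1)) + r • var (polyData q) V (e v) := by
      rw [hbr, d_mul H hz, hdY, add_mul, smul_mul_assoc, one_mul]; abel
    -- Taking boundaries, `r x_v` is minus the constant term of a boundary in the earlier variables.
    -- So it lies in their left ideal, and `x_v` can be cancelled.
    have hr : r ∈ Submodule.span (SkewPoly q) (SkewPoly.x q '' {j | j.val < i}) := by
      refine SkewPoly.mem_span_x_of_mul_x_mem hq (i := v) (fun h => lt_irrefl i h) ?_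
      have h1 := congrArg (d z) ha2
      rw [hda, map_add, map_add, hdd _ (hYmem c hc), zero_add, map_smul, hdY, smul_smul] at h1
      have h2 := cf_one_d_mem hq hz he hdeg hze i (neg_mem hb1)
      rw [map_neg, neg_eq_of_add_eq_zero_right h1.symm, map_smul, cf_one_one, smul_eq_mul,
        mul_one] at h2
      exact h2
    obtain ⟨a', ha', hra⟩ := exists_d_eq_smul_one hq hz he hdeg hze hr
    -- Since `r` is the boundary of `a'`, subtracting the boundary of `a' y_v` removes `y_v`
    -- altogether, and the induction hypothesis applies to what remains.
    have ha3 : b + b' * var (polyData q) V (e v) =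
        d z (c * var (polyData q) V (e v) + a' * var (polyData q) V (e v)) +
        (b - inv (polyData q) V c * (SkewPoly.x q v • 1) -
          inv (polyData q) V a' * (SkewPoly.x q v • 1)) := by
      rw [ha2, map_add, d_mul H hz a', hdY, hra, smul_mul_assoc, one_mul]; abel
    have hb2 := sub_mem hb1 (hmulz a' ha')
    have hd2 := congrArg (d z) ha3
    rw [hda, map_add, hdd _ (add_mem (hYmem c hc) (hYmem a' ha')), zero_add] at hd2
    obtain ⟨b₃, hb₃, r₃, hr₃⟩ := ih (by omega) hb2 hd2.symm
    refine ⟨c * var (polyData q) V (e v) + a' * var (polyData q) V (e v) + b₃,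
      add_mem (add_mem (hYmem c hc) (hYmem a' ha')) (hSle hb₃), r₃, ?_⟩
    rw [ha3, hr₃, map_add (d z) _ b₃]; abel

/-- The Koszul complex of a skew polynomial ring is a resolution of `k`. -/
theorem koszul_exact {a : SemiFree (polyData q) V} (ha : a ∈ sub (polyData q) V (Set.range e))
    (hda : d z a = 0) : ∃ b ∈ sub (polyData q) V (Set.range e), ∃ α : k, a = d z b + α • 1 := by
  have hS : e '' {j | j.val < n} = Set.range e := by
    rw [show {j : Fin n | j.val < n} = Set.univ from Set.eq_univ_of_forall fun j => j.2,
      Set.image_univ]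
  have hx : SkewPoly.x q '' {j | j.val < n} = Set.range (SkewPoly.x q) := by
    rw [show {j : Fin n | j.val < n} = Set.univ from Set.eq_univ_of_forall fun j => j.2,
      Set.image_univ]
  have h1 := fun a ha => exists_eq_d_add_smul_one (a := a) hq hz he hdeg hze n le_rfl ha
  have h2 := fun r hr => exists_d_eq_smul_one (r := r) hq hz he hdeg hze (i := n) hr
  rw [hS] at h1 h2
  rw [hx] at h2
  obtain ⟨b, hb, r, rfl⟩ := h1 a ha hda
  obtain ⟨s, hs, hr⟩ := exists_eq_aug_add r
  obtain ⟨b', hb', hb's⟩ := h2 s hs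
  refine ⟨b + b', add_mem hb hb', aug q r, ?_⟩
  rw [map_add, hb's]
  nth_rewrite 1 [hr]
  rw [add_smul, algebraMap_smul]; abel

end Exact

end SemiFree

/-! ### Boundaries modulo the ideals of the regular sequence -/

namespace SemiFree

section

set_option linter.unusedSectionVars false

variable {k : Type u} [Field k] {G : Type v} [CommGroup G] {R : Type w} [Ring R] [Algebra k R]
variable {ι : Type t} [Fintype ι] [LinearOrder ι]
variable {C : ColorData k G R} {V : Vars G ι} {z : ι → SemiFree C V}

theorem cf_one_mul (a b : SemiFree C V) :
    cf C (Mon.one V) (a * b) = cf C (Mon.one V) a * cf C (Mon.one V) b := by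
  classical
  induction a using SemiFree.induction with
  | zero => simp
  | add a a' h h' => rw [add_mul, map_add, h, h', map_add, add_mul]
  | term I r =>
  induction b using SemiFree.induction with
  | zero => simp
  | add a a' h h' => rw [mul_add, map_add, h, h', map_add, mul_add]
  | term J s =>
    rw [term_mul_term, cf_term, cf_term]
    by_cases hI : I = Mon.one V
    · by_cases hJ : J = Mon.one V
      · subst hI hJ
        have h := SemiFree.one_mul' (term C (Mon.one V) (r * s))
        rw [one_def, term_mul_term, one_mul] at h
        have e : C.aut (Mon.one V).color = 1 := by rw [color_one, map_one]
        rw [e, AlgEquiv.one_apply] at h ⊢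
        rw [h, cf_term, if_pos rfl, if_pos rfl, if_pos rfl]
      · rw [if_neg hJ, mul_zero]
        unfold mulTerm
        split_ifs with hc
        · rw [cf_term, if_neg]
          intro h
          refine hJ (Mon.ext (funext fun v => ?_))
          have := congrArg (fun M => Mon.exp M v) h
          simp only [Mon.add, Mon.one, Pi.zero_apply] at this ⊢
          omega
        · exact map_zero _
    · rw [if_neg hI, zero_mul]
      unfold mulTerm
      split_ifs with hc
      · rw [cf_term, if_neg]
        intro h
        refine hI (Mon.ext (funext fun v => ?_))
        have := congrArg (fun M => Mon.exp M v) h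
        simp only [Mon.add, Mon.one, Pi.zero_apply] at this ⊢
        omega
      · exact map_zero _

/-- Constant terms are multiplicative, so if those of all `z v` are killed by `ε`, then so are those
of all boundaries. This is why `1` is not a boundary. -/
theorem map_cf_one_d {B : Type*} [Ring B] [Algebra k B] (ε : R →ₐ[k] B)
    (h : ∀ v, ε (cf C (Mon.one V) (z v)) = 0) (a : SemiFree C V) :
    ε (cf C (Mon.one V) (d z a)) = 0 := by
  induction a using SemiFree.induction with
  | zero => simp
  | add a a' h h' => rw [map_add, map_add, map_add, h, h', add_zero]
  | term I r =>
    rw [d_term, map_smul, smul_eq_mul, map_mul, dMon, map_sum, map_sum, Finset.sum_eq_zero,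
      mul_zero]
    intro v _
    split_ifs
    · simp
    · rw [cf_one_mul, cf_one_mul, map_mul, map_mul, h, mul_zero, zero_mul]

end

section Chain

set_option linter.unusedSectionVars false

variable {k : Type u} [Field k] {n c : ℕ} {q : Fin n → Fin n → kˣ} (hq : IsSkewMatrix q)
variable {f : Fin c → SkewPoly q} {δ : Fin c → ℕ} {γ : Fin c → ColorGroup q}
  (hf : ∀ j, f j ∈ SkewPoly.comp q (δ j) (γ j)) (hreg : IsRegularSeq f)
variable {ι : Type t} [Fintype ι] [LinearOrder ι] {V : Vars (ColorGroup q) ι}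
  {z : ι → SemiFree (polyData q) V} (hz : IsDiff (polyData q) V z)

/-- The elements with coefficients in the ideal of the `f_j` with `j < i`. -/
abbrev seqCoef (f : Fin c → SkewPoly q) (V : Vars (ColorGroup q) ι) (i : ℕ) :
    Submodule (SkewPoly q) (SemiFree (polyData q) V) :=
  coefIdeal (polyData q) V (seqIdeal f i)

include hq hf in
theorem mul_mem_seqCoef (i : ℕ) (b : SemiFree (polyData q) V) {a : SemiFree (polyData q) V}
    (ha : a ∈ seqCoef f V i) : b * a ∈ seqCoef f V i :=
  mul_mem_coefIdeal_left (fun g _ hr => aut_mem_seqIdeal hq hf i g hr) ha b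

theorem gen_smul_mem_seqCoef {i : ℕ} {j : Fin c} (h : j.val < i) (a : SemiFree (polyData q) V) :
    f j • a ∈ seqCoef f V i := smul_mem_coefIdeal (mem_seqIdeal f h) a

theorem seqCoef_mono {i i' : ℕ} (h : i ≤ i') : seqCoef f V i ≤ seqCoef f V i' :=
  coefIdeal_mono (seqIdeal_mono f h)

include hq hz in
theorem d_mul_of_inv_eq_neg {ζ : SemiFree (polyData q) V} (hinv : inv (polyData q) V ζ = -ζ)
    {r : SkewPoly q} (hdζ : d z ζ = r • 1) (b : SemiFree (polyData q) V) :
    d z (ζ * b) = r • b - ζ * d z b := by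
  rw [d_mul (SkewPoly.good_polyData hq) hz, hdζ, hinv, smul_mul_assoc, one_mul, neg_mul,
    sub_eq_add_neg]

include hq hf hreg hz in
-- Passing from the quotient by `f_j`, `j < i`, to the one by `f_j`, `j ≤ i`, means enlarging the
-- ideal of coefficients in one fixed module. The sign in the rule for the boundary of `ζ b` comes
-- from `ζ` having odd degree, expressed by `hinv`.
theorem killData (i : Fin c) {S : Set ι} (hS : ∀ v ∈ S, z v ∈ sub (polyData q) V S)
    (hdd : ∀ v ∈ S, d z (z v) ∈ seqCoef f V i.val) {ζ : SemiFree (polyData q) V}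
    (hζ : ζ ∈ sub (polyData q) V S) (hinv : inv (polyData q) V ζ = -ζ)
    (hdζ : d z ζ = f i • 1) :
    KillData (d z).toAddMonoidHom (sub (polyData q) V S).toAddSubgroup
      (seqCoef f V i.val).toAddSubgroup (seqCoef f V (i.val + 1)).toAddSubgroup (f i) ζ where
  d_mem a ha := d_mem_sub (SkewPoly.good_polyData hq) hz hS ha
  d_mem_N a ha := d_mem_coefIdeal ha
  smul_mem a ha := Submodule.smul_mem _ _ ha
  smul_mem_N a ha := Submodule.smul_mem _ _ ha
  mul_mem a ha := mul_mem_sub hζ ha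
  mul_mem_N a ha := mul_mem_seqCoef hq hf i.val ζ ha
  d_d a ha := d_d_mem_coefIdeal (SkewPoly.good_polyData hq) hz hdd ha
  split a ha ha' := by
    obtain ⟨u, hu, b, hb, h⟩ := exists_eq_add_smul (fun r hr => mem_seqIdeal_succ hq hf i hr) ha ha'
    exact ⟨u, hu.1, hu.2, b, hb, h⟩
  le := seqCoef_mono (Nat.le_succ _)
  smul_mem_N' a := gen_smul_mem_seqCoef (Nat.lt_succ_self _) a
  regular b _ h I := mem_seqIdeal_of_gen_mul_mem hq hf hreg i (by
    have := h I
    rwa [map_smul, smul_eq_mul] at this)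
  d_smul b := map_smul (d z) _ b
  d_mul b := d_mul_of_inv_eq_neg hq hz hinv hdζ b

section Augmentation

variable (haug : ∀ j, aug q (f j) = 0) (hzaug : ∀ v, aug q (cf (polyData q) (Mon.one V) (z v)) = 0)

include haug hzaug in
-- Constant terms of boundaries and elements of the ideal have augmentation zero, whereas `α • 1`
-- has augmentation `α`.
theorem eq_zero_of_smul_one_sub_d_mem {i : ℕ} {α : k} {b : SemiFree (polyData q) V}
    (h : α • 1 - d z b ∈ seqCoef f V i) : α = 0 := by
  have h1 := aug_of_mem_seqIdeal haug (h (Mon.one V))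
  rw [map_sub, map_sub, map_cf_one_d _ hzaug, sub_zero, ← smul_one_smul (SkewPoly q), map_smul,
    cf_one_one, smul_eq_mul, mul_one, map_smul, map_one, smul_eq_mul, mul_one] at h1
  exact h1

end Augmentation

/-! ### The homology of the Koszul complex -/

section Products

variable {A : Type*} [Ring A] [Algebra k A]

/-- The product of the `ζ_j` with `j ∈ s`, in decreasing order. -/
def zprod (ζ : Fin c → A) (s : Finset (Fin c)) : A := ((s.sort (· ≥ ·)).map ζ).prod

theorem zprod_empty (ζ : Fin c → A) : zprod ζ ∅ = 1 := by simp [zprod]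

/-- The reason for the decreasing order: a new largest index multiplies on the left, as `z` does in
`KillData`. -/
theorem zprod_insert (ζ : Fin c → A) {i : Fin c} {s : Finset (Fin c)} (h : ∀ j ∈ s, j < i) :
    zprod ζ (insert i s) = ζ i * zprod ζ s := by
  rw [zprod, Finset.sort_insert _ (fun j hj => (h j hj).le) (fun hi => lt_irrefl _ (h i hi)),
    List.map_cons, List.prod_cons, zprod]

/-- The linear combinations of the products of the `ζ_j`. -/
def comb (k : Type u) [Field k] [Algebra k A] (ζ : Fin c → A) : (Finset (Fin c) → k) →ₗ[k] A :=
  Fintype.linearCombination k (zprod ζ)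

theorem comb_apply (ζ : Fin c → A) (α : Finset (Fin c) → k) :
    comb k ζ α = ∑ s, α s • zprod ζ s := rfl

/-- The coefficients of linear combinations of products of the `ζ_j` with `j < i`. -/
def below (k : Type u) [Field k] (c i : ℕ) : Submodule k (Finset (Fin c) → k) where
  carrier := {α | ∀ s, (∃ j ∈ s, i ≤ j.val) → α s = 0}
  zero_mem' _ _ := rfl
  add_mem' ha hb s hs := by rw [Pi.add_apply, ha s hs, hb s hs, add_zero]
  smul_mem' r a ha s hs := by rw [Pi.smul_apply, ha s hs, smul_zero]

theorem below_last (α : Finset (Fin c) → k) : α ∈ below k c c := fun _ ⟨j, _, hj⟩ =>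
  absurd j.2 (not_lt.mpr hj)

/-- The subsets are sorted by whether they contain the largest admitted index `i`. This is the
decomposition of the homology into `E` and `ζ_i E`. -/
theorem comb_split (ζ : Fin c → A) (i : Fin c) {α : Finset (Fin c) → k}
    (hα : α ∈ below k c (i.val + 1)) :
    comb k ζ α = comb k ζ (fun s => if i ∈ s then 0 else α s) +
      ζ i * comb k ζ (fun s => if i ∈ s then 0 else α (insert i s)) := by
  simp only [comb_apply, Finset.mul_sum, ite_smul, zero_smul, Finset.sum_ite,
    Finset.sum_const_zero, zero_add]
  rw [add_comm, ← Finset.sum_filter_add_sum_filter_not Finset.univ (fun s => i ∈ s)]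
  congr 1
  refine Finset.sum_nbij' (fun s => s.erase i) (fun s => insert i s) ?_ ?_ ?_ ?_ ?_
  · intro s _; simp
  · intro s _; simp
  · intro s hs; exact Finset.insert_erase (by simpa using hs)
  · intro s hs; exact Finset.erase_insert (by simpa using hs)
  · intro s hs
    have hs' : i ∈ s := by simpa using hs
    rw [Finset.insert_erase hs', mul_smul_comm]
    by_cases h : ∃ j ∈ s, i.val + 1 ≤ j.val
    · rw [hα s h, zero_smul, zero_smul]
    · push Not at h
      rw [← zprod_insert, Finset.insert_erase hs']
      intro j hj
      have h1 := h j (Finset.mem_of_mem_erase hj)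
      have h2 := Finset.ne_of_mem_erase hj
      exact lt_of_le_of_ne (by rw [Fin.le_def]; omega) h2

theorem below_split {i : Fin c} {α : Finset (Fin c) → k} (hα : α ∈ below k c (i.val + 1)) :
    (fun s => if i ∈ s then 0 else α s) ∈ below k c i.val ∧
      (fun s => if i ∈ s then 0 else α (insert i s)) ∈ below k c i.val := by
  constructor
  all_goals
    rintro s ⟨j, hj, hij⟩
    dsimp only
    split_ifs with h
    · rfl
    · have hne : j ≠ i := fun e => h (e ▸ hj)
      exact hα _ ⟨j, by simp [hj], by have := Fin.val_ne_of_ne hne; omega⟩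

/-- The inverse of `comb_split`: the coefficient of a subset with `i` comes from `β`, that of a
subset without `i` from `α`. -/
theorem exists_comb_eq (ζ : Fin c → A) (i : Fin c) {α β : Finset (Fin c) → k}
    (hα : α ∈ below k c i.val) (hβ : β ∈ below k c i.val) :
    ∃ μ ∈ below k c (i.val + 1), comb k ζ μ = comb k ζ α + ζ i * comb k ζ β := by
  have hμ : (fun s => if i ∈ s then β (s.erase i) else α s) ∈ below k c (i.val + 1) := by
    rintro s ⟨j, hj, hij⟩
    dsimp only
    split_ifs
    · exact hβ _ ⟨j, Finset.mem_erase.mpr ⟨fun e => by subst e; omega, hj⟩, by omega⟩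
    · exact hα _ ⟨j, hj, by omega⟩
  refine ⟨_, hμ, ?_⟩
  rw [comb_split ζ i hμ]
  congr 3
  · funext s
    split_ifs with h
    · exact (hα s ⟨i, h, le_rfl⟩).symm
    · rfl
  · funext s
    split_ifs with h h'
    · exact (hβ s ⟨i, h, le_rfl⟩).symm
    · rw [Finset.erase_insert h]
    · exact absurd (Finset.mem_insert_self i s) h'

end Products

variable (haug : ∀ j, aug q (f j) = 0) (hzaug : ∀ v, aug q (cf (polyData q) (Mon.one V) (z v)) = 0)
variable {e : Fin n → ι} (he : StrictMono e) (hdeg : ∀ i, V.hdeg (e i) = 1)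
  (hze : ∀ i, z (e i) = SkewPoly.x q i • 1)
variable {ζ : Fin c → SemiFree (polyData q) V}
  (hζ : ∀ j, ζ j ∈ sub (polyData q) V (Set.range e))
  (hinv : ∀ j, inv (polyData q) V (ζ j) = -ζ j) (hdζ : ∀ j, d z (ζ j) = f j • 1)

include hζ in
theorem zprod_mem_sub (s : Finset (Fin c)) : zprod ζ s ∈ sub (polyData q) V (Set.range e) := by
  unfold zprod
  induction s.sort (· ≥ ·) with
  | nil => exact one_mem_sub _
  | cons j l ih => rw [List.map_cons, List.prod_cons]; exact mul_mem_sub (hζ j) ih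

include hζ in
theorem comb_mem_sub (α : Finset (Fin c) → k) :
    comb k ζ α ∈ sub (polyData q) V (Set.range e) := by
  rw [comb_apply]
  exact Submodule.sum_mem _ fun s _ => supp_smul_mem _ (zprod_mem_sub hζ s)

include hq hf hz hinv hdζ in
theorem d_zprod_mem {i : ℕ} {s : Finset (Fin c)} (hs : ∀ j ∈ s, j.val < i) :
    d z (zprod ζ s) ∈ seqCoef f V i := by
  have hs' : ∀ j ∈ s.sort (· ≥ ·), j.val < i := fun j hj => hs j (by simpa using hj)
  unfold zprod
  generalize s.sort (· ≥ ·) = l at hs' ⊢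
  induction l with
  | nil => rw [List.map_nil, List.prod_nil, d_one]; exact zero_mem _
  | cons j l ih =>
    rw [List.map_cons, List.prod_cons, d_mul_of_inv_eq_neg hq hz (hinv j) (hdζ j)]
    exact sub_mem (gen_smul_mem_seqCoef (hs' j (by simp)) _)
      (mul_mem_seqCoef hq hf i _ (ih fun j' hj' => hs' j' (by simp [hj'])))

theorem d_field_smul (a : k) (b : SemiFree (polyData q) V) : d z (a • b) = a • d z b := by
  rw [← smul_one_smul (SkewPoly q) a b, map_smul, smul_one_smul]

theorem field_smul_mem_seqCoef (a : k) {i : ℕ} {b : SemiFree (polyData q) V}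
    (hb : b ∈ seqCoef f V i) : a • b ∈ seqCoef f V i := by
  rw [← smul_one_smul (SkewPoly q) a b]; exact Submodule.smul_mem _ _ hb

include hq hf hz hinv hdζ in
theorem d_comb_mem {i : ℕ} {α : Finset (Fin c) → k} (hα : α ∈ below k c i) :
    d z (comb k ζ α) ∈ seqCoef f V i := by
  rw [comb_apply, map_sum]
  refine Submodule.sum_mem _ fun s _ => ?_
  rw [d_field_smul]
  by_cases h : ∃ j ∈ s, i ≤ j.val
  · rw [hα s h, zero_smul]; exact zero_mem _
  · push Not at h
    exact field_smul_mem_seqCoef _ (d_zprod_mem hq hf hz hinv hdζ h)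

include hze in
theorem z_mem_sub_range : ∀ v ∈ Set.range e, z v ∈ sub (polyData q) V (Set.range e) := by
  rintro _ ⟨j, rfl⟩
  rw [hze]; exact smul_one_mem_sub _ _

include hze in
theorem d_z_range : ∀ v ∈ Set.range e, d z (z v) = 0 := by
  rintro _ ⟨j, rfl⟩
  rw [hze, d_smul_one]

include hq hf hreg hz haug hzaug he hdeg hze hζ hinv hdζ in
-- Each `f_i` doubles the homology by `KillData`, from `E` to `E` and `ζ_i E`, starting from `k` for
-- the skew polynomial ring. So the products of the `ζ_j` with `j < i` form a `k`-basis of the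
-- homology modulo the first `i` elements; the two halves state generation and independence.
theorem koszul_homology (i : ℕ) (hi : i ≤ c) :
    (∀ a ∈ sub (polyData q) V (Set.range e), d z a ∈ seqCoef f V i →
      ∃ b ∈ sub (polyData q) V (Set.range e), ∃ α ∈ below k c i, ∃ u ∈ seqCoef f V i,
        a = d z b + comb k ζ α + u) ∧
    (∀ α ∈ below k c i, ∀ b ∈ sub (polyData q) V (Set.range e),
      comb k ζ α - d z b ∈ seqCoef f V i → α = 0) := by
  induction i with
  | zero =>
    constructor
    · intro a ha hda
      rw [seqCoef, seqIdeal_zero, mem_coefIdeal_bot] at hda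
      obtain ⟨b, hb, α, rfl⟩ := koszul_exact hq hz he hdeg hze ha hda
      refine ⟨b, hb, Pi.single ∅ α, ?_, 0, zero_mem _, ?_⟩
      · rintro s ⟨j, hj, -⟩
        exact Pi.single_eq_of_ne (Finset.ne_empty_of_mem hj) _
      · rw [comb_apply, Finset.sum_eq_single ∅, zprod_empty, Pi.single_eq_same, add_zero]
        · intro s _ hs; rw [Pi.single_eq_of_ne hs, zero_smul]
        · simp
    · intro α hα b _ h
      have h0 : ∀ s, s ≠ ∅ → α s = 0 := fun s hs => by
        obtain ⟨j, hj⟩ := Finset.nonempty_iff_ne_empty.mpr hs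
        exact hα s ⟨j, hj, Nat.zero_le _⟩
      rw [comb_apply, Finset.sum_eq_single ∅ (fun s _ hs => by rw [h0 s hs, zero_smul]) (by simp),
        zprod_empty] at h
      have h1 := eq_zero_of_smul_one_sub_d_mem haug hzaug h
      funext s
      by_cases hs : s = ∅
      · rw [hs, h1]; rfl
      · exact h0 s hs
  | succ i ih =>
    obtain ⟨gen, ind⟩ := ih (by omega)
    let i' : Fin c := ⟨i, hi⟩
    have K := killData hq hf hreg hz i' (z_mem_sub_range hze)
      (fun v hv => by rw [d_z_range hze v hv]; exact zero_mem _) (hζ i') (hinv i') (hdζ i')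
    let E : AddSubgroup (SemiFree (polyData q) V) := ((below k c i).map (comb k ζ)).toAddSubgroup
    have hE : E ≤ (sub (polyData q) V (Set.range e)).toAddSubgroup := by
      rintro _ ⟨α, -, rfl⟩; exact comb_mem_sub hζ α
    have hDE : ∀ e ∈ E, d z e ∈ seqCoef f V i := by
      rintro _ ⟨α, hα, rfl⟩; exact d_comb_mem hq hf hz hinv hdζ hα
    have gen' : ∀ a ∈ (sub (polyData q) V (Set.range e)).toAddSubgroup, d z a ∈ seqCoef f V i →
        ∃ b ∈ (sub (polyData q) V (Set.range e)).toAddSubgroup, ∃ e ∈ E,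
          ∃ u ∈ (seqCoef f V i).toAddSubgroup, a = d z b + e + u := by
      intro a ha hda
      obtain ⟨b, hb, α, hα, u, hu, h⟩ := gen a ha hda
      exact ⟨b, hb, _, ⟨α, hα, rfl⟩, u, hu, h⟩
    constructor
    · intro a ha hda
      obtain ⟨b, hb, _, ⟨α, hα, rfl⟩, _, ⟨β, hβ, rfl⟩, u, hu, h⟩ := K.generates hE hDE gen' ha hda
      obtain ⟨μ, hμ, hμ'⟩ := exists_comb_eq ζ i' hα hβ
      refine ⟨b, hb, μ, hμ, u, hu, ?_⟩
      rw [hμ', h, ← add_assoc]; rfl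
    · intro α hα b hb h
      rw [comb_split ζ i' hα] at h
      obtain ⟨h₀, h₁⟩ := below_split (i := i') hα
      have h' := K.independent hE hDE gen' (by
        rintro _ ⟨α, hα, rfl⟩ b hb h
        rw [ind α hα b hb h]; exact map_zero _) ⟨_, h₀, rfl⟩ ⟨_, h₁, rfl⟩ hb h
      -- The elements of `E` are already known to vanish. Independence with the zero boundary turns
      -- this into vanishing of their coefficients.
      have e₀ := ind _ h₀ 0 (zero_mem _) (by
        rw [map_zero, sub_zero]; exact h'.1 ▸ zero_mem _)
      have e₁ := ind _ h₁ 0 (zero_mem _) (by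
        rw [map_zero, sub_zero]; exact h'.2 ▸ zero_mem _)
      funext s
      by_cases hs : i' ∈ s
      · have := congrFun e₁ (s.erase i')
        simpa [Finset.insert_erase hs] using this
      · have := congrFun e₀ s
        simpa [hs] using this

end Chain

end SemiFree

namespace SemiFree

/-! ### The homology of the extension by divided power variables -/

section Tate

set_option linter.unusedSectionVars false

variable {k : Type u} [Field k] {n c : ℕ} {q : Fin n → Fin n → kˣ} (hq : IsSkewMatrix q)
variable {f : Fin c → SkewPoly q} {δ : Fin c → ℕ} {γ : Fin c → ColorGroup q}
  (hf : ∀ j, f j ∈ SkewPoly.comp q (δ j) (γ j)) (hreg : IsRegularSeq f)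
variable {ι : Type t} [Fintype ι] [LinearOrder ι] {V : Vars (ColorGroup q) ι}
  {z : ι → SemiFree (polyData q) V} (hz : IsDiff (polyData q) V z)

section Adjoin

variable {S : Set ι} {v : ι} (hSv : ∀ w ∈ S, w < v) (heven : ¬ Odd (V.hdeg v))
  (hSz : ∀ w ∈ S, z w ∈ sub (polyData q) V S) (hzv : z v ∈ sub (polyData q) V S)

include hq hz hSv heven hSz hzv

theorem coefAt_d_mul_dpow {b : SemiFree (polyData q) V} (hb : b ∈ sub (polyData q) V S)
    (l l' : ℕ) : coefAt (polyData q) V v l' (d z (b * dpow (polyData q) V v l)) =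
      (if l = l' then d z b else 0) +
        if l = l' + 1 then inv (polyData q) V b * z v else 0 := by
  have H := SkewPoly.good_polyData hq
  have hdb := d_mem_sub H hz hSz hb
  cases l with
  | zero =>
    have := coefAt_mul_dpow hSv hdb (l := 0) (l' := l') fun h => absurd h heven
    rw [dpow_zero, mul_one] at this ⊢
    rw [this, if_neg (by omega : ¬ 0 = l' + 1), add_zero]
  | succ l =>
    rw [d_mul H hz, d_dpow_succ H hz fun h => absurd h heven, ← mul_assoc, map_add,
      coefAt_mul_dpow hSv hdb fun h => absurd h heven,
      coefAt_mul_dpow hSv (mul_mem_sub (inv_mem_supp hb) hzv) fun h => absurd h heven]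
    simp only [add_left_inj]

theorem coefAt_d_sum {b : ℕ → SemiFree (polyData q) V} (hb : ∀ l, b l ∈ sub (polyData q) V S)
    (N l' : ℕ) (hN : N ≤ l') : coefAt (polyData q) V v l'
      (d z (∑ l ∈ Finset.range N, b l * dpow (polyData q) V v l)) = 0 := by
  rw [map_sum, map_sum]
  refine Finset.sum_eq_zero fun l hl => ?_
  have hl := Finset.mem_range.mp hl
  rw [coefAt_d_mul_dpow hq hz hSv heven hSz hzv (hb l), if_neg (by omega), if_neg (by omega),
    add_zero]

include hf in
-- Before the variable is adjoined the homology is `k` and the multiples of `z v`. Induction on the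
-- highest exponent of `y_v`: the class of `z v` in the top coefficient is removed by the next
-- divided power, and a constant in it would make `z v` a boundary one step lower.
theorem divided_power_step {i : ℕ} {b : ℕ → SemiFree (polyData q) V}
    (hb : ∀ l, b l ∈ sub (polyData q) V S)
    (hdd : ∀ w ∈ insert v S, d z (z w) ∈ seqCoef f V i)
    (gen : ∀ a ∈ sub (polyData q) V S, d z a ∈ seqCoef f V i →
      ∃ x ∈ sub (polyData q) V S, ∃ α β : k, ∃ u ∈ seqCoef f V i,
        a = d z x + α • 1 + β • z v + u)
    (ind : ∀ α : k, ∀ x ∈ sub (polyData q) V S, α • z v - d z x ∈ seqCoef f V i → α = 0)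
    (N : ℕ) {y : SemiFree (polyData q) V} (hy : y ∈ sub (polyData q) V S)
    (hd : d z (∑ l ∈ Finset.range N, b l * dpow (polyData q) V v l +
      y * dpow (polyData q) V v N) ∈ seqCoef f V i) :
    ∃ x ∈ sub (polyData q) V (insert v S), ∃ α : k, ∃ u ∈ seqCoef f V i,
      ∑ l ∈ Finset.range N, b l * dpow (polyData q) V v l + y * dpow (polyData q) V v N =
        d z x + α • 1 + u := by
  have H := SkewPoly.good_polyData hq
  have hle : sub (polyData q) V S ≤ sub (polyData q) V (insert v S) :=
    sub_mono (Set.subset_insert _ _)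
  have hpow := fun l => dpow_mem_sub (C := polyData q) (V := V) (Set.mem_insert v S) l
  induction N generalizing y with
  | zero =>
    rw [Finset.range_zero, Finset.sum_empty, zero_add, dpow_zero, mul_one] at hd ⊢
    obtain ⟨x, hx, α, β, u, hu, rfl⟩ := gen y hy hd
    refine ⟨x + β • var (polyData q) V v,
      add_mem (hle hx) (supp_smul_mem _ (var_mem_sub (Set.mem_insert _ _))), α, u, hu, ?_⟩
    rw [map_add, d_field_smul, d_var H hz]; abel
  | succ M ih =>
    -- The map `d` does not raise the exponent of `y_v`, so the coefficient of the top power in the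
    -- boundary is the boundary of `y`.
    have h1 : d z y ∈ seqCoef f V i := by
      have := coefAt_mem_coefIdeal (v := v) (M + 1) hd
      rwa [map_add, map_add, coefAt_d_sum hq hz hSv heven hSz hzv hb _ _ le_rfl, zero_add,
        coefAt_d_mul_dpow hq hz hSv heven hSz hzv hy, if_pos rfl, if_neg (by omega),
        add_zero] at this
    obtain ⟨x, hx, α, β, u, hu, rfl⟩ := gen y hy h1
    -- The boundary of this element has `d x + β z_v` as coefficient of the top power; up to the
    -- ideal only `α` stays there. The correction to the next lower coefficient goes into `y'`.
    set x₁ := x * dpow (polyData q) V v (M + 1) + β • dpow (polyData q) V v (M + 2) with hx₁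
    have hx₁mem : x₁ ∈ sub (polyData q) V (insert v S) :=
      add_mem (mul_mem_sub (hle hx) (hpow _)) (supp_smul_mem _ (hpow _))
    set y' := b M - inv (polyData q) V x * z v with hy'
    have hy'mem : y' ∈ sub (polyData q) V S := sub_mem (hb M) (mul_mem_sub (inv_mem_supp hx) hzv)
    have huW : u * dpow (polyData q) V v (M + 1) ∈ seqCoef f V i := mul_mem_coefIdeal_right hu _
    have e1 : ∑ l ∈ Finset.range (M + 1), b l * dpow (polyData q) V v l +
        (d z x + α • 1 + β • z v + u) * dpow (polyData q) V v (M + 1) =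
        d z x₁ + (∑ l ∈ Finset.range M, b l * dpow (polyData q) V v l +
          y' * dpow (polyData q) V v M + (α • 1) * dpow (polyData q) V v (M + 1)) +
          u * dpow (polyData q) V v (M + 1) := by
      rw [hx₁, hy', map_add, d_mul H hz, d_field_smul, d_dpow_succ H hz fun h => absurd h heven,
        d_dpow_succ H hz fun h => absurd h heven, Finset.sum_range_succ]
      simp only [add_mul, sub_mul, smul_mul_assoc, mul_assoc]
      abel
    have hddx : d z (d z x₁) ∈ seqCoef f V i := d_d_mem_coefIdeal H hz hdd hx₁mem
    have h2 : d z (∑ l ∈ Finset.range M, b l * dpow (polyData q) V v l +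
          y' * dpow (polyData q) V v M + (α • 1) * dpow (polyData q) V v (M + 1)) ∈
        seqCoef f V i := by
      rw [e1, map_add, map_add] at hd
      have := sub_mem (sub_mem hd (d_mem_coefIdeal (z := z) huW)) hddx
      rwa [add_sub_cancel_right, add_sub_cancel_left] at this
    have hα1 : (α • 1 : SemiFree (polyData q) V) ∈ sub (polyData q) V S :=
      supp_smul_mem _ (one_mem_sub _)
    -- The coefficient of the power below the top in the boundary is `d y' + α z_v`. As it vanishes
    -- modulo the ideal, `α z_v` is a boundary there.
    have hα : α = 0 := by
      have := coefAt_mem_coefIdeal (v := v) M h2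
      rw [map_add, map_add, map_add, map_add, coefAt_d_sum hq hz hSv heven hSz hzv hb _ _ le_rfl,
        zero_add, coefAt_d_mul_dpow hq hz hSv heven hSz hzv hy'mem, if_pos rfl, if_neg (by omega),
        add_zero, coefAt_d_mul_dpow hq hz hSv heven hSz hzv hα1, if_neg (by omega), if_pos rfl,
        zero_add, inv_of_mem_part (S := S) (m := 0) (by
          rw [← smul_one_smul (SkewPoly q)]
          exact Submodule.smul_mem _ _ (one_mem_part S)), pow_zero, one_smul, smul_mul_assoc,
        one_mul] at this
      refine ind α (-y') (neg_mem hy'mem) ?_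
      rwa [map_neg, sub_neg_eq_add, add_comm]
    subst hα
    rw [zero_smul, zero_mul, add_zero] at h2
    obtain ⟨x₂, hx₂, α₂, u₂, hu₂, h3⟩ := ih hy'mem h2
    refine ⟨x₁ + x₂, add_mem hx₁mem hx₂, α₂, u₂ + u * dpow (polyData q) V v (M + 1),
      add_mem hu₂ huW, ?_⟩
    rw [e1, zero_smul, zero_mul, add_zero, h3, map_add (d z) x₁ x₂]
    abel

end Adjoin

variable (haug : ∀ j, aug q (f j) = 0) (hzaug : ∀ v, aug q (cf (polyData q) (Mon.one V) (z v)) = 0)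
variable {e : Fin n → ι} (he : StrictMono e) (hdeg : ∀ i, V.hdeg (e i) = 1)
  (hze : ∀ i, z (e i) = SkewPoly.x q i • 1)
variable {w : Fin c → ι} (hw : StrictMono w) (hew : ∀ i j, e i < w j)
  (heven : ∀ j, ¬ Odd (V.hdeg (w j)))
  (hζ : ∀ j, z (w j) ∈ sub (polyData q) V (Set.range e))
  (hinv : ∀ j, inv (polyData q) V (z (w j)) = -z (w j)) (hdζ : ∀ j, d z (z (w j)) = f j • 1)

include hq hf hreg hz haug hzaug he hdeg hze hw hew heven hζ hinv hdζ in
-- Killing `f_i` enlarges the homology from `k` to `k` and `k z_i`, and the divided power variable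
-- with boundary `z_i` brings it back to `k`. Elements and variables are added in turn, so no
-- complex with larger homology occurs.
theorem tate_homology (i : ℕ) (hi : i ≤ c) {a : SemiFree (polyData q) V}
    (ha : a ∈ sub (polyData q) V (Set.range e ∪ w '' {j | j.val < i}))
    (hda : d z a ∈ seqCoef f V i) :
    ∃ b ∈ sub (polyData q) V (Set.range e ∪ w '' {j | j.val < i}), ∃ α : k,
      ∃ u ∈ seqCoef f V i, a = d z b + α • 1 + u := by
  induction i generalizing a with
  | zero =>
    have hS : Set.range e ∪ w '' {j | j.val < 0} = Set.range e := by simp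
    rw [hS] at ha ⊢
    rw [seqCoef, seqIdeal_zero, mem_coefIdeal_bot] at hda
    obtain ⟨b, hb, α, rfl⟩ := koszul_exact hq hz he hdeg hze ha hda
    exact ⟨b, hb, α, 0, zero_mem _, by rw [add_zero]⟩
  | succ i ih =>
    set S : Set ι := Set.range e ∪ w '' {j | j.val < i} with hS
    let v : Fin c := ⟨i, hi⟩
    have hins : Set.range e ∪ w '' {j | j.val < i + 1} = insert (w v) S := by
      rw [hS, ← Set.union_insert, ← Set.image_insert_eq]
      congr 2
      ext j
      simp only [Set.mem_ofPred_eq, Set.mem_insert_iff, v, Fin.ext_iff]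
      omega
    rw [hins] at ha ⊢
    have hSv : ∀ x ∈ S, x < w v := by
      rintro _ (⟨j, rfl⟩ | ⟨j, hj, rfl⟩)
      · exact hew _ _
      · exact hw hj
    have hzw : ∀ j, z (w j) ∈ sub (polyData q) V S := fun j =>
      sub_mono Set.subset_union_left (hζ j)
    have hSz : ∀ x ∈ S, z x ∈ sub (polyData q) V S := by
      rintro _ (⟨j, rfl⟩ | ⟨j, hj, rfl⟩)
      · rw [hze]; exact smul_one_mem_sub _ _
      · exact hzw j
    have hdd : ∀ i', ∀ x ∈ Set.range e ∪ w '' {j | j.val < i'}, d z (z x) ∈ seqCoef f V i' := by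
      rintro i' _ (⟨j, rfl⟩ | ⟨j, hj, rfl⟩)
      · rw [hze, d_smul_one]; exact zero_mem _
      · rw [hdζ]; exact gen_smul_mem_seqCoef hj _
    have K := killData hq hf hreg hz v hSz (hdd i) (hzw v) (hinv v) (hdζ v)
    -- By induction the constants represent the homology before `f_i` is killed.
    let E : AddSubgroup (SemiFree (polyData q) V) :=
      (Submodule.span k {(1 : SemiFree (polyData q) V)}).toAddSubgroup
    have hE : E ≤ (sub (polyData q) V S).toAddSubgroup := by
      intro x hx
      obtain ⟨α, rfl⟩ := Submodule.mem_span_singleton.mp hx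
      exact supp_smul_mem _ (one_mem_sub _)
    have hDE : ∀ x ∈ E, d z x ∈ seqCoef f V i := by
      intro x hx
      obtain ⟨α, rfl⟩ := Submodule.mem_span_singleton.mp hx
      rw [d_field_smul, d_one, smul_zero]; exact zero_mem _
    have gen' : ∀ a ∈ (sub (polyData q) V S).toAddSubgroup, d z a ∈ seqCoef f V i →
        ∃ b ∈ (sub (polyData q) V S).toAddSubgroup, ∃ x ∈ E,
          ∃ u ∈ (seqCoef f V i).toAddSubgroup, a = d z b + x + u := by
      intro a ha hda
      obtain ⟨b, hb, α, u, hu, h⟩ := ih (by omega) ha hda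
      exact ⟨b, hb, _, Submodule.mem_span_singleton.mpr ⟨α, rfl⟩, u, hu, h⟩
    have hmem : ∀ α : k, α • (1 : SemiFree (polyData q) V) ∈ E := fun α =>
      Submodule.mem_span_singleton.mpr ⟨α, rfl⟩
    obtain ⟨N, b, hb, rfl⟩ := exists_eq_sum_dpow hSv ha
    rcases N with - | N
    · exact ⟨0, zero_mem _, 0, 0, zero_mem _, by simp⟩
    rw [Finset.sum_range_succ] at hda ⊢
    refine divided_power_step hq hf hz hSv (heven v) hSz (hzw v) hb ?_ ?_ ?_ N (hb N) hda
    · rw [← hins]; exact hdd (i + 1)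
    · intro a ha hda
      obtain ⟨b, hb, x, hx, y, hy, u, hu, h⟩ := K.generates hE hDE gen' ha hda
      obtain ⟨α, rfl⟩ := Submodule.mem_span_singleton.mp hx
      obtain ⟨β, rfl⟩ := Submodule.mem_span_singleton.mp hy
      refine ⟨b, hb, α, β, u, hu, ?_⟩
      rw [h, mul_smul_comm, mul_one]; rfl
    · intro α x hx h
      have h' := (K.independent hE hDE gen' (by
        intro y hy b hb h
        obtain ⟨β, rfl⟩ := Submodule.mem_span_singleton.mp hy
        rw [eq_zero_of_smul_one_sub_d_mem haug hzaug h, zero_smul]) (zero_mem E) (hmem α) hx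
        (by rw [zero_add, mul_smul_comm, mul_one]; exact h)).2
      -- So far only `α • 1 = 0` is known; the augmentation recovers `α`.
      refine eq_zero_of_smul_one_sub_d_mem haug hzaug (i := 0) (b := 0) ?_
      rw [h', map_zero, sub_zero]; exact zero_mem _

end Tate

end SemiFree

/-! ### Projections to homological degrees and linear combinations of variables -/

namespace SemiFree

section

set_option linter.unusedSectionVars false

variable {k : Type u} [Field k] {G : Type v} [CommGroup G] {R : Type w} [Ring R] [Algebra k R]
variable {ι : Type t} [Fintype ι] [LinearOrder ι]
variable {C : ColorData k G R} {V : Vars G ι} {z : ι → SemiFree C V}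

/-- The projection to homological degree `m`. -/
def hproj (C : ColorData k G R) (V : Vars G ι) (m : ℕ) : SemiFree C V →ₗ[R] SemiFree C V :=
  Finsupp.linearCombination R fun I : Mon V => if I.hdeg = m then term C I 1 else 0

theorem hproj_term (m : ℕ) (I : Mon V) (r : R) :
    hproj C V m (term C I r) = if I.hdeg = m then term C I r else 0 := by
  refine (Finsupp.linearCombination_single ..).trans ?_
  rw [smul_ite, smul_zero]
  split_ifs
  · rw [smul_term', mul_one]
  · rfl

theorem hproj_mem_part {S : Set ι} {a : SemiFree C V} (ha : a ∈ sub C V S) (m : ℕ) :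
    hproj C V m a ∈ part C V S m := by
  induction ha using supp_induction with
  | zero => simp
  | add a a' _ _ h h' => rw [map_add]; exact add_mem h h'
  | term I r hI =>
    rw [hproj_term]
    split_ifs with h
    · exact term_mem_supp (P := fun J : Mon V => J.hdeg = m ∧ J.On S) ⟨h, hI⟩ r
    · exact zero_mem _

theorem hproj_of_mem_part {S : Set ι} {m' : ℕ} {a : SemiFree C V} (ha : a ∈ part C V S m') (m : ℕ) :
    hproj C V m a = if m' = m then a else 0 := by
  rw [part_eq_supp] at ha
  induction ha using supp_induction with
  | zero => simp
  | add a a' _ _ h h' => rw [map_add, h, h']; split_ifs <;> simp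
  | term I r hI => rw [hproj_term, hI.1]

theorem mem_part_of_mem_comp {h e : ℕ} {g : G} {a : SemiFree C V} (ha : a ∈ comp C V h e g) :
    a ∈ part C V Set.univ h := by
  induction ha using Submodule.span_induction with
  | zero => exact zero_mem _
  | add x y _ _ hx hy => exact add_mem hx hy
  | smul c x _ hx => exact supp_smul_mem c hx
  | mem x hx =>
    obtain ⟨I, e', g', r, hr, hI, -, -, rfl⟩ := hx
    exact term_mem_supp (P := fun J : Mon V => J.hdeg = h ∧ J.On Set.univ)
      ⟨hI, fun v hv => absurd trivial hv⟩ r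

theorem mem_sub_univ (a : SemiFree C V) : a ∈ sub C V Set.univ :=
  mem_supp.mpr fun _ _ _ hv => absurd trivial hv

theorem hproj_d (H : C.Good) (hz : IsDiff C V z) (m : ℕ) (a : SemiFree C V) :
    hproj C V m (d z a) = d z (hproj C V (m + 1) a) := by
  induction a using SemiFree.induction with
  | zero => simp
  | add a a' h h' => simp only [map_add, h, h']
  | term I r =>
    have hpos : ∀ v, 0 < V.hdeg v := fun v => by obtain ⟨h, hh, -⟩ := hz v; omega
    rw [hproj_term]
    rcases Nat.eq_zero_or_pos I.hdeg with h0 | h0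
    · have hI : I = Mon.one V := by
        refine Mon.ext (funext fun v => ?_)
        have := (Finset.sum_eq_zero_iff.mp h0) v (Finset.mem_univ v)
        exact (Nat.mul_eq_zero.mp this).resolve_right (hpos v).ne'
      rw [if_neg (by omega), map_zero, hI, term_eq_smul, ← one_def, map_smul, d_one, smul_zero,
        map_zero]
    · obtain ⟨h, hh⟩ : ∃ h, I.hdeg = h + 1 := ⟨I.hdeg - 1, by omega⟩
      have h1 : d z (term C I r) ∈ part C V Set.univ h :=
        d_mem_part H hz (fun v _ => by
          obtain ⟨h, hh, hv⟩ := hz v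
          exact ⟨h, hh, mem_part_of_mem_comp hv⟩) (term_mem_supp
            (P := fun J : Mon V => J.hdeg = h + 1 ∧ J.On Set.univ)
            ⟨hh, fun v hv => absurd trivial hv⟩ r)
      rw [hproj_of_mem_part h1, hh]
      simp only [add_left_inj]
      split_ifs <;> simp

theorem varMon_hdeg (v : ι) : (Mon.var V v).hdeg = V.hdeg v := by
  rw [Mon.hdeg, Finset.sum_eq_single v]
  · simp [Mon.var]
  · intro w _ hw; simp [Mon.var, Pi.single_eq_of_ne hw]
  · simp

theorem varMon_ideg (v : ι) : (Mon.var V v).ideg = V.ideg v := by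
  rw [Mon.ideg, Finset.sum_eq_single v]
  · simp [Mon.var]
  · intro w _ hw; simp [Mon.var, Pi.single_eq_of_ne hw]
  · simp

theorem varMon_color (v : ι) : (Mon.var V v).color = V.color v := by
  rw [Mon.color, Finset.prod_eq_single v]
  · simp [Mon.var]
  · intro w _ hw; simp [Mon.var, Pi.single_eq_of_ne hw]
  · simp

/-- The linear combinations of the variables `y_{e(i)}`. -/
def linComb {n : ℕ} (C : ColorData k G R) (V : Vars G ι) (e : Fin n → ι) (a : Fin n → R) :
    SemiFree C V := ∑ i, a i • var C V (e i)

variable {n : ℕ} {e : Fin n → ι}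

theorem linComb_mem_part (hdeg : ∀ i, V.hdeg (e i) = 1) (a : Fin n → R) :
    linComb C V e a ∈ part C V (Set.range e) 1 := by
  refine Submodule.sum_mem _ fun i _ => Submodule.smul_mem _ _ ?_
  refine term_mem_supp (P := fun J : Mon V => J.hdeg = 1 ∧ J.On (Set.range e)) ⟨?_, ?_⟩ 1
  · rw [varMon_hdeg, hdeg]
  · intro w hw
    exact Pi.single_eq_of_ne (fun h => hw ⟨i, h.symm⟩) _

theorem inv_linComb (hdeg : ∀ i, V.hdeg (e i) = 1) (a : Fin n → R) :
    inv C V (linComb C V e a) = -linComb C V e a := by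
  rw [inv_of_mem_part (linComb_mem_part hdeg a), pow_one, neg_one_smul]

theorem d_linComb (H : C.Good) (hz : IsDiff C V z) {x : Fin n → R}
    (hze : ∀ i, z (e i) = x i • 1) (a : Fin n → R) :
    d z (linComb C V e a) = (∑ i, a i * x i) • 1 := by
  rw [linComb, map_sum, Finset.sum_smul]
  refine Finset.sum_congr rfl fun i _ => ?_
  rw [map_smul, d_var H hz, hze, smul_smul]

theorem var_mem_comp (H : C.Good) (v : ι) :
    var C V v ∈ comp C V (V.hdeg v) (V.ideg v) (V.color v) := by
  have := mon_mem_comp (V := V) H (Mon.var V v)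
  rwa [varMon_hdeg, varMon_ideg, varMon_color] at this

theorem linComb_mem_comp (H : C.Good) (hdeg : ∀ i, V.hdeg (e i) = 1)
    (hideg : ∀ i, V.ideg (e i) = 1) {d : ℕ} {g : G} {a : Fin n → R}
    (ha : ∀ i, a i ∈ C.comp d (g * (V.color (e i))⁻¹)) :
    linComb C V e a ∈ comp C V 1 (d + 1) g := by
  refine Submodule.sum_mem _ fun i _ => ?_
  have := smul_mem_comp H (ha i) (var_mem_comp H (V := V) (e i))
  rwa [hdeg, hideg, inv_mul_cancel_right] at this

theorem smul_one_mem_comp (H : C.Good) {d : ℕ} {g : G} {r : R} (hr : r ∈ C.comp d g) :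
    r • (1 : SemiFree C V) ∈ comp C V 0 d g := by
  simpa using smul_mem_comp H hr (one_mem_comp H (V := V))

end

section Map

set_option linter.unusedSectionVars false

variable {k : Type u} [Field k] {G : Type v} [CommGroup G] {R R' : Type w} [Ring R] [Algebra k R]
  [Ring R'] [Algebra k R']
variable {ι : Type t} [Fintype ι] [LinearOrder ι]
variable {C : ColorData k G R} {C' : ColorData k G R'} {V : Vars G ι} {z : ι → SemiFree C V}
variable (φ : R →ₐ[k] R') (hχ : C.χ = C'.χ) (hφ : ∀ g r, φ (C.aut g r) = C'.aut g (φ r))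

theorem map_mem_comp (hcomp : ∀ e g, ∀ r ∈ C.comp e g, φ r ∈ C'.comp e g) {h e : ℕ} {g : G}
    {a : SemiFree C V} (ha : a ∈ comp C V h e g) : map φ hχ hφ V a ∈ comp C' V h e g := by
  induction ha using Submodule.span_induction with
  | zero => rw [map_zero]; exact zero_mem _
  | add x y _ _ hx hy => rw [map_add]; exact add_mem hx hy
  | smul c x _ hx => rw [map_smul_field]; exact Submodule.smul_mem _ _ hx
  | mem x hx =>
    obtain ⟨I, e', g', r, hr, rfl, rfl, rfl, rfl⟩ := hx
    rw [map_term]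
    exact term_mem_comp I (hcomp _ _ r hr)

theorem map_linComb {n : ℕ} (e : Fin n → ι) (a : Fin n → R) :
    map φ hχ hφ V (linComb C V e a) = linComb C' V e fun i => φ (a i) := by
  rw [linComb, map_sum]
  exact Finset.sum_congr rfl fun i _ => by rw [map_smul', map_var]

theorem map_comb {c : ℕ} (ζ : Fin c → SemiFree C V) (α : Finset (Fin c) → k) :
    map φ hχ hφ V (comb k ζ α) = comb k (fun j => map φ hχ hφ V (ζ j)) α := by
  rw [comb_apply, comb_apply, map_sum]
  refine Finset.sum_congr rfl fun s _ => ?_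
  rw [map_smul_field, zprod, map_list_prod, List.map_map]
  rfl

end Map

end SemiFree

/-! ### Regular sequences of normal homogeneous elements -/

/-- A regular sequence of elements that are homogeneous for the degree and the colour. -/
structure IsColorRegular {k : Type u} [Field k] {n c : ℕ} {q : Fin n → Fin n → kˣ}
    (f : Fin c → SkewPoly q) (δ : Fin c → ℕ) (γ : Fin c → ColorGroup q) : Prop where
  skew : IsSkewMatrix q
  pos : ∀ j, 1 ≤ δ j
  mem : ∀ j, f j ∈ SkewPoly.comp q (δ j) (γ j)
  regular : IsRegularSeq f

namespace IsColorRegular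

variable {k : Type u} [Field k] {n c : ℕ} {q : Fin n → Fin n → kˣ} {f : Fin c → SkewPoly q}
  {δ : Fin c → ℕ} {γ : Fin c → ColorGroup q}

/-- Colour homogeneity is proved for nonzero elements only. If `f_j` were zero, regularity would put
`1` into the ideal of the earlier elements, which the augmentation kills. -/
theorem exists_of_isNormal (hq : IsSkewMatrix q) (hδ : ∀ j, 1 ≤ δ j)
    (hf : ∀ j, f j ∈ SkewPoly.homog q (δ j)) (hn : ∀ j, IsNormal (f j)) (hr : IsRegularSeq f) :
    ∃ γ, IsColorRegular f δ γ := by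
  have haug : ∀ j, aug q (f j) = 0 := fun j => aug_of_mem_homog (hδ j) (hf j)
  have h0 : ∀ j, f j ≠ 0 := by
    intro j h
    have h1 : (1 : SkewPoly q) ∈ seqIdeal f j.val :=
      hr j 1 (by rw [h, mul_zero]; exact TwoSidedIdeal.zero_mem _)
    have h2 := aug_of_mem_seqIdeal haug h1
    rw [map_one] at h2
    exact one_ne_zero h2
  choose γ hγ using fun j => SkewPoly.exists_mem_comp_of_isNormal hq (h0 j) (hn j) (hf j)
  exact ⟨γ, hq, hδ, hγ, hr⟩

variable (hs : IsColorRegular f δ γ)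

include hs

theorem aug_gen (j : Fin c) : aug q (f j) = 0 :=
  aug_of_mem_homog (hs.pos j) (Submodule.span_mono
    (by rintro _ ⟨l, hl, -, rfl⟩; exact ⟨l, hl, rfl⟩) (hs.mem j))

theorem good : (polyData q).Good := SkewPoly.good_polyData hs.skew

theorem good' : (colorData f).Good := SkewQuot.good_colorData hs.skew hs.mem

theorem mk_aut (g : ColorGroup q) (r : SkewPoly q) :
    SkewQuot.mk f ((polyData q).aut g r) = (colorData f).aut g (SkewQuot.mk f r) :=
  (SkewQuot.colorAct_mk hs.skew hs.mem g r).symm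

variable {ι : Type t} [Fintype ι] [LinearOrder ι]

/-- Reduction modulo the ideal generated by the sequence. -/
def proj (V : Vars (ColorGroup q) ι) : SemiFree (polyData q) V →+* SemiFree (colorData f) V :=
  SemiFree.map (SkewQuot.mk f) rfl hs.mk_aut V

variable {V : Vars (ColorGroup q) ι} {z : ι → SemiFree (polyData q) V}

theorem proj_eq_zero {a : SemiFree (polyData q) V} :
    hs.proj V a = 0 ↔ a ∈ SemiFree.seqCoef f V c := by
  refine SemiFree.map_eq_zero_iff _ _ _ fun r => ?_
  rw [SkewQuot.mk_eq_zero, seqIdeal_last]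

theorem proj_d (a : SemiFree (polyData q) V) :
    hs.proj V (SemiFree.d z a) = SemiFree.d (fun v => hs.proj V (z v)) (hs.proj V a) :=
  SemiFree.map_d _ _ _ a

theorem proj_smul (r : SkewPoly q) (a : SemiFree (polyData q) V) :
    hs.proj V (r • a) = SkewQuot.mk f r • hs.proj V a := SemiFree.map_smul' _ _ _ r a

theorem cf_proj (I : Mon V) (a : SemiFree (polyData q) V) :
    SemiFree.cf (colorData f) I (hs.proj V a) = SkewQuot.mk f (SemiFree.cf (polyData q) I a) :=
  SemiFree.cf_map _ _ _ I a

theorem proj_mem_comp {h e : ℕ} {g : ColorGroup q} {a : SemiFree (polyData q) V}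
    (ha : a ∈ SemiFree.comp (polyData q) V h e g) :
    hs.proj V a ∈ SemiFree.comp (colorData f) V h e g :=
  SemiFree.map_mem_comp _ _ _ (fun _ _ _ hr => Submodule.mem_map_of_mem hr) ha

theorem isDiff_proj (hz : SemiFree.IsDiff (polyData q) V z) :
    SemiFree.IsDiff (colorData f) V fun v => hs.proj V (z v) := fun v => by
  obtain ⟨h, hh, hv⟩ := hz v
  exact ⟨h, hh, hs.proj_mem_comp hv⟩

theorem exists_proj_eq {S : Set ι} {a : SemiFree (colorData f) V}
    (ha : a ∈ SemiFree.sub (colorData f) V S) :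
    ∃ b ∈ SemiFree.sub (polyData q) V S, hs.proj V b = a :=
  SemiFree.exists_map_eq _ _ _ SkewQuot.mk_surjective ha

theorem proj_mem_sub {S : Set ι} {a : SemiFree (polyData q) V}
    (ha : a ∈ SemiFree.sub (polyData q) V S) :
    hs.proj V a ∈ SemiFree.sub (colorData f) V S :=
  SemiFree.map_mem_supp _ _ _ ha

end IsColorRegular

/-! ### Generators of homology modules -/

namespace SemiFree

section

set_option linter.unusedSectionVars false

variable {k : Type u} [Field k] {G : Type v} [CommGroup G] {R : Type w} [Ring R] [Algebra k R]
variable {ι : Type t} [Fintype ι] [LinearOrder ι]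
variable {C : ColorData k G R} {V : Vars G ι} {z : ι → SemiFree C V} {c : ℕ}

theorem generatesHomology_of {S : Set ι} {m : ℕ} {κ : Type*} [Fintype κ] {b : κ → SemiFree C V}
    (hb : ∀ j, b j ∈ cycles z S m)
    (h : ∀ x ∈ cycles z S m, ∃ y ∈ part C V S (m + 1), ∃ r : κ → R,
      x = d z y + ∑ j, r j • b j) : GeneratesHomology z S m b := by
  refine ⟨hb, eq_top_iff.mpr ?_⟩
  rintro x -
  obtain ⟨⟨x, hx⟩, rfl⟩ := Submodule.Quotient.mk_surjective _ x
  obtain ⟨y, hy, r, hxy⟩ := h x hx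
  have e : (Submodule.Quotient.mk ⟨x, hx⟩ : Homology z S m) =
      ∑ j, r j • Submodule.Quotient.mk ⟨b j, hb j⟩ := by
    have : ∑ j, r j • (Submodule.Quotient.mk ⟨b j, hb j⟩ : Homology z S m) =
        Submodule.Quotient.mk (∑ j, r j • ⟨b j, hb j⟩) := by
      rw [← Submodule.mkQ_apply, map_sum]
      exact Finset.sum_congr rfl fun j _ => by rw [map_smul]; rfl
    rw [this, Submodule.Quotient.eq]
    have e2 : ((⟨x, hx⟩ - ∑ j, r j • ⟨b j, hb j⟩ : cycles z S m) : SemiFree C V) =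
        x - ∑ j, r j • b j := by simp
    refine ⟨y, hy, Eq.trans ?_ e2.symm⟩
    rw [hxy, add_sub_cancel_right]
  rw [e]
  exact Submodule.sum_mem _ fun j _ => Submodule.smul_mem _ _ (Submodule.subset_span ⟨j, rfl⟩)

theorem GeneratesHomology.exists_eq {S : Set ι} {m : ℕ} {κ : Type*} [Fintype κ]
    {b : κ → SemiFree C V} (h : GeneratesHomology z S m b) {x : SemiFree C V}
    (hx : x ∈ cycles z S m) : ∃ y ∈ part C V S (m + 1), ∃ r : κ → R,
      x = d z y + ∑ j, r j • b j := by
  obtain ⟨hb, h⟩ := h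
  have h1 : (Submodule.Quotient.mk ⟨x, hx⟩ : Homology z S m) ∈
      Submodule.span R (Set.range fun j => (Submodule.Quotient.mk ⟨b j, hb j⟩ : Homology z S m)) := by
    rw [h]; trivial
  obtain ⟨r, hr⟩ := (Submodule.mem_span_range_iff_exists_fun R).mp h1
  have : ∑ j, r j • (Submodule.Quotient.mk ⟨b j, hb j⟩ : Homology z S m) =
      Submodule.Quotient.mk (∑ j, r j • ⟨b j, hb j⟩) := by
    rw [← Submodule.mkQ_apply, map_sum]
    exact Finset.sum_congr rfl fun j _ => by rw [map_smul]; rfl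
  rw [this, eq_comm, Submodule.Quotient.eq] at hr
  obtain ⟨y, hy, hxy⟩ := hr
  refine ⟨y, hy, r, ?_⟩
  have e2 : ((⟨x, hx⟩ - ∑ j, r j • ⟨b j, hb j⟩ : cycles z S m) : SemiFree C V) =
      x - ∑ j, r j • b j := by simp
  rw [show d z y = x - ∑ j, r j • b j from Eq.trans hxy e2, sub_add_cancel]

theorem comb_single {A : Type*} [Ring A] [Algebra k A] (ζ : Fin c → A) (s : Finset (Fin c)) (r : k) :
    comb k ζ (Pi.single s r) = r • zprod ζ s := by
  rw [comb_apply, Finset.sum_eq_single s, Pi.single_eq_same]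
  · intro t _ ht; rw [Pi.single_eq_of_ne ht, zero_smul]
  · simp

theorem zprod_singleton {A : Type*} [Ring A] [Algebra k A] (ζ : Fin c → A) (j : Fin c) :
    zprod ζ {j} = ζ j := by simp [zprod]

theorem zprod_mem_part {S : Set ι} {ζ : Fin c → SemiFree C V} (hζ : ∀ j, ζ j ∈ part C V S 1)
    (s : Finset (Fin c)) : zprod ζ s ∈ part C V S s.card := by
  rw [← Finset.length_sort (· ≥ ·) (s := s), zprod]
  induction s.sort (· ≥ ·) with
  | nil => exact one_mem_part S
  | cons j l ih =>
    rw [List.map_cons, List.prod_cons, List.length_cons, add_comm]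
    exact mul_mem_part (hζ j) ih

theorem hproj_field_smul (m : ℕ) (r : k) (a : SemiFree C V) :
    hproj C V m (r • a) = r • hproj C V m a := by
  rw [← smul_one_smul R r a, map_smul, smul_one_smul]

/-- The product over `s` has homological degree `s.card`, so only singletons contribute. -/
theorem hproj_one_comb {S : Set ι} {ζ : Fin c → SemiFree C V} (hζ : ∀ j, ζ j ∈ part C V S 1)
    (α : Finset (Fin c) → k) : hproj C V 1 (comb k ζ α) = ∑ j, α {j} • ζ j := by
  rw [comb_apply, map_sum]
  simp_rw [hproj_field_smul, fun s => hproj_of_mem_part (zprod_mem_part hζ s), smul_ite, smul_zero]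
  rw [← Finset.sum_filter]
  symm
  refine Finset.sum_bij (fun j _ => {j}) ?_ ?_ ?_ ?_
  · intro j _; simp
  · intro i _ j _ h; exact Finset.singleton_injective h
  · intro s hs
    obtain ⟨j, rfl⟩ := Finset.card_eq_one.mp (Finset.mem_filter.mp hs).2
    exact ⟨j, Finset.mem_univ _, rfl⟩
  · intro j _; rw [zprod_singleton (k := k)]

theorem comb_sum_single {A : Type*} [Ring A] [Algebra k A] (ζ : Fin c → A) (β : Fin c → k) :
    comb k ζ (∑ j, Pi.single {j} (β j)) = ∑ j, β j • ζ j := by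
  rw [map_sum]
  exact Finset.sum_congr rfl fun j _ => by rw [comb_single, zprod_singleton (k := k)]

end

/-- The variables `y_{e(i)}` with `∂(y_{e(i)}) = x_i` form a Koszul complex inside `Q⟨Y⟩`. -/
structure IsKoszulPart {k : Type u} [Field k] {n : ℕ} {q : Fin n → Fin n → kˣ}
    {ι : Type t} [Fintype ι] [LinearOrder ι] {V : Vars (ColorGroup q) ι}
    (z : ι → SemiFree (polyData q) V) (e : Fin n → ι) : Prop where
  isDiff : IsDiff (polyData q) V z
  strictMono : StrictMono e
  hdeg : ∀ i, V.hdeg (e i) = 1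
  z_eq : ∀ i, z (e i) = SkewPoly.x q i • 1
  aug_eq : ∀ v, aug q (cf (polyData q) (Mon.one V) (z v)) = 0

end SemiFree

namespace IsColorRegular

open SemiFree

variable {k : Type u} [Field k] {n c : ℕ} {q : Fin n → Fin n → kˣ} {f : Fin c → SkewPoly q}
  {δ : Fin c → ℕ} {γ : Fin c → ColorGroup q}
variable (hs : IsColorRegular f δ γ)
variable {ι : Type t} [Fintype ι] [LinearOrder ι]
variable {V : Vars (ColorGroup q) ι} {z : ι → SemiFree (polyData q) V} {e : Fin n → ι}
  (hz : IsKoszulPart z e) {a : Fin n → Fin c → SkewPoly q}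
  (ha : ∀ j, f j = ∑ i, a i j * SkewPoly.x q i)

/-- The element `∑_i ā_{ij} y_{e(i)}`. -/
def cyc (f : Fin c → SkewPoly q) (V : Vars (ColorGroup q) ι) (e : Fin n → ι)
    (a : Fin n → Fin c → SkewPoly q) (j : Fin c) : SemiFree (colorData f) V :=
  linComb (colorData f) V e fun i => SkewQuot.mk f (a i j)

theorem proj_linComb (j : Fin c) :
    hs.proj V (linComb (polyData q) V e fun i => a i j) = cyc f V e a j :=
  map_linComb _ _ _ e _

theorem proj_comb (ζ : Fin c → SemiFree (polyData q) V) (α : Finset (Fin c) → k) :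
    hs.proj V (comb k ζ α) = comb k (fun j => hs.proj V (ζ j)) α := map_comb _ _ _ ζ α

/-- The differential of `R⟨Y⟩` induced by that of `Q⟨Y⟩`. -/
abbrev dR (z : ι → SemiFree (polyData q) V) :
    SemiFree (colorData f) V →ₗ[SkewQuot f] SemiFree (colorData f) V :=
  d fun v => hs.proj V (z v)

include hs hz ha

theorem d_lift (j : Fin c) : d z (linComb (polyData q) V e fun i => a i j) = f j • 1 := by
  rw [d_linComb hs.good hz.isDiff hz.z_eq, ← ha]

omit hs ha in
theorem cyc_mem_part (j : Fin c) : cyc f V e a j ∈ part (colorData f) V (Set.range e) 1 :=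
  linComb_mem_part hz.hdeg _

theorem dR_cyc (j : Fin c) : hs.dR z (cyc f V e a j) = 0 := by
  rw [← hs.proj_linComb, ← hs.proj_d, hs.d_lift hz ha, hs.proj_eq_zero]
  exact gen_smul_mem_seqCoef j.2 _

/-- Lift to the skew polynomial ring: the kernel of reduction consists of the elements with
coefficients in the ideal of all `f_j`, so this is the generating half of `koszul_homology` for the
whole sequence. -/
theorem exists_eq_dR_add_comb {x : SemiFree (colorData f) V}
    (hx : x ∈ sub (colorData f) V (Set.range e)) (hdx : hs.dR z x = 0) :
    ∃ b ∈ sub (colorData f) V (Set.range e), ∃ α : Finset (Fin c) → k,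
      x = hs.dR z b + comb k (cyc f V e a) α := by
  obtain ⟨y, hy, rfl⟩ := hs.exists_proj_eq hx
  rw [← hs.proj_d, hs.proj_eq_zero] at hdx
  obtain ⟨b, hb, α, -, u, hu, h⟩ := (koszul_homology hs.skew hs.mem hs.regular hz.isDiff hs.aug_gen
    hz.aug_eq hz.strictMono hz.hdeg hz.z_eq
    (ζ := fun j => linComb (polyData q) V e fun i => a i j)
    (fun j => part_le_sub _ 1 (linComb_mem_part hz.hdeg _)) (fun j => inv_linComb hz.hdeg _)
    (hs.d_lift hz ha) c le_rfl).1 y hy hdx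
  refine ⟨hs.proj V b, hs.proj_mem_sub hb, α, ?_⟩
  rw [h, map_add, map_add, hs.proj_eq_zero.mpr hu, add_zero, hs.proj_d, hs.proj_comb]
  simp_rw [hs.proj_linComb]

theorem eq_zero_of_comb_eq_dR {α : Finset (Fin c) → k} {b : SemiFree (colorData f) V}
    (hb : b ∈ sub (colorData f) V (Set.range e))
    (h : comb k (cyc f V e a) α = hs.dR z b) : α = 0 := by
  obtain ⟨y, hy, rfl⟩ := hs.exists_proj_eq hb
  refine (koszul_homology hs.skew hs.mem hs.regular hz.isDiff hs.aug_gen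
    hz.aug_eq hz.strictMono hz.hdeg hz.z_eq
    (ζ := fun j => linComb (polyData q) V e fun i => a i j)
    (fun j => part_le_sub _ 1 (linComb_mem_part hz.hdeg _)) (fun j => inv_linComb hz.hdeg _)
    (hs.d_lift hz ha) c le_rfl).2 α (below_last α) y hy ?_
  rw [← hs.proj_eq_zero, map_sub, hs.proj_comb, hs.proj_d, ← h]
  simp_rw [hs.proj_linComb]
  rw [sub_self]

theorem exists_eq_dR_add_sum {x : SemiFree (colorData f) V}
    (hx : x ∈ part (colorData f) V (Set.range e) 1) (hdx : hs.dR z x = 0) :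
    ∃ b ∈ part (colorData f) V (Set.range e) 2, ∃ β : Fin c → k,
      x = hs.dR z b + ∑ j, β j • cyc f V e a j := by
  obtain ⟨b, hb, α, h⟩ := hs.exists_eq_dR_add_comb hz ha (part_le_sub _ _ hx) hdx
  refine ⟨hproj _ _ 2 b, hproj_mem_part hb 2, fun j => α {j}, ?_⟩
  have := congrArg (hproj (colorData f) V 1) h
  rwa [hproj_of_mem_part hx, if_pos rfl, map_add, hproj_d hs.good' (hs.isDiff_proj hz.isDiff),
    hproj_one_comb (cyc_mem_part hz)] at this

omit ha in
-- For a cycle `x` the boundary of `y_j x` is `x̄_j x`, so the variables of the ring annihilate the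
-- homology.
theorem exists_dR_eq_smul {x : SemiFree (colorData f) V}
    (hx : x ∈ sub (colorData f) V (Set.range e)) (hdx : hs.dR z x = 0) {r : SkewPoly q}
    (hr : r ∈ Submodule.span (SkewPoly q) (Set.range (SkewPoly.x q))) :
    ∃ b ∈ sub (colorData f) V (Set.range e), hs.dR z b = SkewQuot.mk f r • x := by
  induction hr using Submodule.closure_induction with
  | zero => exact ⟨0, zero_mem _, by simp⟩
  | add r s _ _ hr hs' =>
    obtain ⟨a, ha, hr⟩ := hr
    obtain ⟨b, hb, hs'⟩ := hs'
    exact ⟨a + b, add_mem ha hb, by rw [map_add, hr, hs', map_add, add_smul]⟩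
  | smul_mem r _ h =>
    obtain ⟨j, rfl⟩ := h
    refine ⟨SkewQuot.mk f r • (var (colorData f) V (e j) * x), Submodule.smul_mem _ _
      (mul_mem_sub (var_mem_sub ⟨j, rfl⟩) hx), ?_⟩
    rw [map_smul, d_mul hs.good' (hs.isDiff_proj hz.isDiff), hdx, mul_zero, add_zero,
      d_var hs.good' (hs.isDiff_proj hz.isDiff), hz.z_eq, hs.proj_smul, map_one,
      smul_mul_assoc, one_mul, smul_smul, smul_eq_mul, map_mul]

/-- As the variables annihilate the homology, each coefficient may be replaced by its augmentation.
The relation then has coefficients in `k`, and the classes are independent over `k`. This carries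
the minimality in homological degree one. -/
theorem aug_eq_zero_of_sum_eq_dR {r : Fin c → SkewPoly q} {b : SemiFree (colorData f) V}
    (hb : b ∈ sub (colorData f) V (Set.range e))
    (h : ∑ j, SkewQuot.mk f (r j) • cyc f V e a j = hs.dR z b) (j : Fin c) :
    aug q (r j) = 0 := by
  choose s hs' hrs using fun j => exists_eq_aug_add (r j)
  choose y hy hys using fun j => hs.exists_dR_eq_smul hz
    (part_le_sub _ _ (cyc_mem_part hz (a := a) j)) (hs.dR_cyc hz ha j) (hs' j)
  have h1 : comb k (cyc f V e a) (∑ j, Pi.single {j} (aug q (r j))) =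
      hs.dR z (b - ∑ j, y j) := by
    rw [comb_sum_single, map_sub, ← h, map_sum, ← Finset.sum_sub_distrib]
    refine Finset.sum_congr rfl fun j _ => ?_
    rw [hys, ← sub_smul, ← map_sub]
    nth_rewrite 2 [hrs j]
    rw [add_sub_cancel_right, AlgHom.commutes, algebraMap_smul]
  have h2 := congrFun (hs.eq_zero_of_comb_eq_dR hz ha
    (sub_mem hb (Submodule.sum_mem _ fun j _ => hy j)) h1) {j}
  rw [Finset.sum_apply, Finset.sum_eq_single j, Pi.single_eq_same] at h2
  · exact h2
  · intro i _ hij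
    exact Pi.single_eq_of_ne (fun h => hij (Finset.singleton_injective h).symm) _
  · simp

end IsColorRegular

open SemiFree

/-! ### The Koszul complex of a skew complete intersection -/

section

variable {k : Type u} [Field k] {n c : ℕ} {q : Fin n → Fin n → kˣ}

theorem SkewPoly.x_mem_comp (i : Fin n) : SkewPoly.x q i ∈ SkewPoly.comp q 1 (rowColor q i) :=
  Submodule.subset_span ⟨[i], by simp⟩

/-- The differentials of the variables of the Koszul complex of the skew polynomial ring. -/
def polyKoszulZ (q : Fin n → Fin n → kˣ) (i : Fin n) : SemiFree (polyData q) (koszulVars q) :=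
  SkewPoly.x q i • 1

theorem isKoszulPart_polyKoszulZ (hq : IsSkewMatrix q) :
    IsKoszulPart (polyKoszulZ q) (id : Fin n → Fin n) where
  isDiff i := ⟨0, rfl, smul_one_mem_comp (SkewPoly.good_polyData hq) (SkewPoly.x_mem_comp i)⟩
  strictMono := strictMono_id
  hdeg _ := rfl
  z_eq _ := rfl
  aug_eq i := by
    rw [polyKoszulZ, map_smul, cf_one_one, smul_eq_mul, mul_one, aug_x]

namespace IsColorRegular

variable {f : Fin c → SkewPoly q} {δ : Fin c → ℕ} {γ : Fin c → ColorGroup q}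
variable (hs : IsColorRegular f δ γ)

include hs

theorem koszulZ_eq : (fun i => hs.proj (koszulVars q) (polyKoszulZ q i)) = koszulZ f :=
  funext fun i => by
    rw [polyKoszulZ, hs.proj_smul, map_one, koszulZ, incl_eq]; rfl

theorem dR_koszul : hs.dR (polyKoszulZ q) = d (koszulZ f) := by rw [dR, hs.koszulZ_eq]

theorem isDiff_koszulZ : IsDiff (colorData f) (koszulVars q) (koszulZ f) := by
  rw [← hs.koszulZ_eq]
  exact hs.isDiff_proj (isKoszulPart_polyKoszulZ hs.skew).isDiff

theorem koszul_isColorDGA : IsColorDGA (bichar q) (comp (colorData f) (koszulVars q))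
    ((d (koszulZ f)).restrictScalars k) :=
  isColorDGA hs.good' hs.isDiff_koszulZ fun i => by rw [koszulZ, incl_eq, d_smul_one]

omit hs in
theorem cyc_id (a : Fin n → Fin c → SkewPoly q) :
    cyc f (koszulVars q) id a = koszulCycle f a := rfl

theorem koszulCycle_mem_comp {a : Fin n → Fin c → SkewPoly q} {j : Fin c}
    (ha : ∀ i, a i j ∈ SkewPoly.comp q (δ j - 1) (γ j * (rowColor q i)⁻¹)) :
    koszulCycle f a j ∈ comp (colorData f) (koszulVars q) 1 (δ j) (γ j) := by
  have := linComb_mem_comp (V := koszulVars q) (e := id) (g := γ j) (d := δ j - 1)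
    (a := fun i => SkewQuot.mk f (a i j)) hs.good' (fun _ => rfl) (fun _ => rfl)
    (fun i => Submodule.mem_map_of_mem (ha i))
  rwa [Nat.sub_add_cancel (hs.pos j)] at this

theorem exists_homogeneous : ∃ a : Fin n → Fin c → SkewPoly q,
    (∀ j, f j = ∑ i, a i j * SkewPoly.x q i) ∧
    ∀ i j, a i j ∈ SkewPoly.comp q (δ j - 1) (γ j * (rowColor q i)⁻¹) := by
  choose a ha h using fun j => SkewPoly.exists_eq_sum_mul_x (q := q) (d := δ j - 1) (g := γ j)
    (f := f j) (by rw [Nat.sub_add_cancel (hs.pos j)]; exact hs.mem j)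
  exact ⟨fun i j => a j i, h, fun i j => ha j i⟩

variable {a : Fin n → Fin c → SkewPoly q} (ha : ∀ j, f j = ∑ i, a i j * SkewPoly.x q i)

include ha

theorem d_koszulCycle (j : Fin c) : d (koszulZ f) (koszulCycle f a j) = 0 := by
  rw [← hs.dR_koszul]
  exact hs.dR_cyc (isKoszulPart_polyKoszulZ hs.skew) ha j

theorem koszulCycle_mem_cycles (j : Fin c) :
    koszulCycle f a j ∈ cycles (koszulZ f) Set.univ 1 := by
  refine ⟨?_, hs.d_koszulCycle ha j⟩
  have := cyc_mem_part (f := f) (a := a) (isKoszulPart_polyKoszulZ hs.skew) j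
  rwa [Set.range_id] at this

theorem generatesHomology_koszulCycle :
    GeneratesHomology (koszulZ f) Set.univ 1 (koszulCycle f a) := by
  refine generatesHomology_of (hs.koszulCycle_mem_cycles ha) fun x hx => ?_
  have h1 : x ∈ part (colorData f) (koszulVars q) (Set.range id) 1 := by
    rw [Set.range_id]; exact hx.1
  have h2 : d (koszulZ f) x = 0 := hx.2
  rw [← hs.dR_koszul] at h2
  obtain ⟨b, hb, β, h⟩ := hs.exists_eq_dR_add_sum (isKoszulPart_polyKoszulZ hs.skew) ha h1 h2
  rw [Set.range_id] at hb
  refine ⟨b, hb, fun j => algebraMap k _ (β j), ?_⟩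
  simp_rw [algebraMap_smul]
  rw [← hs.dR_koszul]
  exact h

/-- Over the skew polynomial ring both lifts have boundary `f_j`, so their difference is a cycle of
degree one. It is a boundary by exactness there, and this survives reduction. -/
theorem exists_koszulCycle_eq {a' : Fin n → Fin c → SkewPoly q}
    (ha' : ∀ j, f j = ∑ i, a' i j * SkewPoly.x q i) (j : Fin c) :
    ∃ y, koszulCycle f a j = koszulCycle f a' j + d (koszulZ f) y := by
  have hz := isKoszulPart_polyKoszulZ hs.skew
  set D := linComb (polyData q) (koszulVars q) id (fun i => a i j) -
    linComb (polyData q) (koszulVars q) id (fun i => a' i j) with hD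
  have hD1 : D ∈ part (polyData q) (koszulVars q) (Set.range id) 1 :=
    sub_mem (linComb_mem_part hz.hdeg _) (linComb_mem_part hz.hdeg _)
  have hD2 : d (polyKoszulZ q) D = 0 := by
    rw [hD, map_sub, hs.d_lift hz ha, hs.d_lift hz ha', sub_self]
  obtain ⟨b, -, α, hb⟩ := koszul_exact hs.skew hz.isDiff hz.strictMono hz.hdeg hz.z_eq
    (part_le_sub _ _ hD1) hD2
  have h := congrArg (hproj (polyData q) (koszulVars q) 1) hb
  rw [hproj_of_mem_part hD1, if_pos rfl, map_add, hproj_d hs.good hz.isDiff, hproj_field_smul,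
    hproj_of_mem_part (one_mem_part Set.univ), if_neg zero_ne_one, smul_zero, add_zero] at h
  refine ⟨hs.proj _ (hproj (polyData q) (koszulVars q) (1 + 1) b), ?_⟩
  rw [← hs.dR_koszul, ← hs.proj_d, ← h, hD, map_sub, hs.proj_linComb, hs.proj_linComb, cyc_id,
    cyc_id, add_sub_cancel]

end IsColorRegular

end

open SemiFree

/-! ### Homology classes -/

namespace SemiFree

section

set_option linter.unusedSectionVars false

variable {k : Type u} [Field k] {G : Type v} [CommGroup G] {R : Type w} [Ring R] [Algebra k R]
variable {ι : Type t} [Fintype ι] [LinearOrder ι]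
variable {C : ColorData k G R} {V : Vars G ι} {z : ι → SemiFree C V} {c : ℕ}

theorem d_inv (H : C.Good) (hz : IsDiff C V z) (a : SemiFree C V) :
    d z (inv C V a) = -inv C V (d z a) := by
  induction a using SemiFree.induction with
  | zero => simp
  | add a a' h h' => simp only [map_add, h, h', neg_add]
  | term I r =>
    have hd : ∀ s : k, d z (s • term C I r) = s • d z (term C I r) := fun s => by
      rw [← smul_one_smul R s, map_smul, smul_one_smul]
    have hmem := hproj_mem_part (mem_sub_univ (term C I r)) I.hdeg
    rw [hproj_term, if_pos rfl] at hmem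
    rw [inv_of_mem_part hmem, hd]
    rcases Nat.eq_zero_or_pos I.hdeg with h0 | h0
    · have hI : I = Mon.one V := Mon.ext (funext fun v => by
        obtain ⟨h, hh, -⟩ := hz v
        have := (Finset.sum_eq_zero_iff.mp h0) v (Finset.mem_univ v)
        exact (Nat.mul_eq_zero.mp this).resolve_right (by omega))
      rw [hI, term_eq_smul, ← one_def, d_smul_one, map_zero, smul_zero, neg_zero]
    · obtain ⟨m, hm⟩ : ∃ m, I.hdeg = m + 1 := ⟨I.hdeg - 1, by omega⟩
      rw [hm] at hmem ⊢
      have h2 : d z (term C I r) ∈ part C V Set.univ m :=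
        d_mem_part H hz (fun v _ => by
          obtain ⟨h, hh, hv⟩ := hz v
          exact ⟨h, hh, mem_part_of_mem_comp hv⟩) hmem
      rw [inv_of_mem_part h2, pow_succ, mul_neg_one, neg_smul]

theorem mul_d_of_d_eq_zero (H : C.Good) (hz : IsDiff C V z) {a : SemiFree C V} (ha : d z a = 0)
    (b : SemiFree C V) : a * d z b = d z (inv C V a * b) := by
  rw [d_mul H hz, d_inv H hz, ha, map_zero, neg_zero, zero_mul, zero_add, inv_inv]

/-- Two cycles have the same class if and only if they differ by a boundary. -/
theorem cls_eq_iff (H : C.Good) (hz : IsDiff C V z)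
    (K : IsColorDGA C.χ (comp C V) ((d z).restrictScalars k)) (a b : K.cycleAlg) :
    K.cls a = K.cls b ↔ ∃ y, (a : SemiFree C V) = b + d z y := by
  constructor
  -- The homology algebra is the quotient by the congruence generated by the relation. Differing by
  -- a boundary is a congruence already, so a map to its quotient detects equality of classes.
  · let S : RingCon K.cycleAlg :=
      { r := fun a b => ∃ y, (a : SemiFree C V) = b + d z y
        iseqv := ⟨fun a => ⟨0, by simp⟩,
          fun {a b} ⟨y, h⟩ => ⟨-y, by rw [h, map_neg, add_neg_cancel_right]⟩,
          fun {a b c} ⟨y, h⟩ ⟨y', h'⟩ => ⟨y' + y, by rw [h, h', map_add, add_assoc]⟩⟩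
        add' := fun {a b a' b'} ⟨y, h⟩ ⟨y', h'⟩ => ⟨y + y', by
          rw [Subalgebra.coe_add, Subalgebra.coe_add, h, h', map_add]; abel⟩
        mul' := fun {a b a' b'} ⟨y, h⟩ ⟨y', h'⟩ => ⟨inv C V (b : SemiFree C V) * y' +
            y * (a' : SemiFree C V), by
          have ha' : d z (a' : SemiFree C V) = 0 := a'.2
          have hb : d z (b : SemiFree C V) = 0 := b.2
          rw [Subalgebra.coe_mul, Subalgebra.coe_mul, map_add, ← mul_d_of_d_eq_zero H hz hb,
            d_mul H hz y, ha', mul_zero, add_zero, h, add_mul, ← add_assoc, ← mul_add, ← h']⟩ }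
    let π : K.cycleAlg →ₐ[k] S.Quotient :=
      { S.mk' with commutes' := fun _ => rfl }
    let Φ : K.HomologyAlg →ₐ[k] S.Quotient :=
      RingQuot.liftAlgHom k ⟨π, fun a b h => (RingCon.eq S).mpr h⟩
    have hΦ : ∀ a, Φ (K.cls a) = π a := fun a => RingQuot.liftAlgHom_mkAlgHom_apply ..
    intro h
    have := congrArg Φ h
    rw [hΦ, hΦ] at this
    exact (RingCon.eq S).mp this
  · rintro ⟨y, h⟩
    exact RingQuot.mkAlgHom_rel k ⟨y, h⟩

theorem map_comb_algHom {A B : Type*} [Ring A] [Algebra k A] [Ring B] [Algebra k B]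
    (φ : A →ₐ[k] B) (ζ : Fin c → A) (α : Finset (Fin c) → k) :
    φ (comb k ζ α) = comb k (fun j => φ (ζ j)) α := by
  rw [comb_apply, comb_apply, map_sum]
  refine Finset.sum_congr rfl fun s _ => ?_
  rw [map_smul, zprod, map_list_prod, List.map_map]
  rfl

end

end SemiFree

/-! ### Skew exterior algebras -/

section Exterior

variable {k : Type u} [Field k] {c : ℕ} {p : Fin c → Fin c → kˣ}

/-- A word with a repeated letter can be permuted, up to a unit, to begin with a square, so it
vanishes. Any other word is a unit multiple of the decreasing product over its letters. -/
theorem exists_eq_comb (a : SkewExterior p) :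
    ∃ α : Finset (Fin c) → k,
      a = comb k (SkewQuot.x fun i : Fin c => SkewPoly.x p i ^ 2) α := by
  suffices a ∈ LinearMap.range (comb k (SkewQuot.x fun i : Fin c => SkewPoly.x p i ^ 2)) by
    obtain ⟨α, h⟩ := this
    exact ⟨α, h.symm⟩
  obtain ⟨a, rfl⟩ := SkewQuot.mk_surjective a
  induction a using SkewPoly.induction with
  | zero => rw [map_zero]; exact zero_mem _
  | add a b ha hb => rw [map_add]; exact add_mem ha hb
  | word r l =>
    rw [map_smul]
    refine Submodule.smul_mem _ _ ?_
    by_cases hl : l.Nodup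
    · obtain ⟨r, hr⟩ := SkewPoly.word_perm (q := p) (l := l) (l' := l.toFinset.sort (· ≥ ·)) (by
        rw [List.perm_ext_iff_of_nodup hl (Finset.sort_nodup _ _)]
        simp)
      rw [hr, map_smul]
      refine Submodule.smul_mem _ _ ⟨Pi.single l.toFinset 1, ?_⟩
      rw [comb_single, one_smul, SkewPoly.word, map_list_prod, List.map_map]
      rfl
    · obtain ⟨j, hj⟩ := List.exists_duplicate_iff_not_nodup.mpr hl
      obtain ⟨l', hl'⟩ := (List.duplicate_iff_sublist.mp hj).exists_perm_append
      obtain ⟨r, hr⟩ := SkewPoly.word_perm (q := p) hl'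
      have : SkewQuot.mk (fun i : Fin c => SkewPoly.x p i ^ 2) (SkewPoly.word p [j, j]) = 0 := by
        rw [SkewPoly.word_cons, SkewPoly.word_singleton, ← sq]
        exact SkewQuot.mk_gen j
      rw [hr, SkewPoly.word_append, map_smul, map_mul, this, zero_mul, smul_zero]
      exact zero_mem _

end Exterior

namespace IsColorRegular

variable {k : Type u} [Field k] {n c : ℕ} {q : Fin n → Fin n → kˣ} {f : Fin c → SkewPoly q}
  {δ : Fin c → ℕ} {γ : Fin c → ColorGroup q}
variable (hs : IsColorRegular f δ γ)

/-- The matrix of the skew exterior algebra. -/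
def homologyMatrix (γ : Fin c → ColorGroup q) (i j : Fin c) : kˣ :=
  if i = j then 1 else -bichar q (γ i) (γ j)

omit hs in
-- The diagonal is set to one separately: the general formula would give `-χ(γ_i, γ_i) = -1`. As the
-- squares vanish, either value satisfies the relation.
theorem isSkewMatrix_homologyMatrix (hq : IsSkewMatrix q) : IsSkewMatrix (homologyMatrix γ) where
  diag i := if_pos rfl
  anti i j := by
    unfold homologyMatrix
    by_cases h : i = j
    · rw [if_pos h, if_pos h.symm, mul_one]
    · rw [if_neg h, if_neg (Ne.symm h), neg_mul_neg, (isSkewBichar_bichar hq).antisymm (γ i),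
        inv_mul_cancel]

include hs

/-- The classes satisfy the defining relations, so there is a map. The ordered squarefree products
span the source and go to a basis of the homology, hence the map is bijective; no basis of the skew
exterior algebra has to be known beforehand. -/
theorem exists_homology_equiv {a : Fin n → Fin c → SkewPoly q}
    (ha : ∀ j, f j = ∑ i, a i j * SkewPoly.x q i)
    (K : IsColorDGA (bichar q) (comp (colorData f) (koszulVars q))
      ((d (koszulZ f)).restrictScalars k)) :
    ∃ φ : SkewExterior (homologyMatrix γ) ≃ₐ[k] K.HomologyAlg,
      ∀ j, ∃ hz : koszulCycle f a j ∈ K.cycleAlg,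
        φ (SkewQuot.x _ j) = K.cls ⟨koszulCycle f a j, hz⟩ := by
  have hcls := cls_eq_iff hs.good' hs.isDiff_koszulZ K
  let Z (j : Fin c) : K.cycleAlg := ⟨koszulCycle f a j, hs.d_koszulCycle ha j⟩
  obtain ⟨a₀, ha₀, hom⟩ := hs.exists_homogeneous
  let Z₀ (j : Fin c) : K.cycleAlg := ⟨koszulCycle f a₀ j, hs.d_koszulCycle ha₀ j⟩
  -- The given cycles may be inhomogeneous. The relations are checked on homogeneous representatives
  -- of the same classes.
  have hZ : ∀ j, K.cls (Z j) = K.cls (Z₀ j) := fun j =>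
    (hcls _ _).mpr (hs.exists_koszulCycle_eq ha ha₀ j)
  have hsq : ∀ j, K.cls (Z j) * K.cls (Z j) = 0 := fun j => by
    rw [hZ, ← map_mul]
    have : Z₀ j * Z₀ j = 0 := Subtype.ext
      (K.sq_zero odd_one (hs.koszulCycle_mem_comp fun i => hom i j))
    rw [this, map_zero]
  have hcomm : ∀ i j, K.cls (Z i) * K.cls (Z j) =
      (homologyMatrix γ i j : k) • (K.cls (Z j) * K.cls (Z i)) := fun i j => by
    unfold homologyMatrix
    split_ifs with h
    · subst h; rw [Units.val_one, one_smul]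
    · rw [hZ, hZ, ← map_mul, ← map_mul, ← map_smul]
      congr 1
      refine Subtype.ext ?_
      have := K.color_comm (hs.koszulCycle_mem_comp fun l => hom l i)
        (hs.koszulCycle_mem_comp fun l => hom l j)
      rw [mul_one, pow_one, neg_one_mul] at this
      exact this
  let φ : SkewExterior (homologyMatrix γ) →ₐ[k] K.HomologyAlg :=
    SkewQuot.lift (SkewPoly.lift (fun j => K.cls (Z j)) hcomm) fun j => by
      rw [map_pow, SkewPoly.lift_x, sq, hsq]
  have hφ : ∀ j, φ (SkewQuot.x _ j) = K.cls (Z j) := fun j => SkewPoly.lift_x _ _ j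
  have hφc : ∀ α, φ (comb k (SkewQuot.x _) α) = K.cls (comb k Z α) := fun α => by
    rw [map_comb_algHom, map_comb_algHom]
    simp_rw [hφ]
  have hcomb : ∀ α, ((comb k Z α : K.cycleAlg) : Koszul f) =
      comb k (cyc f (koszulVars q) id a) α := fun α => map_comb_algHom K.cycleAlg.val Z α
  have hK := isKoszulPart_polyKoszulZ hs.skew
  have bij : Function.Bijective φ := by
    constructor
    · rw [injective_iff_map_eq_zero]
      intro x hx
      obtain ⟨α, rfl⟩ := exists_eq_comb x
      rw [hφc, ← map_zero K.cls] at hx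
      obtain ⟨y, hy⟩ := (hcls _ _).mp hx
      have : α = 0 := hs.eq_zero_of_comb_eq_dR hK ha (b := y)
        (by rw [Set.range_id]; exact mem_sub_univ y) (by
          rw [hs.dR_koszul, ← hcomb, hy, Subalgebra.coe_zero, zero_add])
      rw [this, map_zero]
    · intro x
      obtain ⟨x, rfl⟩ : ∃ x', K.cls x' = x := RingQuot.mkAlgHom_surjective k _ x
      have hx : hs.dR (polyKoszulZ q) (x : Koszul f) = 0 := by
        rw [hs.dR_koszul]; exact x.2
      obtain ⟨b, -, α, h⟩ := hs.exists_eq_dR_add_comb hK ha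
        (by rw [Set.range_id]; exact mem_sub_univ _) hx
      refine ⟨comb k (SkewQuot.x _) α, ?_⟩
      rw [hφc, eq_comm]
      exact (hcls _ _).mpr ⟨b, by rw [hcomb, h, hs.dR_koszul, add_comm]⟩
  exact ⟨AlgEquiv.ofBijective φ bij, fun j => ⟨_, hφ j⟩⟩

end IsColorRegular

open SemiFree

/-! ### Homogeneous lifts of the coefficients -/

namespace SemiFree

section

set_option linter.unusedSectionVars false

variable {k : Type u} [Field k] {G : Type v} [CommGroup G] {R : Type w} [Ring R] [Algebra k R]
variable {ι : Type t} [Fintype ι] [LinearOrder ι]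
variable {C : ColorData k G R} {V : Vars G ι}

/-- The truncated subtraction is harmless: a nonzero coefficient of `y^{(I)}` can only come from
spanning terms whose internal degree is at least that of `I`. -/
theorem cf_mem_comp {h e : ℕ} {g : G} {a : SemiFree C V} (ha : a ∈ comp C V h e g) (I : Mon V) :
    cf C I a ∈ C.comp (e - I.ideg) (g * I.color⁻¹) := by
  induction ha using Submodule.span_induction with
  | zero => rw [map_zero]; exact zero_mem _
  | add x y _ _ hx hy => rw [map_add]; exact add_mem hx hy
  | smul c x _ hx =>
    rw [← smul_one_smul R c x, map_smul, smul_eq_mul, smul_one_mul]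
    exact Submodule.smul_mem _ _ hx
  | mem x hx =>
    obtain ⟨J, e', g', r, hr, -, rfl, rfl, rfl⟩ := hx
    rw [cf_term]
    split_ifs with h
    · subst h
      rwa [Nat.add_sub_cancel, mul_inv_cancel_right]
    · exact zero_mem _

theorem cf_var_linComb {n : ℕ} {e : Fin n → ι} (he : Function.Injective e) (a : Fin n → R)
    (i : Fin n) : cf C (Mon.var V (e i)) (linComb C V e a) = a i := by
  classical
  rw [linComb, map_sum, Finset.sum_eq_single i]
  · rw [map_smul, var, cf_term, if_pos rfl, smul_eq_mul, mul_one]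
  · intro j _ hj
    rw [map_smul, var, cf_term, if_neg, smul_zero]
    intro h
    have := congrArg (fun M => Mon.exp M (e j)) h
    simp only [Mon.var, Pi.single_eq_same] at this
    rw [Pi.single_eq_of_ne (fun h' => hj (he h'))] at this
    exact one_ne_zero this
  · simp

end

end SemiFree

namespace IsColorRegular

variable {k : Type u} [Field k] {n c : ℕ} {q : Fin n → Fin n → kˣ} {f : Fin c → SkewPoly q}
  {δ : Fin c → ℕ} {γ : Fin c → ColorGroup q}
variable (hs : IsColorRegular f δ γ)

include hs

/-- Both rings are graded and reduction respects the components, so it commutes with the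
projections. Therefore an element with homogeneous image may be replaced by its component. -/
theorem exists_component (d : ℕ) (g : ColorGroup q) : ∃ P : SkewPoly q →ₗ[k] SkewPoly q,
    (∀ r, P r ∈ SkewPoly.comp q d g) ∧ (∀ r ∈ SkewPoly.comp q d g, P r = r) ∧
    (∀ d' g', (d', g') ≠ (d, g) → ∀ r ∈ SkewPoly.comp q d' g', P r = 0) ∧
    ∀ r, SkewQuot.mk f r ∈ (colorData f).comp d g → SkewQuot.mk f (P r) = SkewQuot.mk f r := by
  obtain ⟨P, hP, hP'⟩ := hs.good.proj d g
  obtain ⟨P₁, hP₁, hP₁'⟩ := hs.good'.proj d g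
  have hcomm : ∀ r, SkewQuot.mk f (P r) = P₁ (SkewQuot.mk f r) := fun r => by
    induction r using hs.good.induction with
    | zero => simp
    | add r s hr hs => simp only [map_add, hr, hs]
    | mem d' g' r hr =>
      by_cases h : (d', g') = (d, g)
      · obtain ⟨rfl, rfl⟩ := Prod.mk.inj h
        rw [hP r hr]
        exact (hP₁ _ (Submodule.mem_map_of_mem hr)).symm
      · rw [hP' _ _ h r hr, map_zero]
        exact (hP₁' _ _ h _ (Submodule.mem_map_of_mem hr)).symm
  refine ⟨P, fun r => ?_, hP, hP', fun r hr => by rw [hcomm, hP₁ _ hr]⟩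
  induction r using hs.good.induction with
  | zero => rw [map_zero]; exact zero_mem _
  | add r s hr hs => rw [map_add]; exact add_mem hr hs
  | mem d' g' r hr =>
    by_cases h : (d', g') = (d, g)
    · obtain ⟨rfl, rfl⟩ := Prod.mk.inj h
      rw [hP r hr]; exact hr
    · rw [hP' _ _ h r hr]; exact zero_mem _

/-- If the cycles are trihomogeneous, then their colours are those of the `f_j`, and they come from
homogeneous coefficients. -/
theorem exists_homogeneous_lift (j : Fin c) {a : Fin n → SkewPoly q}
    (ha : f j = ∑ i, a i * SkewPoly.x q i) {g : ColorGroup q}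
    (hg : linComb (colorData f) (koszulVars q) id (fun i => SkewQuot.mk f (a i)) ∈
      comp (colorData f) (koszulVars q) 1 (δ j) g) :
    g = γ j ∧ ∃ a' : Fin n → SkewPoly q, f j = ∑ i, a' i * SkewPoly.x q i ∧
      (∀ i, a' i ∈ SkewPoly.comp q (δ j - 1) (g * (rowColor q i)⁻¹)) ∧
      ∀ i, SkewQuot.mk f (a' i) = SkewQuot.mk f (a i) := by
  choose P hPm hP hP' hPq using fun d g => hs.exists_component d g
  have hmem : ∀ i, SkewQuot.mk f (a i) ∈ (colorData f).comp (δ j - 1) (g * (rowColor q i)⁻¹) :=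
    fun i => by
      have := cf_mem_comp hg (Mon.var (koszulVars q) i)
      rw [varMon_ideg, varMon_color] at this
      have h2 := cf_var_linComb (C := colorData f) (V := koszulVars q) (e := (id : Fin n → Fin n))
        Function.injective_id (fun i => SkewQuot.mk f (a i)) i
      rw [id] at h2
      rwa [h2] at this
  -- Right multiplication by `x_i` shifts components; `δ j ≥ 1` ensures that `δ j - 1` is the degree
  -- one below.
  have hmul : ∀ i r, P (δ j) g (r * SkewPoly.x q i) =
      P (δ j - 1) (g * (rowColor q i)⁻¹) r * SkewPoly.x q i := fun i r => by
    induction r using hs.good.induction with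
    | zero => simp
    | add r s hr hs => rw [add_mul, map_add, hr, hs, map_add, add_mul]
    | mem d' g' r hr =>
      have hr' : r * SkewPoly.x q i ∈ SkewPoly.comp q (d' + 1) (g' * rowColor q i) :=
        hs.good.mul_mem hr (SkewPoly.x_mem_comp i)
      by_cases h : (d', g') = (δ j - 1, g * (rowColor q i)⁻¹)
      · obtain ⟨rfl, rfl⟩ := Prod.mk.inj h
        rw [Nat.sub_add_cancel (hs.pos j), inv_mul_cancel_right] at hr'
        rw [hP _ _ _ hr', hP _ _ _ hr]
      · rw [hP' _ _ _ _ h _ hr, zero_mul, hP' _ _ _ _ _ _ hr']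
        intro h'
        obtain ⟨h1, h2⟩ := Prod.mk.inj h'
        refine h (Prod.ext ?_ ?_)
        · simp only; omega
        · simp only [← h2, mul_inv_cancel_right]
  let a' (i : Fin n) : SkewPoly q := P (δ j - 1) (g * (rowColor q i)⁻¹) (a i)
  have hsum : P (δ j) g (f j) = ∑ i, a' i * SkewPoly.x q i := by
    rw [ha, map_sum]
    exact Finset.sum_congr rfl fun i _ => hmul i _
  have hmk : ∀ i, SkewQuot.mk f (a' i) = SkewQuot.mk f (a i) := fun i => hPq _ _ _ (hmem i)
  -- Otherwise the component of `f_j` of colour `g` is zero, so the components `a'` define a cycle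
  -- over the skew polynomial ring. It is a boundary by exactness, and the class of `z_j` would
  -- vanish, contrary to independence.
  have hgγ : g = γ j := by
    by_contra hne
    have h0 : ∑ i, a' i * SkewPoly.x q i = 0 := by
      rw [← hsum, hP' _ _ _ _ _ _ (hs.mem j)]
      intro h
      exact hne (Prod.mk.inj h).2.symm
    have hz := isKoszulPart_polyKoszulZ hs.skew
    have hd : d (polyKoszulZ q) (linComb (polyData q) (koszulVars q) id a') = 0 := by
      rw [d_linComb hs.good hz.isDiff hz.z_eq, h0, zero_smul]
    have hpart := linComb_mem_part (C := polyData q) (V := koszulVars q)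
      (e := (id : Fin n → Fin n)) hz.hdeg a'
    obtain ⟨b, hb, α, hbα⟩ := koszul_exact hs.skew hz.isDiff hz.strictMono hz.hdeg hz.z_eq
      (part_le_sub _ _ hpart) hd
    have h := congrArg (hproj (polyData q) (koszulVars q) 1) hbα
    rw [hproj_of_mem_part hpart, if_pos rfl, map_add, hproj_d hs.good hz.isDiff, hproj_field_smul,
      hproj_of_mem_part (one_mem_part Set.univ), if_neg zero_ne_one, smul_zero, add_zero] at h
    obtain ⟨a₀, ha₀, -⟩ := hs.exists_homogeneous
    -- Independence is stated for a full family of coefficients, while the given ones concern `f_j`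
    -- only. The other columns are filled arbitrarily.
    let a₁ (i : Fin n) (l : Fin c) : SkewPoly q := if l = j then a i else a₀ i l
    have ha₁ : ∀ l, f l = ∑ i, a₁ i l * SkewPoly.x q i := fun l => by
      by_cases hl : l = j
      · subst hl; simpa [a₁] using ha
      · simpa [a₁, hl] using ha₀ l
    have hcyc : hs.dR (polyKoszulZ q) (hs.proj _ (hproj _ _ (1 + 1) b)) =
        cyc f (koszulVars q) id a₁ j := by
      rw [← hs.proj_d, ← h]
      refine (hs.proj_linComb (a := fun i _ => a' i) j).trans ?_
      unfold cyc
      congr 1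
      funext i
      simp [a₁, hmk]
    have := hs.eq_zero_of_comb_eq_dR hz ha₁ (α := Pi.single {j} 1)
      (b := hs.proj _ (hproj _ _ (1 + 1) b)) (by rw [Set.range_id]; exact mem_sub_univ _)
      (by rw [hcyc, comb_single, zprod_singleton (k := k), one_smul])
    have := congrFun this {j}
    rw [Pi.single_eq_same] at this
    exact one_ne_zero this
  refine ⟨hgγ, a', ?_, fun i => hPm _ _ _, hmk⟩
  rw [← hsum, hP _ _ _ (hgγ ▸ hs.mem j)]

end IsColorRegular

open SemiFree

namespace IsColorRegular

variable {k : Type u} [Field k] {n c : ℕ} {q : Fin n → Fin n → kˣ} {f : Fin c → SkewPoly q}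
  {δ : Fin c → ℕ} {γ : Fin c → ColorGroup q}
variable (hs : IsColorRegular f δ γ)

include hs

/-! ### The augmentation of a skew complete intersection -/

/-- The augmentation `R → k`. -/
def augR : SkewQuot f →ₐ[k] k := SkewQuot.lift (aug q) hs.aug_gen

theorem augR_x (i : Fin n) : hs.augR (SkewQuot.x f i) = 0 := aug_x i

theorem ker_augR : (RingHom.ker hs.augR : Submodule (SkewQuot f) (SkewQuot f)) =
    Submodule.span (SkewQuot f) (Set.range (SkewQuot.x f)) := by
  refine le_antisymm ?_ ?_
  · intro r hr
    obtain ⟨r, rfl⟩ := SkewQuot.mk_surjective r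
    have h0 : aug q r = 0 := hr
    obtain ⟨s, hs', h⟩ := exists_eq_aug_add r
    rw [h0, map_zero, zero_add] at h
    subst h
    clear hr h0
    induction hs' using Submodule.closure_induction with
    | zero => rw [map_zero]; exact zero_mem _
    | add r s _ _ hr hs => rw [map_add]; exact add_mem hr hs
    | smul_mem r _ h =>
      obtain ⟨i, rfl⟩ := h
      rw [smul_eq_mul, map_mul]
      exact Submodule.smul_mem _ _ (Submodule.subset_span ⟨i, rfl⟩)
  · rw [Submodule.span_le]
    rintro _ ⟨i, rfl⟩
    exact hs.augR_x i

/-- If the `f_j` have degree at least two, then the `x̄_i` minimally generate their ideal. -/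
theorem x_notMem_span (hδ : ∀ j, 2 ≤ δ j) (i₀ : Fin n) :
    SkewQuot.x f i₀ ∉ Submodule.span (SkewQuot f) (SkewQuot.x f '' {i | i ≠ i₀}) := by
  -- Send `x_{i₀}` to `ε` and the other variables to zero. Products of two variables vanish, so
  -- every `f_j` goes to zero because its degree is at least two. The map then separates `x̄_{i₀}`
  -- from the ideal of the others.
  let y (i : Fin n) : DualNumber k := if i = i₀ then DualNumber.eps else 0
  have hyy : ∀ i j, y i * y j = 0 := fun i j => by
    simp only [y]
    split_ifs <;> simp
  let Ψ₀ : SkewPoly q →ₐ[k] DualNumber k := SkewPoly.lift y fun i j => by rw [hyy, hyy, smul_zero]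
  have hΨ₀ : ∀ i, Ψ₀ (SkewPoly.x q i) = y i := fun i => SkewPoly.lift_x _ _ i
  let Ψ : SkewQuot f →ₐ[k] DualNumber k := SkewQuot.lift Ψ₀ fun j => by
    have h1 : f j ∈ SkewPoly.homog q (δ j) := Submodule.span_mono
      (by rintro _ ⟨l, hl, -, rfl⟩; exact ⟨l, hl, rfl⟩) (hs.mem j)
    generalize f j = r at h1 ⊢
    induction h1 using Submodule.span_induction with
    | mem a ha =>
      obtain ⟨l, hl, rfl⟩ := ha
      have := hδ j
      rcases l with - | ⟨i, - | ⟨i', l⟩⟩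
      · simp at hl; omega
      · simp at hl; omega
      · rw [List.map_cons, List.map_cons, List.prod_cons, List.prod_cons, map_mul, map_mul, hΨ₀,
          hΨ₀, ← mul_assoc, hyy, zero_mul]
    | zero => exact map_zero _
    | add a b _ _ ha hb => rw [map_add, ha, hb, add_zero]
    | smul r a _ ha => rw [map_smul, ha, smul_zero]
  have hΨ : ∀ i, Ψ (SkewQuot.x f i) = y i := hΨ₀
  intro h
  have h1 : ∀ r ∈ Submodule.span (SkewQuot f) (SkewQuot.x f '' {i | i ≠ i₀}), Ψ r = 0 := by
    intro r hr
    induction hr using Submodule.span_induction with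
    | mem a ha =>
      obtain ⟨i, hi, rfl⟩ := ha
      rw [hΨ]; exact if_neg hi
    | zero => exact map_zero _
    | add a b _ _ ha hb => rw [map_add, ha, hb, add_zero]
    | smul r a _ ha => rw [smul_eq_mul, map_mul, ha, mul_zero]
  have h2 := h1 _ h
  rw [hΨ] at h2
  simp only [y, if_true] at h2
  have := congrArg TrivSqZeroExt.snd h2
  rw [DualNumber.snd_eps] at this
  exact one_ne_zero this

/-! ### The extension of the Koszul complex by divided power variables -/

section Tate

variable {a : Fin n → Fin c → SkewPoly q} (ha : ∀ j, f j = ∑ i, a i j * SkewPoly.x q i)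
  (hom : ∀ i j, a i j ∈ SkewPoly.comp q (δ j - 1) (γ j * (rowColor q i)⁻¹))

omit hs in
/-- The differentials of the variables over the skew polynomial ring. -/
def polyTateZ (a : Fin n → Fin c → SkewPoly q) (δ : Fin c → ℕ) (γ : Fin c → ColorGroup q) :
    Fin (n + c) → SemiFree (polyData q) (tateVars q δ γ) :=
  Fin.append (fun i => SkewPoly.x q i • 1)
    (fun j => linComb (polyData q) (tateVars q δ γ) (Fin.castAdd c) fun i => a i j)

omit hs in
theorem polyTateZ_castAdd (i : Fin n) :
    polyTateZ a δ γ (Fin.castAdd c i) = SkewPoly.x q i • 1 := Fin.append_left _ _ i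

omit hs in
theorem polyTateZ_natAdd (j : Fin c) : polyTateZ a δ γ (Fin.natAdd n j) =
    linComb (polyData q) (tateVars q δ γ) (Fin.castAdd c) fun i => a i j := Fin.append_right _ _ j

omit hs in
theorem tateVars_hdeg_castAdd (i : Fin n) : (tateVars q δ γ).hdeg (Fin.castAdd c i) = 1 :=
  Fin.append_left (fun _ => 1) (fun _ => 2) i

omit hs in
theorem tateVars_hdeg_natAdd (j : Fin c) : (tateVars q δ γ).hdeg (Fin.natAdd n j) = 2 :=
  Fin.append_right (fun _ => 1) (fun _ => 2) j

omit hs in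
theorem tateVars_ideg_castAdd (i : Fin n) : (tateVars q δ γ).ideg (Fin.castAdd c i) = 1 :=
  Fin.append_left (fun _ => 1) δ i

omit hs in
theorem tateVars_ideg_natAdd (j : Fin c) : (tateVars q δ γ).ideg (Fin.natAdd n j) = δ j :=
  Fin.append_right (fun _ => 1) δ j

omit hs in
theorem tateVars_color_castAdd (i : Fin n) :
    (tateVars q δ γ).color (Fin.castAdd c i) = rowColor q i := Fin.append_left _ _ i

omit hs in
theorem tateVars_color_natAdd (j : Fin c) : (tateVars q δ γ).color (Fin.natAdd n j) = γ j :=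
  Fin.append_right _ _ j

theorem tateZ_eq : (fun v => hs.proj _ (polyTateZ a δ γ v)) = tateZ f a δ γ := by
  funext v
  cases v using Fin.addCases with
  | left i =>
    rw [polyTateZ_castAdd, hs.proj_smul, map_one, tateZ, Fin.append_left, incl_eq]; rfl
  | right j =>
    rw [polyTateZ_natAdd, hs.proj_linComb, tateZ, Fin.append_right]; rfl

theorem dR_tate : hs.dR (polyTateZ a δ γ) = d (tateZ f a δ γ) := by rw [dR, hs.tateZ_eq]

include hom in
theorem isKoszulPart_polyTateZ : IsKoszulPart (polyTateZ a δ γ) (Fin.castAdd c) where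
  isDiff v := by
    cases v using Fin.addCases with
    | left i =>
      refine ⟨0, tateVars_hdeg_castAdd i, ?_⟩
      rw [polyTateZ_castAdd, tateVars_ideg_castAdd, tateVars_color_castAdd]
      exact smul_one_mem_comp hs.good (SkewPoly.x_mem_comp i)
    | right j =>
      refine ⟨1, tateVars_hdeg_natAdd j, ?_⟩
      rw [polyTateZ_natAdd, tateVars_ideg_natAdd, tateVars_color_natAdd]
      have := linComb_mem_comp (V := tateVars q δ γ) (e := Fin.castAdd c) (g := γ j)
        (d := δ j - 1) (a := fun i => a i j) hs.good tateVars_hdeg_castAdd tateVars_ideg_castAdd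
        (fun i => by rw [tateVars_color_castAdd]; exact hom i j)
      rwa [Nat.sub_add_cancel (hs.pos j)] at this
  strictMono := Fin.strictMono_castAdd c
  hdeg := tateVars_hdeg_castAdd
  z_eq := polyTateZ_castAdd
  aug_eq v := by
    cases v using Fin.addCases with
    | left i =>
      rw [polyTateZ_castAdd, map_smul, cf_one_one, smul_eq_mul, mul_one, aug_x]
    | right j =>
      rw [polyTateZ_natAdd, cf_one_of_hdeg_ne (P := fun I : Mon (tateVars q δ γ) => I.hdeg = 1 ∧
        I.On (Set.range (Fin.castAdd c))) (fun I hI => by rw [hI.1]; exact one_ne_zero)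
        (linComb_mem_part tateVars_hdeg_castAdd _), map_zero]

include ha hom

/-- This is `tate_homology` for the whole sequence, carried down to the quotient: all variables are
then adjoined, and reduction kills the elements with coefficients in the ideal. -/
theorem exists_eq_dR_add_smul_one {x : SemiFree (colorData f) (tateVars q δ γ)}
    (hdx : hs.dR (polyTateZ a δ γ) x = 0) :
    ∃ b, ∃ α : k, x = hs.dR (polyTateZ a δ γ) b + α • 1 := by
  have hz := hs.isKoszulPart_polyTateZ hom
  obtain ⟨y, -, rfl⟩ := hs.exists_proj_eq (mem_sub_univ x)
  rw [← hs.proj_d, hs.proj_eq_zero] at hdx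
  have huniv : Set.range (Fin.castAdd c : Fin n → _) ∪ Fin.natAdd n '' {j : Fin c | j.val < c} =
      Set.univ := by
    refine Set.eq_univ_of_forall fun v => ?_
    cases v using Fin.addCases with
    | left i => exact Or.inl ⟨i, rfl⟩
    | right j => exact Or.inr ⟨j, j.2, rfl⟩
  obtain ⟨b, -, α, u, hu, h⟩ := tate_homology hs.skew hs.mem hs.regular hz.isDiff hs.aug_gen
    hz.aug_eq hz.strictMono hz.hdeg hz.z_eq (w := Fin.natAdd n) (Fin.strictMono_natAdd n)
    (fun i j => by rw [Fin.lt_def, Fin.val_castAdd, Fin.val_natAdd]; omega)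
    (fun j => by rw [tateVars_hdeg_natAdd]; decide)
    (fun j => by
      rw [polyTateZ_natAdd]; exact part_le_sub _ 1 (linComb_mem_part hz.hdeg _))
    (fun j => by rw [polyTateZ_natAdd]; exact inv_linComb hz.hdeg _)
    (fun j => by rw [polyTateZ_natAdd]; exact hs.d_lift hz ha j) c le_rfl
    (a := y) (by rw [huniv]; exact mem_sub_univ y) hdx
  refine ⟨hs.proj _ b, α, ?_⟩
  rw [h, map_add, map_add, hs.proj_eq_zero.mpr hu, add_zero, hs.proj_d]
  congr 1
  exact (map_smul_field _ _ _ α 1).trans (by rw [map_one])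

theorem exists_eq_dR_of_pos {m : ℕ} (hm : 1 ≤ m) {x : SemiFree (colorData f) (tateVars q δ γ)}
    (hx : x ∈ part (colorData f) (tateVars q δ γ) Set.univ m)
    (hdx : hs.dR (polyTateZ a δ γ) x = 0) :
    ∃ b ∈ part (colorData f) (tateVars q δ γ) Set.univ (m + 1),
      x = hs.dR (polyTateZ a δ γ) b := by
  have hz := hs.isKoszulPart_polyTateZ hom
  obtain ⟨b, α, h⟩ := hs.exists_eq_dR_add_smul_one ha hom hdx
  refine ⟨hproj _ _ (m + 1) b, hproj_mem_part (mem_sub_univ b) _, ?_⟩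
  have := congrArg (hproj (colorData f) (tateVars q δ γ) m) h
  rwa [hproj_of_mem_part hx, if_pos rfl, map_add, hproj_d hs.good' (hs.isDiff_proj hz.isDiff),
    hproj_field_smul, hproj_of_mem_part (one_mem_part Set.univ), if_neg (by omega), smul_zero,
    add_zero] at this

end Tate

end IsColorRegular

open SemiFree

namespace SemiFree

section

set_option linter.unusedSectionVars false

variable {k : Type u} [Field k] {G : Type v} [CommGroup G] {R : Type w} [Ring R] [Algebra k R]
variable {ι : Type t} [Fintype ι] [LinearOrder ι]
variable {C : ColorData k G R} {V : Vars G ι} {z : ι → SemiFree C V}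

theorem IsDiff.hdeg_pos (hz : IsDiff C V z) (v : ι) : 0 < V.hdeg v := by
  obtain ⟨h, hh, -⟩ := hz v; omega

theorem eq_smul_one_of_mem_part_zero (hz : IsDiff C V z) {S : Set ι} {a : SemiFree C V}
    (ha : a ∈ part C V S 0) : a = cf C (Mon.one V) a • 1 := by
  classical
  rw [part_eq_supp] at ha
  induction ha using supp_induction with
  | zero => simp
  | add a a' _ _ h h' =>
    rw [map_add, add_smul]
    nth_rewrite 1 [h, h']
    rfl
  | term I r hI =>
    have : I = Mon.one V := Mon.ext (funext fun v =>
      (Nat.mul_eq_zero.mp ((Finset.sum_eq_zero_iff.mp hI.1) v (Finset.mem_univ v))).resolve_right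
        (hz.hdeg_pos v).ne')
    rw [this, cf_term, if_pos rfl, term_eq_smul, one_def]

end

end SemiFree

namespace IsColorRegular

variable {k : Type u} [Field k] {n c : ℕ} {q : Fin n → Fin n → kˣ} {f : Fin c → SkewPoly q}
  {δ : Fin c → ℕ} {γ : Fin c → ColorGroup q}
variable (hs : IsColorRegular f δ γ) {a : Fin n → Fin c → SkewPoly q}
  (ha : ∀ j, f j = ∑ i, a i j * SkewPoly.x q i)
  (hom : ∀ i j, a i j ∈ SkewPoly.comp q (δ j - 1) (γ j * (rowColor q i)⁻¹))

theorem tateZ_castAdd (i : Fin n) : tateZ f a δ γ (Fin.castAdd c i) =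
    incl (colorData f) (tateVars q δ γ) (SkewQuot.x f i) := Fin.append_left _ _ i

theorem tateZ_natAdd (j : Fin c) : tateZ f a δ γ (Fin.natAdd n j) =
    cyc f (tateVars q δ γ) (Fin.castAdd c) a j := Fin.append_right _ _ j

theorem setOf_hdeg_le_one : {v | (tateVars q δ γ).hdeg v ≤ 1} = Set.range (Fin.castAdd c) := by
  ext v
  cases v using Fin.addCases with
  | left i => simp [tateVars_hdeg_castAdd]
  | right j =>
    simp only [Set.mem_ofPred_eq, tateVars_hdeg_natAdd, Set.mem_range]
    refine ⟨fun h => absurd h (by omega), ?_⟩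
    rintro ⟨i, hi⟩
    have := congrArg (tateVars q δ γ).hdeg hi
    rw [tateVars_hdeg_castAdd, tateVars_hdeg_natAdd] at this
    omega

theorem hdeg_le_two (v : Fin (n + c)) : (tateVars q δ γ).hdeg v ≤ 2 := by
  cases v using Fin.addCases with
  | left i => rw [tateVars_hdeg_castAdd]; omega
  | right j => rw [tateVars_hdeg_natAdd]

theorem exists_eq_castAdd {v : Fin (n + c)} (hv : (tateVars q δ γ).hdeg v = 1) :
    ∃ i, Fin.castAdd c i = v := by
  cases v using Fin.addCases with
  | left i => exact ⟨i, rfl⟩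
  | right j => rw [tateVars_hdeg_natAdd] at hv; omega

theorem exists_eq_natAdd {v : Fin (n + c)} (hv : (tateVars q δ γ).hdeg v = 2) :
    ∃ j, Fin.natAdd n j = v := by
  cases v using Fin.addCases with
  | left i => rw [tateVars_hdeg_castAdd] at hv; omega
  | right j => exact ⟨j, rfl⟩

theorem incl_injective {V : Vars (ColorGroup q) (Fin (n + c))} :
    Function.Injective (incl (colorData f) V) := Finsupp.single_injective _

include hs

include hom in
theorem isDiff_tateZ : IsDiff (colorData f) (tateVars q δ γ) (tateZ f a δ γ) := by
  rw [← hs.tateZ_eq]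
  exact hs.isDiff_proj (hs.isKoszulPart_polyTateZ hom).isDiff

include hom in
theorem tate_d_var (v : Fin (n + c)) :
    d (tateZ f a δ γ) (var (colorData f) (tateVars q δ γ) v) = tateZ f a δ γ v :=
  d_var hs.good' (hs.isDiff_tateZ hom) v

include hom in
theorem span_tate_one (s : Set (Fin n)) {κ : Type*} {v : κ → Fin (n + c)}
    (hv : Set.range v = Fin.castAdd c '' s) :
    Submodule.span (SkewQuot f)
      (Set.range fun l => d (tateZ f a δ γ) (var (colorData f) (tateVars q δ γ) (v l))) =
    (Submodule.span (SkewQuot f) (SkewQuot.x f '' s)).map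
      (incl (colorData f) (tateVars q δ γ)) := by
  rw [Submodule.map_span, ← Set.image_comp]
  congr 1
  simp_rw [hs.tate_d_var hom]
  ext x
  constructor
  · rintro ⟨l, rfl⟩
    obtain ⟨i, hi, h⟩ := hv.subset ⟨l, rfl⟩
    exact ⟨i, hi, by dsimp only; rw [← h, tateZ_castAdd]; rfl⟩
  · rintro ⟨i, hi, rfl⟩
    obtain ⟨l, h⟩ := hv.superset ⟨i, hi, rfl⟩
    exact ⟨l, by dsimp only; rw [h, tateZ_castAdd]; rfl⟩

include ha hom

theorem d_tateZ (v : Fin (n + c)) : d (tateZ f a δ γ) (tateZ f a δ γ v) = 0 := by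
  cases v using Fin.addCases with
  | left i => rw [tateZ_castAdd, incl_eq, d_smul_one]
  | right j =>
    rw [tateZ_natAdd, ← hs.dR_tate]
    exact hs.dR_cyc (hs.isKoszulPart_polyTateZ hom) ha j

omit ha in
theorem tate_homology_zero : boundaries (tateZ f a δ γ) Set.univ 0 =
    Submodule.map (incl (colorData f) (tateVars q δ γ)) (RingHom.ker hs.augR) := by
  have hz := hs.isKoszulPart_polyTateZ hom
  have hD := hs.isDiff_tateZ hom
  refine le_antisymm ?_ ?_
  · rintro _ ⟨b, hb, rfl⟩
    have h1 : d (tateZ f a δ γ) b ∈ part (colorData f) (tateVars q δ γ) Set.univ 0 :=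
      d_mem_part hs.good' hD (fun v _ => by
        obtain ⟨h, hh, hv⟩ := hD v
        exact ⟨h, hh, mem_part_of_mem_comp hv⟩) hb
    refine ⟨cf _ (Mon.one _) (d (tateZ f a δ γ) b), ?_, ?_⟩
    rotate_left
    · rw [incl_eq]; exact (eq_smul_one_of_mem_part_zero hD h1).symm
    · refine map_cf_one_d hs.augR (fun v => ?_) b
      rw [← hs.tateZ_eq, hs.cf_proj]
      exact hz.aug_eq v
  · rintro _ ⟨r, hr, rfl⟩
    obtain ⟨r, rfl⟩ := SkewQuot.mk_surjective r
    have h0 : aug q r = 0 := hr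
    obtain ⟨s, hs', h⟩ := exists_eq_aug_add r
    rw [h0, map_zero, zero_add] at h
    subst h
    obtain ⟨b, hb, h⟩ := hs.exists_dR_eq_smul hz (one_mem_sub _) d_one hs'
    rw [hs.dR_tate] at h
    refine ⟨hproj _ _ 1 b, hproj_mem_part (mem_sub_univ b) 1, ?_⟩
    rw [← hproj_d hs.good' hD, h, map_smul, hproj_of_mem_part (one_mem_part Set.univ), if_pos rfl,
      incl_eq]

/-- The index type `κ` stands for the subtype of variables of degree two; the hypotheses make `v` a
bijection onto the variables `y_{n+j}`. -/
theorem tate_gen_one {κ : Type*} [Fintype κ] {v : κ → Fin (n + c)}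
    (hv : Function.Injective v) (hr : ∀ j, ∃ l, v l = Fin.natAdd n j)
    (hd : ∀ l, (tateVars q δ γ).hdeg (v l) = 2) :
    GeneratesHomology (tateZ f a δ γ) {v | (tateVars q δ γ).hdeg v ≤ 1} 1
      (fun l => d (tateZ f a δ γ) (var (colorData f) (tateVars q δ γ) (v l))) := by
  have hz := hs.isKoszulPart_polyTateZ hom
  rw [setOf_hdeg_le_one]
  simp_rw [hs.tate_d_var hom]
  choose σ hσ using hr
  have hbij : Function.Bijective σ := by
    refine ⟨fun j j' h => ?_, fun l => ?_⟩
    · have := congrArg v h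
      rw [hσ, hσ] at this
      exact (Fin.strictMono_natAdd n).injective this
    · obtain ⟨j, hj⟩ := exists_eq_natAdd (hd l)
      exact ⟨j, hv (by rw [hσ, hj])⟩
  have hcyc : ∀ j, tateZ f a δ γ (v (σ j)) = cyc f (tateVars q δ γ) (Fin.castAdd c) a j :=
    fun j => by rw [hσ, tateZ_natAdd]
  refine generatesHomology_of (fun l => ?_) fun x hx => ?_
  · obtain ⟨j, rfl⟩ := hbij.2 l
    refine ⟨?_, hs.d_tateZ ha hom _⟩
    rw [hcyc]
    exact cyc_mem_part hz j
  · have h2 : hs.dR (polyTateZ a δ γ) x = 0 := by rw [hs.dR_tate]; exact hx.2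
    obtain ⟨b, hb, β, h⟩ := hs.exists_eq_dR_add_sum hz ha hx.1 h2
    let e := Equiv.ofBijective σ hbij
    refine ⟨b, hb, fun l => algebraMap k _ (β (e.symm l)), ?_⟩
    rw [h, hs.dR_tate, ← hbij.sum_comp]
    congr 1
    refine Finset.sum_congr rfl fun j _ => ?_
    rw [hcyc, algebraMap_smul, show e.symm (σ j) = j from e.symm_apply_apply j]

/-- If the other classes generated the one with index `j₀`, there would be a relation in which it
has coefficient one, against `aug_eq_zero_of_sum_eq_dR`. -/
theorem tate_min_one {κ : Type*} [Fintype κ] {v : κ → Fin (n + c)} {j₀ : Fin c}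
    (hr : ∀ l, v l ≠ Fin.natAdd n j₀) (hd : ∀ l, (tateVars q δ γ).hdeg (v l) = 2) :
    ¬ GeneratesHomology (tateZ f a δ γ) {v | (tateVars q δ γ).hdeg v ≤ 1} 1
      (fun l => d (tateZ f a δ γ) (var (colorData f) (tateVars q δ γ) (v l))) := by
  classical
  have hz := hs.isKoszulPart_polyTateZ hom
  rw [setOf_hdeg_le_one]
  simp_rw [hs.tate_d_var hom]
  intro hgen
  have hx : cyc f (tateVars q δ γ) (Fin.castAdd c) a j₀ ∈
      cycles (tateZ f a δ γ) (Set.range (Fin.castAdd c)) 1 :=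
    ⟨cyc_mem_part hz j₀, by
      rw [← tateZ_natAdd (γ := γ)]; exact hs.d_tateZ ha hom _⟩
  obtain ⟨y, hy, r, h⟩ := hgen.exists_eq hx
  choose σ hσ using fun l => exists_eq_natAdd (hd l)
  choose s hs' using fun l => SkewQuot.mk_surjective (r l)
  have hne : ∀ l, σ l ≠ j₀ := fun l hl => hr l (by rw [← hσ, hl])
  -- The relation is rewritten as a sum over all `j`. The inner sum collects the coefficients of the
  -- given family at `j` and is empty of contributions at `j₀`.
  have h1 : ∑ j, SkewQuot.mk f ((if j = j₀ then 1 else 0) - ∑ l, if σ l = j then s l else 0) •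
      cyc f (tateVars q δ γ) (Fin.castAdd c) a j = hs.dR (polyTateZ a δ γ) y := by
    rw [hs.dR_tate, ← sub_eq_of_eq_add h]
    simp_rw [map_sub, sub_smul, Finset.sum_sub_distrib, map_sum, Finset.sum_smul]
    rw [Finset.sum_comm (s := Finset.univ (α := Fin c)) (t := Finset.univ (α := κ))]
    congr 1
    · rw [Finset.sum_eq_single j₀]
      · rw [if_pos rfl, map_one, one_smul]
      · intro j _ hj; rw [if_neg hj, map_zero, zero_smul]
      · simp
    · refine Finset.sum_congr rfl fun l _ => ?_
      rw [Finset.sum_eq_single (σ l)]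
      · rw [if_pos rfl, hs', ← tateZ_natAdd (γ := γ), hσ]
      · intro j _ hj; rw [if_neg hj.symm, map_zero, zero_smul]
      · simp
  have h2 := hs.aug_eq_zero_of_sum_eq_dR hz ha (part_le_sub _ _ hy) h1 j₀
  rw [if_pos rfl, Finset.sum_eq_zero fun l _ => if_neg (hne l), sub_zero, map_one] at h2
  exact one_ne_zero h2

theorem isAcyclicClosure (hδ : ∀ j, 2 ≤ δ j) : IsAcyclicClosure (tateZ f a δ γ) hs.augR where
  isColorDGA := isColorDGA hs.good' (hs.isDiff_tateZ hom) (hs.d_tateZ ha hom)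
  hdeg_pos := (hs.isDiff_tateZ hom).hdeg_pos
  surjective r := ⟨algebraMap k _ r, hs.augR.commutes r⟩
  gen_zero := by
    rw [hs.span_tate_one hom Set.univ, Set.image_univ, hs.ker_augR]
    ext v
    simp only [Set.mem_range, Subtype.exists, exists_prop, exists_eq_right, Set.image_univ]
    exact ⟨fun hv => exists_eq_castAdd hv, by rintro ⟨i, rfl⟩; exact tateVars_hdeg_castAdd i⟩
  min_zero := by
    rintro ⟨v₀, hv₀⟩
    obtain ⟨i₀, rfl⟩ := exists_eq_castAdd hv₀
    rw [hs.span_tate_one hom {i | i ≠ i₀}]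
    · intro h
      have h1 := Submodule.map_injective_of_injective incl_injective h
      refine hs.x_notMem_span hδ i₀ ?_
      rw [h1]
      exact hs.augR_x i₀
    · ext v
      constructor
      · rintro ⟨⟨⟨v, hv⟩, hne⟩, rfl⟩
        obtain ⟨i, rfl⟩ := exists_eq_castAdd hv
        exact ⟨i, fun h => hne (by subst h; rfl), rfl⟩
      · rintro ⟨i, hi, rfl⟩
        refine ⟨⟨⟨Fin.castAdd c i, tateVars_hdeg_castAdd i⟩, fun h => hi ?_⟩, rfl⟩
        exact (Fin.strictMono_castAdd c).injective (congrArg Subtype.val h)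
  gen_succ m hm := by
    rcases Nat.eq_or_lt_of_le hm with rfl | hm'
    · exact hs.tate_gen_one ha hom Subtype.val_injective
        (fun j => ⟨⟨Fin.natAdd n j, tateVars_hdeg_natAdd j⟩, rfl⟩) (fun l => l.2)
    -- For `m ≥ 2` all variables have been adjoined and none has degree `m + 1`, so the empty family
    -- has to generate. This is the vanishing of the homology.
    · have hu : {v | (tateVars q δ γ).hdeg v ≤ m} = Set.univ :=
        Set.eq_univ_of_forall fun v => (hdeg_le_two v).trans hm'
      rw [hu]
      refine generatesHomology_of (fun v => ?_) fun x hx => ?_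
      · exact absurd (hdeg_le_two v.1) (by rw [v.2]; omega)
      · obtain ⟨b, hb, h⟩ := hs.exists_eq_dR_of_pos ha hom hm hx.1
          (by rw [hs.dR_tate]; exact hx.2)
        refine ⟨b, hb, 0, ?_⟩
        rw [h, hs.dR_tate]
        simp
  min_succ m hm := by
    rintro ⟨v₀, hv₀⟩
    rcases Nat.eq_or_lt_of_le hm with rfl | hm'
    · obtain ⟨j₀, rfl⟩ := exists_eq_natAdd hv₀
      exact hs.tate_min_one ha hom (fun l h => l.2 (Subtype.ext h)) (fun l => l.1.2)
    · exact absurd (hdeg_le_two v₀) (by rw [hv₀]; omega)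
  homology_zero := hs.tate_homology_zero hom
  homology_pos m hm := by
    rw [Submodule.Quotient.subsingleton_iff, eq_top_iff]
    rintro ⟨x, hx⟩ -
    obtain ⟨b, hb, h⟩ := hs.exists_eq_dR_of_pos ha hom hm hx.1 (by rw [hs.dR_tate]; exact hx.2)
    exact ⟨b, hb, by rw [← hs.dR_tate]; exact h.symm⟩

omit ha hom in
-- The extension depends on the coefficients only through their images in the quotient, so
-- homogeneous lifts may be used, and the given colours are necessarily those of the `f_j`.
theorem exists_isAcyclicClosure {a : Fin n → Fin c → SkewPoly q}
    (ha : ∀ j, f j = ∑ i, a i j * SkewPoly.x q i) (hδ : ∀ j, 2 ≤ δ j) {g : Fin c → ColorGroup q}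
    (hg : ∀ j, koszulCycle f a j ∈ comp (colorData f) (koszulVars q) 1 (δ j) (g j)) :
    IsAcyclicClosure (tateZ f a δ g) hs.augR := by
  choose hgγ a' ha' hom hmk using fun j => hs.exists_homogeneous_lift j (ha j) (hg j)
  obtain rfl : g = γ := funext hgγ
  have e : tateZ f a δ g = tateZ f (fun i j => a' j i) δ g := by
    unfold tateZ
    simp_rw [hmk]
  rw [e]
  exact hs.isAcyclicClosure ha' (fun i j => hom j i) hδ

end IsColorRegular

end SkewKoszul

end

/-! ### The main theorem -/

open SkewKoszul
theorem mainTheorem4 {k : Type*} [Field k] (n c : ℕ) (q : Fin n → Fin n → kˣ)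
    (hq_diag : ∀ i, q i i = 1) (hq_anti : ∀ i j, q i j * q j i = 1)
    (f : Fin c → SkewPoly q) (δ : Fin c → ℕ) (hδ : ∀ j, 1 ≤ δ j)
    (hf_homog : ∀ j, f j ∈ SkewPoly.homog q (δ j))
    (hf_normal : ∀ j, IsNormal (f j)) (hf_reg : IsRegularSeq f) :
    -- the Koszul complex is a colour DG algebra
    ∃ K : IsColorDGA (bichar q) (SemiFree.comp (colorData f) (koszulVars q))
        ((SemiFree.d (koszulZ f)).restrictScalars k),
      -- the coefficients can be chosen so that the cycles are trihomogeneous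
      (∃ a : Fin n → Fin c → SkewPoly q, (∀ j, f j = ∑ i, a i j * SkewPoly.x q i) ∧
        ∀ j, ∃ g, koszulCycle f a j ∈ SemiFree.comp (colorData f) (koszulVars q) 1 (δ j) g) ∧
      ∀ a : Fin n → Fin c → SkewPoly q, (∀ j, f j = ∑ i, a i j * SkewPoly.x q i) →
        -- the cycles generate the first Koszul homology
        SemiFree.GeneratesHomology (koszulZ f) Set.univ 1 (koszulCycle f a) ∧
        -- the Koszul homology algebra is a skew exterior algebra on their classes
        (∃ p : Fin c → Fin c → kˣ, (∀ i, p i i = 1) ∧ (∀ i j, p i j * p j i = 1) ∧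
          ∃ φ : SkewExterior p ≃ₐ[k] K.HomologyAlg, ∀ j, ∃ hz : koszulCycle f a j ∈ K.cycleAlg,
            φ (SkewQuot.x _ j) = K.cls ⟨koszulCycle f a j, hz⟩) ∧
        -- killing them by divided power variables gives an acyclic closure of `k` over `R`
        ((∀ j, 2 ≤ δ j) → ∀ g : Fin c → ColorGroup q,
          (∀ j, koszulCycle f a j ∈
            SemiFree.comp (colorData f) (koszulVars q) 1 (δ j) (g j)) →
          ∃ ε : SkewQuot f →ₐ[k] k, (∀ i, ε (SkewQuot.x f i) = 0) ∧
            SemiFree.IsAcyclicClosure (tateZ f a δ g) ε) := by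
  obtain ⟨γ, hs⟩ := IsColorRegular.exists_of_isNormal ⟨hq_diag, hq_anti⟩ hδ hf_homog hf_normal hf_reg
  refine ⟨hs.koszul_isColorDGA, ?_, fun a ha => ⟨hs.generatesHomology_koszulCycle ha, ?_, ?_⟩⟩
  · obtain ⟨a, ha, hom⟩ := hs.exists_homogeneous
    exact ⟨a, ha, fun j => ⟨γ j, hs.koszulCycle_mem_comp fun i => hom i j⟩⟩
  · have hp := IsColorRegular.isSkewMatrix_homologyMatrix (γ := γ) hs.skew
    exact ⟨_, hp.diag, hp.anti, hs.exists_homology_equiv ha hs.koszul_isColorDGA⟩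
  · exact fun hδ2 g hg => ⟨hs.augR, hs.augR_x, hs.exists_isAcyclicClosure ha hδ2 hg⟩
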